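/- Let $d\ge 1$ and let $\mathcal L\subset\mathbb R^d$ be uniformly discrete (there is $r>0$ with $|x-y|\ge r$ for all distinct $x,y\in\mathcal L$) and $T$-periodic for some integer $T\ge 1$, i.e. $\mathcal L+Tz=\mathcal L$ for all $z\in\mathbb Z^d$. Let $c\colon\mathcal L\times\mathcal L\to[0,+\infty)$, $(i,j)\mapsto c_{i,j}$, satisfy $c_{i+Tz,j+Tz}=c_{i,j}$ for all $i,j\in\mathcal L$, $z\in\mathbb Z^d$, and $\sum_{j\in\mathcal L}c_{i,j}|i-j|<+\infty$ for all $i\in\mathcal L$. For $u\colon\mathcal L\to\mathbb R$ and $A\subset\mathbb R^d$ put $$E(u,A)=\sum_{i\in\mathcal L\cap A}\ \sum_{j\in\mathcal L}c_{i,j}\,(u(i)-u(j))^+ .$$ For a unit vector $\nu$ let $u_\nu(x)=1$ if $\langle\nu,x\rangle\ge 0$ and $u_\nu(x)=0$ otherwise, and let $Q^\nu_\rho=R^\nu\big([-\rho/2,\rho/2)^d\big)$, where $R^\nu$ is a linear isometry of $\mathbb R^d$ with $R^\nu e_d=\nu$. Then there is exactly one convex function $\varphi\colon\mathbb R^d\to[0,+\infty)$,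 positively homogeneous of degree one, such that for every unit vector $\nu$ and every choice of $R^\nu$ $$\varphi(\nu)=\lim_{\delta\to0^+}\ \lim_{S\to+\infty}\frac1{S^{d-1}}\inf\Big\{E(u,Q^\nu_S)\colon u\colon\mathcal L\to\{0,1\},\ u(i)=u_\nu(i)\text{ for all } i\in\mathcal L\setminus Q^\nu_{(1-\delta)S}\Big\},$$ where the inner limit exists for every $\delta\in(0,1)$ and the outer limit exists (the homogenized surface energy density). Moreover, $\varphi$ is differentiable at every totally irrational $\nu\in\mathbb R^d$, i.e. at every $\nu$ such that $\langle q,\nu\rangle\ne 0$ for all $q\in\mathbb Z^d\setminus\{0\}$. -/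

import Mathlib

open Filter Topology
open scoped ENNReal NNReal

namespace SpinLattice

/-- The integer vector `z`, seen in `ℝ^d` with its Euclidean structure. -/
noncomputable def intVec {d : ℕ} (z : Fin d → ℤ) : EuclideanSpace ℝ (Fin d) :=
  WithLp.toLp 2 (fun k => (z k : ℝ))

/-- Discreteness of the point set `L`: distinct points are at distance at least some `r > 0`. -/
def Discrete {d : ℕ} (L : Set (EuclideanSpace ℝ (Fin d))) : Prop :=
  ∃ r : ℝ, 0 < r ∧ ∀ x ∈ L, ∀ y ∈ L, y ≠ x → r ≤ dist x y

/-- Periodicity of the point set: `L + T z = L` for every integer vector `z`. -/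
def Periodic {d : ℕ} (L : Set (EuclideanSpace ℝ (Fin d))) (T : ℕ) : Prop :=
  ∀ z : Fin d → ℤ, (fun x => x + (T : ℝ) • intVec z) '' L = L

/-- Periodicity of the coefficients: `c (i + T z) (j + T z) = c i j` for all `i, j ∈ L` and all
integer vectors `z` (`i'` and `j'` are the translated points, as elements of `L`). -/
def PeriodicCoeff {d : ℕ} (L : Set (EuclideanSpace ℝ (Fin d))) (T : ℕ) (c : L → L → ℝ≥0) : Prop :=
  ∀ (z : Fin d → ℤ) (i j i' j' : L),
    (i' : EuclideanSpace ℝ (Fin d)) = i + (T : ℝ) • intVec z →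
    (j' : EuclideanSpace ℝ (Fin d)) = j + (T : ℝ) • intVec z →
    c i' j' = c i j

/-- Decay of interactions: `∑_j c i j * |i - j| < ∞` for every `i ∈ L`. -/
def DecayingCoeff {d : ℕ} (L : Set (EuclideanSpace ℝ (Fin d))) (c : L → L → ℝ≥0) : Prop :=
  ∀ i : L, Summable fun j : L =>
    (c i j : ℝ) * ‖(i : EuclideanSpace ℝ (Fin d)) - (j : EuclideanSpace ℝ (Fin d))‖

/-- The localized energy `E(u, A) = ∑_{i ∈ L ∩ A} ∑_{j ∈ L} c i j (u i - u j)^+`,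
as a sum of nonnegative terms with values in `[0, ∞]`. -/
noncomputable def energy {d : ℕ} (L : Set (EuclideanSpace ℝ (Fin d))) (c : L → L → ℝ≥0)
    (u : L → ℝ) (A : Set (EuclideanSpace ℝ (Fin d))) : ℝ≥0∞ :=
  ∑' i : {i : L // (i : EuclideanSpace ℝ (Fin d)) ∈ A}, ∑' j : L,
    (c i.1 j : ℝ≥0∞) * ENNReal.ofReal (max (u i.1 - u j) 0)

/-- The half-open cube `[-ρ/2, ρ/2)^d`. -/
def cube (d : ℕ) (ρ : ℝ) : Set (EuclideanSpace ℝ (Fin d)) :=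
  {x | ∀ k, -ρ / 2 ≤ x k ∧ x k < ρ / 2}

/-- The last vector `e_d` of the standard basis of `ℝ^d`, `d ≥ 1`. -/
noncomputable def lastBasisVec (d : ℕ) [NeZero d] : EuclideanSpace ℝ (Fin d) :=
  EuclideanSpace.single ⟨d - 1, Nat.sub_lt (NeZero.pos d) one_pos⟩ 1

/-- The indicator function `u_ν` of the half space `{x | ⟨ν, x⟩ ≥ 0}`. -/
noncomputable def halfSpace {d : ℕ} (ν x : EuclideanSpace ℝ (Fin d)) : ℝ :=
  open Classical in if 0 ≤ inner ℝ ν x then 1 else 0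

/-- The infimum of `E(u, R Q_S)` over all `u : L → {0, 1}` with `u = u_ν` on
`L` outside of `R Q_{(1 - δ) S}`. -/
noncomputable def cellInf {d : ℕ} (L : Set (EuclideanSpace ℝ (Fin d))) (c : L → L → ℝ≥0)
    (R : EuclideanSpace ℝ (Fin d) ≃ₗᵢ[ℝ] EuclideanSpace ℝ (Fin d))
    (ν : EuclideanSpace ℝ (Fin d)) (δ S : ℝ) : ℝ≥0∞ :=
  ⨅ u ∈ {u : L → ℝ | (∀ i, u i = 0 ∨ u i = 1) ∧
      ∀ i : L, (i : EuclideanSpace ℝ (Fin d)) ∉ R '' cube d ((1 - δ) * S) → u i = halfSpace ν i},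
    energy L c u (R '' cube d S)

/-- `φ` is the homogenized surface energy density of the interaction `c` on `L`: the convex,
positively one-homogeneous function `φ : ℝ^d → [0, ∞)` with
`φ ν = lim_{δ → 0} lim_{S → ∞} S^{1-d} inf {E(u, Q^ν_S) | …}` for every unit vector `ν`, where
`Q^ν_S = R Q_S` for a linear isometry `R` with `R e_d = ν`. Both limits are required to exist, and
the value must not depend on the choice of `R`. The function `g` is the inner limit. -/
structure IsSurfaceDensity {d : ℕ} [NeZero d] (L : Set (EuclideanSpace ℝ (Fin d)))
    (c : L → L → ℝ≥0) (φ : EuclideanSpace ℝ (Fin d) → ℝ) : Prop where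
  nonneg : ∀ x, 0 ≤ φ x
  convex : ConvexOn ℝ Set.univ φ
  homogeneous : ∀ (t : ℝ) (x : EuclideanSpace ℝ (Fin d)), 0 < t → φ (t • x) = t * φ x
  limit : ∀ ν : EuclideanSpace ℝ (Fin d), ‖ν‖ = 1 →
    ∀ R : EuclideanSpace ℝ (Fin d) ≃ₗᵢ[ℝ] EuclideanSpace ℝ (Fin d), R (lastBasisVec d) = ν →
      ∃ g : ℝ → ℝ≥0∞,
        (∀ δ : ℝ, 0 < δ → δ < 1 →
          Tendsto (fun S : ℝ => cellInf L c R ν δ S / ENNReal.ofReal (S ^ (d - 1)))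
            atTop (𝓝 (g δ))) ∧
        Tendsto g (𝓝[>] 0) (𝓝 (ENNReal.ofReal (φ ν)))

/-- `ν` is totally irrational: no nonzero integer vector is orthogonal to it. -/
def TotallyIrrational {d : ℕ} (ν : EuclideanSpace ℝ (Fin d)) : Prop :=
  ∀ q : Fin d → ℤ, q ≠ 0 → inner ℝ (intVec q) ν ≠ 0

end SpinLattice

/-! Modulo the period lattice, the interactions form a weighted graph with finitely many vertex
classes and countably many edges κ = (k, l, w), each with a weight C κ and a vector D κ from target
to source. The density is the cell formula φ(ν) = T^(-d) inf_ω Σ_κ C κ (⟨ν, D κ⟩ + ω k - ω l)⁺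
(`cellDensity`). It is sublinear in ν, hence convex and homogeneous.

Upper bound: inside the smaller cube take the superlevel set of ⟨ν, ·⟩ + ω. Edges of class κ leave
it with density (jump)⁺ / T^d. This equidistribution needs the heights of lattice translations to be
dense in ℝ, or the jumps to be such heights; in the discrete case a randomly shifted rounding of ω
achieves this at no cost (`exists_admissible_le`). Lower bound: Hahn–Banach gives a calibration
(`exists_calibration`), that is, weights 0 ≤ α ≤ C that annihilate all gradients and attain the
infimum when paired with ⟨ν, D⟩. A competitor has C (u i - u j)⁺ ≥ α (u i - u j) and differs from
the half space at finitely many sites; this difference sums to a gradient, which α does not see.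
Edges at the lateral boundary, and edges that jump over the gap between the two cubes, contribute
o(S^(d-1)), with the finite first moment as majorant. With r = 1 - δ the inner limit
(`tendsto_iInf_dropCount`) is r^(d-1) φ(ν) plus (1 - r^(d-1)) times a flat energy that does not
depend on δ; the latter disappears as δ → 0.

Differentiability: the calibration at ν is a supporting linear functional, and for a convex function
it suffices to control rays. A minimising ω need not exist, but it does after dropping the edges
whose jump diverges to -∞ along a minimising sequence (`exists_attained_truncation`). Since t ↦ t⁺
is smooth off 0, only edges with zero jump could create a corner. For totally irrational ν the
height of a translation determines the translation, so every direction ξ admits a potential whose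
ξ-jumps vanish on exactly those critical edges (`exists_compatible_potential`), and the second
difference along ξ is o(a). -/

namespace SpinLattice

/-! ### The cell functional on a weighted graph and its dual calibration. -/

section CellFunctional

variable {I K : Type*}

/-- The sum of the positive parts of `δ` with weights `C`. -/
noncomputable def posSum (C δ : I → ℝ) : ℝ := ∑' κ, C κ * max (δ κ) 0

/-- The difference of a potential `ω` between the two endpoints of each edge. -/
def grad (s t : I → K) (ω : K → ℝ) : I → ℝ := fun κ => ω (s κ) - ω (t κ)

/-- The infimum of `posSum` over all perturbations by gradients. -/
noncomputable def relaxed (C : I → ℝ) (s t : I → K) (δ : I → ℝ) : ℝ :=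
  ⨅ ω : K → ℝ, posSum C (δ + grad s t ω)

theorem grad_add (s t : I → K) (ω η : K → ℝ) : grad s t (ω + η) = grad s t ω + grad s t η := by
  ext κ; simp only [grad, Pi.add_apply]; ring

theorem grad_smul (s t : I → K) (a : ℝ) (ω : K → ℝ) : grad s t (a • ω) = a • grad s t ω := by
  ext κ; simp only [grad, Pi.smul_apply, smul_eq_mul]; ring

theorem grad_zero (s t : I → K) : grad s t (0 : K → ℝ) = 0 := by
  ext κ; simp [grad]

theorem abs_grad_le [Fintype K] (s t : I → K) (ω : K → ℝ) (κ : I) :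
    |grad s t ω κ| ≤ 2 * ‖ω‖ := by
  have h1 := norm_le_pi_norm ω (s κ)
  have h2 := norm_le_pi_norm ω (t κ)
  rw [Real.norm_eq_abs] at h1 h2
  have := abs_sub (ω (s κ)) (ω (t κ))
  simp only [grad]
  linarith

theorem summable_mul_grad [Fintype K] {C : I → ℝ} (hC : Summable C) (s t : I → K) (ω : K → ℝ) :
    Summable fun κ => C κ * grad s t ω κ := by
  refine Summable.of_norm_bounded (hC.abs.mul_right (2 * ‖ω‖)) fun κ => ?_
  rw [norm_mul, Real.norm_eq_abs, Real.norm_eq_abs]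
  exact mul_le_mul_of_nonneg_left (abs_grad_le s t ω κ) (abs_nonneg _)

theorem summable_mul_add {C δ ε : I → ℝ} (hδ : Summable fun κ => C κ * δ κ)
    (hε : Summable fun κ => C κ * ε κ) : Summable fun κ => C κ * (δ + ε) κ := by
  simpa only [Pi.add_apply, mul_add] using hδ.add hε

theorem summable_mul_smul {C δ : I → ℝ} (hδ : Summable fun κ => C κ * δ κ) (a : ℝ) :
    Summable fun κ => C κ * (a • δ) κ := by
  simpa only [Pi.smul_apply, smul_eq_mul, mul_left_comm] using hδ.mul_left a

theorem summable_mul_posPart {C δ : I → ℝ} (hδ : Summable fun κ => C κ * δ κ) :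
    Summable fun κ => C κ * max (δ κ) 0 := by
  refine Summable.of_norm_bounded hδ.abs fun κ => ?_
  rw [norm_mul, abs_mul, Real.norm_eq_abs, Real.norm_eq_abs]
  refine mul_le_mul_of_nonneg_left ?_ (abs_nonneg _)
  rw [abs_of_nonneg (le_max_right _ _)]
  exact max_le (le_abs_self _) (abs_nonneg _)

theorem posSum_nonneg {C : I → ℝ} (hC : ∀ κ, 0 ≤ C κ) (δ : I → ℝ) : 0 ≤ posSum C δ :=
  tsum_nonneg fun κ => mul_nonneg (hC κ) (le_max_right _ _)

theorem posSum_add_le {C δ ε : I → ℝ} (hC : ∀ κ, 0 ≤ C κ) (hδ : Summable fun κ => C κ * δ κ)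
    (hε : Summable fun κ => C κ * ε κ) : posSum C (δ + ε) ≤ posSum C δ + posSum C ε := by
  unfold posSum
  rw [← (summable_mul_posPart hδ).tsum_add (summable_mul_posPart hε)]
  refine (summable_mul_posPart (summable_mul_add hδ hε)).tsum_le_tsum (fun κ => ?_)
    ((summable_mul_posPart hδ).add (summable_mul_posPart hε))
  rw [← mul_add]
  refine mul_le_mul_of_nonneg_left (max_le ?_ ?_) (hC κ)
  · exact add_le_add (le_max_left _ _) (le_max_left _ _)
  · exact add_nonneg (le_max_right _ _) (le_max_right _ _)

theorem posSum_smul (C δ : I → ℝ) {a : ℝ} (ha : 0 ≤ a) : posSum C (a • δ) = a * posSum C δ := by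
  unfold posSum
  rw [← tsum_mul_left]
  congr 1; ext κ
  have : max (a * δ κ) 0 = a * max (δ κ) 0 := by
    rw [mul_max_of_nonneg _ _ ha, mul_zero]
  simp only [Pi.smul_apply, smul_eq_mul, this]
  ring

theorem relaxed_nonneg {C : I → ℝ} (hC : ∀ κ, 0 ≤ C κ) (s t : I → K) (δ : I → ℝ) :
    0 ≤ relaxed C s t δ :=
  Real.iInf_nonneg fun _ => posSum_nonneg hC _

theorem relaxed_le {C : I → ℝ} (hC : ∀ κ, 0 ≤ C κ) (s t : I → K) (δ : I → ℝ) (ω : K → ℝ) :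
    relaxed C s t δ ≤ posSum C (δ + grad s t ω) :=
  ciInf_le ⟨0, by rintro _ ⟨ω, rfl⟩; exact posSum_nonneg hC _⟩ ω

theorem relaxed_le_posSum {C : I → ℝ} (hC : ∀ κ, 0 ≤ C κ) (s t : I → K) (δ : I → ℝ) :
    relaxed C s t δ ≤ posSum C δ := by
  simpa [grad_zero] using relaxed_le hC s t δ 0

theorem relaxed_add_le [Fintype K] {C δ ε : I → ℝ} (hC : ∀ κ, 0 ≤ C κ) (hCs : Summable C)
    (s t : I → K) (hδ : Summable fun κ => C κ * δ κ) (hε : Summable fun κ => C κ * ε κ) :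
    relaxed C s t (δ + ε) ≤ relaxed C s t δ + relaxed C s t ε := by
  refine le_ciInf_add_ciInf fun ω η => (relaxed_le hC s t (δ + ε) (ω + η)).trans ?_
  rw [grad_add, add_add_add_comm]
  exact posSum_add_le hC (summable_mul_add hδ (summable_mul_grad hCs s t ω))
    (summable_mul_add hε (summable_mul_grad hCs s t η))

theorem relaxed_smul (C : I → ℝ) (s t : I → K) (δ : I → ℝ) {a : ℝ} (ha : 0 < a) :
    relaxed C s t (a • δ) = a * relaxed C s t δ := by
  unfold relaxed
  rw [Real.mul_iInf_of_nonneg ha.le]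
  refine (Equiv.iInf_congr (MulAction.toPerm (Units.mk0 a ha.ne') : (K → ℝ) ≃ (K → ℝ)) fun ω => ?_).symm
  have : (MulAction.toPerm (Units.mk0 a ha.ne') : (K → ℝ) ≃ (K → ℝ)) ω = a • ω := rfl
  rw [this, grad_smul, ← smul_add, posSum_smul _ _ ha.le]

theorem relaxed_zero (C : I → ℝ) (hC : ∀ κ, 0 ≤ C κ) (s t : I → K) :
    relaxed C s t (0 : I → ℝ) = 0 := by
  refine le_antisymm ((relaxed_le_posSum hC s t 0).trans (by simp [posSum]))
    (relaxed_nonneg hC s t _)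

/-- The gradient is cancelled by the competitor `-ω`. This is what forces a functional below
`relaxed` to kill gradients. -/
theorem relaxed_grad_le {C : I → ℝ} (hC : ∀ κ, 0 ≤ C κ) (s t : I → K) (ω : K → ℝ) :
    relaxed C s t (grad s t ω) ≤ 0 := by
  refine (relaxed_le hC s t (grad s t ω) (-ω)).trans ?_
  rw [← grad_add, add_neg_cancel, grad_zero]
  simp [posSum]

/-- The space of edge functions that are summable with weights `C`. -/
def weighted (C : I → ℝ) : Submodule ℝ (I → ℝ) where
  carrier := {δ | Summable fun κ => C κ * δ κ}
  add_mem' h1 h2 := summable_mul_add h1 h2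
  zero_mem' := by simp
  smul_mem' a _ h := summable_mul_smul h a

/-- A linear functional below a sublinear one that agrees with it at a given point. -/
theorem exists_linear_le_sublinear {E : Type*} [AddCommGroup E] [Module ℝ E] (N : E → ℝ)
    (hom : ∀ a : ℝ, 0 < a → ∀ x, N (a • x) = a * N x) (h_add : ∀ x y, N (x + y) ≤ N x + N y)
    (nonneg : ∀ x, 0 ≤ N x) (zero : N 0 = 0) (x₀ : E) :
    ∃ g : E →ₗ[ℝ] ℝ, g x₀ = N x₀ ∧ ∀ x, g x ≤ N x := by
  by_cases hx : x₀ = 0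
  · exact ⟨0, by simp [hx, zero], fun x => by simpa using nonneg x⟩
  · obtain ⟨g, hg, hN⟩ := exists_extension_of_le_sublinear
      (LinearPMap.mkSpanSingleton (K := ℝ) x₀ (N x₀) hx) N hom h_add (by
        rintro ⟨x, hx'⟩
        obtain ⟨a, rfl⟩ := Submodule.mem_span_singleton.1 hx'
        rw [show (LinearPMap.mkSpanSingleton (K := ℝ) x₀ (N x₀) hx) ⟨a • x₀, hx'⟩ = a • N x₀ from
          LinearPMap.mkSpanSingleton'_apply _ _ _ _ _]
        simp only [smul_eq_mul]
        rcases lt_trichotomy a 0 with h | h | h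
        · exact (mul_nonpos_of_nonpos_of_nonneg h.le (nonneg _)).trans (nonneg _)
        · simp [h, zero]
        · exact (hom a h x₀).ge)
    refine ⟨g, ?_, hN⟩
    exact (hg ⟨x₀, Submodule.mem_span_singleton_self x₀⟩).trans
      (LinearPMap.mkSpanSingleton'_apply_self _ _ _ _)

/-- Domination by `posSum` from one side, applied to `δ` and `-δ`, makes `g` continuous for the
weighted ℓ¹ norm, so its values on single edges determine it. The same bound on single edges gives 0
≤ α ≤ C. -/
theorem linear_le_posSum_eq_tsum {C : I → ℝ} (hC : ∀ κ, 0 ≤ C κ) (g : weighted C →ₗ[ℝ] ℝ)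
    (hg : ∀ δ, g δ ≤ posSum C δ) :
    ∃ α : I → ℝ, (∀ κ, 0 ≤ α κ ∧ α κ ≤ C κ) ∧ ∀ δ : weighted C, g δ = ∑' κ, α κ * δ.1 κ := by
  classical
  have single_mem : ∀ κ, (Pi.single κ (1 : ℝ) : I → ℝ) ∈ weighted C := fun κ =>
    summable_of_ne_finset_zero (s := {κ}) fun b hb => by
      simp [Pi.single_eq_of_ne (Finset.notMem_singleton.1 hb)]
  set e : I → weighted C := fun κ => ⟨Pi.single κ 1, single_mem κ⟩ with he
  have habs : ∀ δ : weighted C, |g δ| ≤ ∑' κ, C κ * |δ.1 κ| := by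
    intro δ
    have hs : Summable fun κ => C κ * |δ.1 κ| :=
      δ.2.abs.congr fun κ => by rw [abs_mul, abs_of_nonneg (hC κ)]
    refine abs_le'.2 ⟨(hg δ).trans ?_, ?_⟩
    · exact (summable_mul_posPart δ.2).tsum_le_tsum (fun κ => mul_le_mul_of_nonneg_left
        (max_le (le_abs_self _) (abs_nonneg _)) (hC κ)) hs
    · rw [← map_neg]
      refine (hg (-δ)).trans ((summable_mul_posPart (-δ).2).tsum_le_tsum
        (fun κ => mul_le_mul_of_nonneg_left (max_le ?_ (abs_nonneg _)) (hC κ)) hs)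
      exact neg_le_abs _
  have hα : ∀ κ, 0 ≤ g (e κ) ∧ g (e κ) ≤ C κ := by
    intro κ
    constructor
    · have h := hg (-e κ)
      rw [map_neg] at h
      have : posSum C ((-e κ : weighted C) : I → ℝ) = 0 := by
        unfold posSum
        refine (tsum_congr fun b => ?_).trans tsum_zero
        have : (-e κ : weighted C).1 b ≤ 0 := by
          simp only [he, Submodule.coe_neg, Pi.neg_apply, Left.neg_nonpos_iff]
          rcases eq_or_ne b κ with rfl | hb
          · simp
          · simp [Pi.single_eq_of_ne hb]
        rw [max_eq_right this, mul_zero]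
      linarith
    · refine (hg (e κ)).trans (le_of_eq ?_)
      unfold posSum
      rw [tsum_eq_single κ fun b hb => by simp [he, Pi.single_eq_of_ne hb]]
      simp [he]
  refine ⟨fun κ => g (e κ), hα, fun δ => ?_⟩
  have hs : Summable fun κ => C κ * |δ.1 κ| :=
    δ.2.abs.congr fun κ => by rw [abs_mul, abs_of_nonneg (hC κ)]
  symm
  refine HasSum.tsum_eq ?_
  -- The error of a partial sum is `g` applied to the tail of `δ`, so it is at most the weighted
  -- norm of that tail.
  have key : ∀ F : Finset I, |(∑ κ ∈ F, g (e κ) * δ.1 κ) - g δ| ≤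
      (∑' κ, C κ * |δ.1 κ|) - ∑ κ ∈ F, C κ * |δ.1 κ| := by
    intro F
    have h1 : (∑ κ ∈ F, g (e κ) * δ.1 κ) = g (∑ κ ∈ F, δ.1 κ • e κ) := by
      rw [map_sum]
      exact Finset.sum_congr rfl fun κ _ => by rw [map_smul, smul_eq_mul, mul_comm]
    have h2 : ∀ b, (δ - ∑ κ ∈ F, δ.1 κ • e κ : weighted C).1 b = if b ∈ F then 0 else δ.1 b := by
      intro b
      simp only [Submodule.coe_sub, Submodule.coe_sum, Submodule.coe_smul, Pi.sub_apply,
        Finset.sum_apply, Pi.smul_apply, smul_eq_mul, he, Pi.single_apply, mul_ite, mul_one,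
        mul_zero]
      rw [Finset.sum_ite_eq]
      split_ifs <;> simp
    rw [h1, ← abs_neg, neg_sub, ← map_sub]
    refine (habs _).trans (le_of_eq ?_)
    rw [eq_sub_iff_add_eq, ← hs.sum_add_tsum_compl (s := F), add_comm]
    congr 1
    rw [tsum_subtype (↑F)ᶜ fun κ => C κ * |δ.1 κ|]
    congr 1; ext b
    rw [h2]
    by_cases hb : b ∈ F <;> simp [Set.indicator, hb]
  have hlim : Tendsto (fun F : Finset I => ∑ κ ∈ F, C κ * |δ.1 κ|) atTop
      (𝓝 (∑' κ, C κ * |δ.1 κ|)) := by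
    simpa only [HasSum, SummationFilter.unconditional_filter] using hs.hasSum
  have h := hlim.const_sub (∑' κ, C κ * |δ.1 κ|)
  rw [sub_self] at h
  rw [HasSum, SummationFilter.unconditional_filter, tendsto_iff_norm_sub_tendsto_zero]
  exact squeeze_zero (fun _ => norm_nonneg _) key h

/-- Linear programming duality: Hahn–Banach gives a linear functional below the sublinear `relaxed`
that touches it at `δ₀`. It is nonpositive on the linear space of gradients, hence zero there. -/
theorem exists_calibration [Fintype K] {C δ₀ : I → ℝ} (hC : ∀ κ, 0 ≤ C κ) (hCs : Summable C)
    (s t : I → K) (hδ : Summable fun κ => C κ * δ₀ κ) :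
    ∃ α : I → ℝ, (∀ κ, 0 ≤ α κ ∧ α κ ≤ C κ) ∧ ∑' κ, α κ * δ₀ κ = relaxed C s t δ₀ ∧
      ∀ ω : K → ℝ, ∑' κ, α κ * grad s t ω κ = 0 := by
  obtain ⟨g, hg0, hg⟩ := exists_linear_le_sublinear (E := weighted C)
    (fun δ => relaxed C s t δ.1)
    (fun a ha δ => by rw [Submodule.coe_smul]; exact relaxed_smul C s t δ.1 ha)
    (fun δ ε => by rw [Submodule.coe_add]; exact relaxed_add_le hC hCs s t δ.2 ε.2) (fun δ => relaxed_nonneg hC s t _)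
    (by rw [Submodule.coe_zero]; exact relaxed_zero C hC s t) ⟨δ₀, hδ⟩
  obtain ⟨α, hα, hrep⟩ := linear_le_posSum_eq_tsum hC g fun δ =>
    (hg δ).trans (relaxed_le_posSum hC s t _)
  refine ⟨α, hα, (hrep ⟨δ₀, hδ⟩).symm.trans hg0, fun ω => ?_⟩
  have hmem : ∀ ω, grad s t ω ∈ weighted C := fun ω => summable_mul_grad hCs s t ω
  have hle : ∀ ω, ∑' κ, α κ * grad s t ω κ ≤ 0 := fun ω => by
    rw [← hrep ⟨_, hmem ω⟩]
    exact (hg _).trans (relaxed_grad_le hC s t ω)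
  refine le_antisymm (hle ω) ?_
  have h := hle ((-1 : ℝ) • ω)
  rw [grad_smul] at h
  simp only [Pi.smul_apply, smul_eq_mul, neg_mul, one_mul, mul_neg, tsum_neg] at h
  linarith

end CellFunctional

/-! ### Attainment of the infimum after truncation; second differences. -/

section Attainment

variable {I K : Type*}

theorem Summable.mul_of_le {C C' δ : I → ℝ} (h : ∀ κ, 0 ≤ C' κ ∧ C' κ ≤ C κ)
    (hδ : Summable fun κ => C κ * δ κ) : Summable fun κ => C' κ * δ κ := by
  refine Summable.of_norm_bounded hδ.abs fun κ => ?_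
  rw [norm_mul, abs_mul, Real.norm_eq_abs, Real.norm_eq_abs, abs_of_nonneg (h κ).1,
    abs_of_nonneg ((h κ).1.trans (h κ).2)]
  exact mul_le_mul_of_nonneg_right (h κ).2 (abs_nonneg _)

/-- After removing some of the interactions, the infimum in `relaxed` is attained, and the
remaining interactions still bound `relaxed` from above. -/
theorem exists_attained_truncation [Fintype K] {C δ : I → ℝ} (hC : ∀ κ, 0 ≤ C κ)
    (hCs : Summable C) (s t : I → K) (hδ : Summable fun κ => C κ * δ κ) :
    ∃ (C' : I → ℝ) (ω : K → ℝ), (∀ κ, 0 ≤ C' κ ∧ C' κ ≤ C κ) ∧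
      posSum C' (δ + grad s t ω) ≤ relaxed C s t δ ∧
      ∀ (ε : I → ℝ), (Summable fun κ => C κ * ε κ) → ∀ η : K → ℝ,
        relaxed C s t ε ≤ posSum C' (ε + grad s t η) := by
  classical
  have hmin : ∀ n : ℕ, ∃ ω : K → ℝ,
      posSum C (δ + grad s t ω) < relaxed C s t δ + 1 / ((n : ℝ) + 1) := fun n =>
    exists_lt_of_ciInf_lt (lt_add_of_pos_right (relaxed C s t δ) (by positivity))
  choose w hw using hmin
  -- An ultrafilter makes each difference of potentials either bounded or eventually beyond any
  -- bound, without passing to subsequences.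
  let U : Ultrafilter ℕ := hyperfilter ℕ
  have hUat : (U : Filter ℕ) ≤ atTop := Nat.hyperfilter_le_atTop
  let rel : K → K → Prop := fun k l => ∃ M : ℝ, ∀ᶠ n in (U : Filter ℕ), |w n k - w n l| ≤ M
  let S : Setoid K :=
    { r := rel
      iseqv :=
        { refl := fun k => ⟨0, by simp⟩
          symm := fun {k l} ⟨M, h⟩ => ⟨M, by filter_upwards [h] with n hn; rwa [abs_sub_comm]⟩
          trans := fun {k l m} ⟨M, h⟩ ⟨M', h'⟩ => ⟨M + M', by
            filter_upwards [h, h'] with n hn hn'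
            exact (abs_sub_le _ (w n l) _).trans (add_le_add hn hn')⟩ } }
  let r : K → K := fun k => (Quotient.mk S k).out
  have hr : ∀ k, rel k (r k) := fun k => S.symm (Quotient.mk_out k)
  have hrr : ∀ k l, rel k l → r k = r l := fun k l h => by
    simp only [r]
    rw [Quotient.sound (s := S) h]
  have hlim : ∀ k, ∃ x : ℝ, Tendsto (fun n => w n k - w n (r k)) U (𝓝 x) := by
    intro k
    obtain ⟨M, hM⟩ := hr k
    obtain ⟨x, _, hx⟩ := (isCompact_Icc (a := -M) (b := M)).ultrafilter_le_nhds
      (U.map fun n => w n k - w n (r k)) (by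
        rw [le_principal_iff, Ultrafilter.mem_coe, Ultrafilter.mem_map]
        filter_upwards [hM] with n hn
        exact abs_le.1 hn)
    exact ⟨x, hx⟩
  choose ω hω using hlim
  -- Bounded energy along the minimising sequence bounds each weighted jump from above, never from
  -- below. Between different classes the jump must then tend to -∞.
  have hbdd : ∀ κ, 0 < C κ → ∃ B : ℝ, ∀ n, w n (s κ) - w n (t κ) ≤ B := by
    intro κ hκ
    refine ⟨(relaxed C s t δ + 1) / C κ - δ κ, fun n => ?_⟩
    have h1 : C κ * max ((δ + grad s t (w n)) κ) 0 ≤ relaxed C s t δ + 1 := by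
      refine ((summable_mul_posPart (summable_mul_add hδ
        (summable_mul_grad hCs s t (w n)))).le_tsum κ fun j _ =>
          mul_nonneg (hC j) (le_max_right _ _)).trans ((hw n).le.trans ?_)
      gcongr
      rw [div_le_one (by positivity)]
      linarith [Nat.cast_nonneg (α := ℝ) n]
    rw [mul_comm, ← le_div_iff₀ hκ] at h1
    have h2 := (le_max_left _ _).trans h1
    simp only [Pi.add_apply, grad] at h2
    linarith
  have hdiv : ∀ κ, 0 < C κ → ¬ rel (s κ) (t κ) → ∀ M : ℝ,
      ∀ᶠ n in (U : Filter ℕ), w n (r (s κ)) - w n (r (t κ)) < -M := by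
    intro κ hκ hn M
    obtain ⟨B, hB⟩ := hbdd κ hκ
    obtain ⟨M1, h1⟩ := hr (s κ)
    obtain ⟨M2, h2⟩ := hr (t κ)
    have h3 : ∀ᶠ n in (U : Filter ℕ),
        ¬ |w n (s κ) - w n (t κ)| ≤ max B (M + M1 + M2) :=
      Ultrafilter.eventually_not.2 fun h => hn ⟨_, h⟩
    filter_upwards [h1, h2, h3] with n a1 a2 a3
    rw [abs_le] at a1 a2
    rw [not_le, lt_abs] at a3
    have := hB n
    have := le_max_left B (M + M1 + M2)
    have := le_max_right B (M + M1 + M2)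
    rcases a3 with a3 | a3 <;> linarith
  have hgrad : ∀ κ, rel (s κ) (t κ) →
      Tendsto (fun n => grad s t (w n) κ) U (𝓝 (grad s t ω κ)) := by
    intro κ hκ
    refine ((hω (s κ)).sub (hω (t κ))).congr fun n => ?_
    rw [hrr _ _ hκ]
    simp [grad]
  -- The edges between different classes are the ones removed: their positive parts vanish in the
  -- limit.
  let C' : I → ℝ := fun κ => if rel (s κ) (t κ) then C κ else 0
  have hC' : ∀ κ, 0 ≤ C' κ ∧ C' κ ≤ C κ := by
    intro κ
    simp only [C']
    split_ifs
    · exact ⟨hC κ, le_rfl⟩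
    · exact ⟨le_rfl, hC κ⟩
  refine ⟨C', ω, hC', ?_, ?_⟩
  · refine (Summable.mul_of_le hC' (summable_mul_posPart (summable_mul_add hδ
      (summable_mul_grad hCs s t ω)))).tsum_le_of_sum_le fun F => ?_
    have h1 : Tendsto (fun n => ∑ κ ∈ F, C' κ * max ((δ + grad s t (w n)) κ) 0) U
        (𝓝 (∑ κ ∈ F, C' κ * max ((δ + grad s t ω) κ) 0)) := by
      refine tendsto_finsetSum _ fun κ _ => ?_
      by_cases hκ : rel (s κ) (t κ)
      · exact (((hgrad κ hκ).const_add _).max tendsto_const_nhds).const_mul _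
      · simp [C', hκ]
    have h2 : Tendsto (fun n : ℕ => relaxed C s t δ + 1 / ((n : ℝ) + 1)) U
        (𝓝 (relaxed C s t δ + 0)) :=
      (tendsto_one_div_add_atTop_nhds_zero_nat.mono_left hUat).const_add _
    rw [add_zero] at h2
    refine le_of_tendsto_of_tendsto' h1 h2 fun n => ?_
    have hs := summable_mul_posPart (summable_mul_add hδ (summable_mul_grad hCs s t (w n)))
    calc ∑ κ ∈ F, C' κ * max ((δ + grad s t (w n)) κ) 0
        ≤ ∑ κ ∈ F, C κ * max ((δ + grad s t (w n)) κ) 0 :=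
          Finset.sum_le_sum fun κ _ =>
            mul_le_mul_of_nonneg_right (hC' κ).2 (le_max_right _ _)
      _ ≤ posSum C (δ + grad s t (w n)) :=
          hs.sum_le_tsum F fun κ _ => mul_nonneg (hC κ) (le_max_right _ _)
      _ ≤ _ := (hw n).le
  · intro ε hε η
    -- The potential `w n ∘ r` is constant on each class, so it leaves the retained edges alone and
    -- drives the jumps of the removed edges to -∞. Adding it to `η` turns the weights `C` into `C'`
    -- in the limit.
    have hle : ∀ n, relaxed C s t ε ≤ posSum C (ε + grad s t (η + w n ∘ r)) := fun n =>
      relaxed_le hC s t ε _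
    have hs : Summable fun κ => C κ * |(ε + grad s t η) κ| :=
      (summable_mul_add hε (summable_mul_grad hCs s t η)).abs.congr fun κ => by
        rw [abs_mul, abs_of_nonneg (hC κ)]
    -- There are only finitely many pairs of vertices, so one eventual set serves all edges at once,
    -- as domination requires.
    have hnonpos : ∀ᶠ n in (U : Filter ℕ), ∀ k l : K, (∃ κ, s κ = k ∧ t κ = l ∧ 0 < C κ) →
        w n (r k) - w n (r l) ≤ 0 := by
      rw [eventually_all]; intro k
      rw [eventually_all]; intro l
      by_cases h : ∃ κ, s κ = k ∧ t κ = l ∧ 0 < C κ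
      · obtain ⟨κ, rfl, rfl, hκ⟩ := h
        by_cases hrel : rel (s κ) (t κ)
        · rw [hrr _ _ hrel]; simp
        · filter_upwards [hdiv κ hκ hrel 0] with n hn _
          linarith
      · simp [h]
    refine ge_of_tendsto (x := (U : Filter ℕ)) (tendsto_tsum_of_dominated_convergence (bound := fun κ =>
      C κ * |(ε + grad s t η) κ|) hs (fun κ => ?_) ?_) (Eventually.of_forall hle)
    · rcases (hC κ).eq_or_lt with h0 | hpos
      · have : C' κ = 0 := le_antisymm ((hC' κ).2.trans h0.ge) (hC' κ).1
        simp [← h0, this]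
      by_cases hκ : rel (s κ) (t κ)
      · refine tendsto_const_nhds.congr fun n => ?_
        simp [C', hκ, grad, hrr _ _ hκ]
      · simp only [C', hκ, if_false, zero_mul]
        refine tendsto_const_nhds.congr' ?_
        filter_upwards [hdiv κ hpos hκ ((ε + grad s t η) κ)] with n hn
        rw [max_eq_right, mul_zero]
        simp only [Pi.add_apply, grad, Function.comp] at hn ⊢
        linarith
    · filter_upwards [hnonpos] with n hn κ
      rw [norm_mul, Real.norm_eq_abs, Real.norm_eq_abs, abs_of_nonneg (hC κ)]
      rcases (hC κ).eq_or_lt with h0 | hpos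
      · simp [← h0]
      refine mul_le_mul_of_nonneg_left ?_ hpos.le
      rw [abs_of_nonneg (le_max_right _ _)]
      refine max_le (le_trans ?_ (le_abs_self _)) (abs_nonneg _)
      have := hn (s κ) (t κ) ⟨κ, rfl, rfl, hpos⟩
      simp only [Pi.add_apply, grad, Function.comp]
      linarith

/-- Each term is exactly zero for small `x`: the positive part is affine near `q κ ≠ 0`, and nothing
moves when `q κ = 0`. The series is dominated by 2 C |p|. -/
theorem tendsto_second_difference_posSum {C q p : I → ℝ} (hC : ∀ κ, 0 ≤ C κ)
    (hq : Summable fun κ => C κ * q κ) (hp : Summable fun κ => C κ * p κ)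
    (h : ∀ κ, q κ = 0 → p κ = 0) :
    Tendsto (fun x : ℝ => (posSum C (q + x • p) + posSum C (q + (-x) • p) - 2 * posSum C q) / x)
      (𝓝[>] 0) (𝓝 0) := by
  have hs : ∀ x : ℝ, Summable fun κ => C κ * max ((q + x • p) κ) 0 := fun x =>
    summable_mul_posPart (summable_mul_add hq (summable_mul_smul hp x))
  have heq : ∀ x : ℝ, (posSum C (q + x • p) + posSum C (q + (-x) • p) - 2 * posSum C q) / x =
      ∑' κ, C κ * ((max (q κ + x * p κ) 0 + max (q κ - x * p κ) 0 - 2 * max (q κ) 0) / x) := by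
    intro x
    unfold posSum
    rw [← (hs x).tsum_add (hs (-x)), ← tsum_mul_left, ← ((hs x).add (hs (-x))).tsum_sub
      ((summable_mul_posPart hq).mul_left 2), ← tsum_div_const]
    refine tsum_congr fun κ => ?_
    simp only [Pi.add_apply, Pi.smul_apply, smul_eq_mul, neg_mul, ← sub_eq_add_neg]
    ring
  simp_rw [heq]
  have hb : Summable fun κ => 2 * (C κ * |p κ|) :=
    (hp.abs.congr fun κ => by rw [abs_mul, abs_of_nonneg (hC κ)]).mul_left 2
  rw [show (0 : ℝ) = ∑' _ : I, (0 : ℝ) from tsum_zero.symm]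
  simp only [tsum_zero]
  rw [show 𝓝 (0 : ℝ) = 𝓝 (∑' _ : I, (0 : ℝ)) by rw [tsum_zero]]
  refine tendsto_tsum_of_dominated_convergence hb (fun κ => ?_) ?_
  · by_cases hq0 : q κ = 0
    · simp [hq0, h κ hq0]
    · refine tendsto_const_nhds.congr' ?_
      have hsmall : ∀ᶠ x : ℝ in 𝓝[>] 0, |x * p κ| < |q κ| := by
        have : Tendsto (fun x : ℝ => |x * p κ|) (𝓝[>] 0) (𝓝 |0 * p κ|) :=
          ((tendsto_id.mul_const (p κ)).abs).mono_left nhdsWithin_le_nhds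
        refine this.eventually_lt_const ?_
        simpa using hq0
      filter_upwards [hsmall] with x hx
      rw [eq_comm, mul_eq_zero, div_eq_zero_iff]
      right; left
      have h1 := (abs_lt.1 hx).1
      have h2 := (abs_lt.1 hx).2
      rcases lt_or_gt_of_ne hq0 with hn | hn
      · rw [abs_of_neg hn] at h1 h2
        rw [max_eq_right, max_eq_right, max_eq_right] <;> linarith
      · rw [abs_of_pos hn] at h1 h2
        rw [max_eq_left, max_eq_left, max_eq_left] <;> linarith
  · filter_upwards [self_mem_nhdsWithin] with x hx κ
    have hx : 0 < x := hx
    rw [norm_mul, Real.norm_eq_abs, Real.norm_eq_abs, abs_of_nonneg (hC κ), mul_left_comm]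
    refine mul_le_mul_of_nonneg_left ?_ (hC κ)
    rw [abs_div, abs_of_pos hx, div_le_iff₀ hx]
    have h1 := abs_max_sub_max_le_abs (q κ + x * p κ) (q κ) 0
    have h2 := abs_max_sub_max_le_abs (q κ - x * p κ) (q κ) 0
    have e1 : |q κ + x * p κ - q κ| = |p κ| * x := by
      rw [add_sub_cancel_left, abs_mul, abs_of_pos hx, mul_comm]
    have e2 : |q κ - x * p κ - q κ| = |p κ| * x := by
      rw [sub_sub_cancel_left, abs_neg, abs_mul, abs_of_pos hx, mul_comm]
    rw [e1] at h1
    rw [e2] at h2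
    rw [abs_le] at h1 h2 ⊢
    constructor <;> linarith [h1.1, h1.2, h2.1, h2.2]

end Attainment

/-! ### From rays to differentiability of the cell functional. -/

section Differentiability

/-- A nonnegative convex function that vanishes at the origin and is of lower order along each
ray has derivative zero at the origin. -/
theorem ConvexOn.hasFDerivAt_zero_of_rays {d : ℕ} {ψ : EuclideanSpace ℝ (Fin d) → ℝ}
    (hψ : ConvexOn ℝ Set.univ ψ) (h0 : ψ 0 = 0) (hpos : ∀ x, 0 ≤ ψ x)
    (hray : ∀ ξ, Tendsto (fun a : ℝ => ψ (a • ξ) / a) (𝓝[>] 0) (𝓝 0)) :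
    HasFDerivAt ψ (0 : EuclideanSpace ℝ (Fin d) →L[ℝ] ℝ) 0 := by
  rw [hasFDerivAt_iff_isLittleO_nhds_zero, Asymptotics.isLittleO_iff]
  intro c hc
  rcases Nat.eq_zero_or_pos d with rfl | hd
  · refine Eventually.of_forall fun x => ?_
    rw [Subsingleton.elim x 0]
    simp
  have hdR : (0 : ℝ) < d := Nat.cast_pos.2 hd
  let e : Fin d → EuclideanSpace ℝ (Fin d) := fun i => EuclideanSpace.single i 1
  have hev : ∀ ξ, ∀ᶠ a : ℝ in 𝓝[>] 0, ψ (a • ξ) ≤ c / d * a := by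
    intro ξ
    filter_upwards [(hray ξ).eventually_lt_const (show 0 < c / d by positivity),
      self_mem_nhdsWithin] with a ha ha'
    exact ((div_lt_iff₀ ha').1 ha).le
  have hall : ∀ᶠ a : ℝ in 𝓝[>] 0, ∀ i, ψ (a • e i) ≤ c / d * a ∧ ψ (a • -e i) ≤ c / d * a := by
    rw [eventually_all]
    exact fun i => (hev _).and (hev _)
  obtain ⟨a₀, ha₀, hball⟩ := mem_nhdsGT_iff_exists_Ioo_subset.1 hall
  have ha₀ : 0 < a₀ := ha₀
  have hcoord : ∀ (y : ℝ) i, |y| < a₀ → ψ (y • e i) ≤ c / d * |y| := by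
    intro y i hy
    rcases lt_trichotomy y 0 with h | h | h
    · rw [abs_of_neg h] at hy ⊢
      have := (hball ⟨neg_pos.2 h, hy⟩ i).2
      rwa [smul_neg, neg_smul, neg_neg] at this
    · simp [h, h0]
    · rw [abs_of_pos h] at hy ⊢
      exact (hball ⟨h, hy⟩ i).1
  have hnear : ∀ᶠ x : EuclideanSpace ℝ (Fin d) in 𝓝 0, ‖x‖ < a₀ / d := by
    have := Metric.ball_mem_nhds (0 : EuclideanSpace ℝ (Fin d)) (div_pos ha₀ hdR)
    filter_upwards [this] with x hx
    simpa using hx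
  filter_upwards [hnear] with x hx
  have hxi : ∀ i, |x i| ≤ ‖x‖ := fun i => by
    simpa using PiLp.norm_apply_le x i
  -- The point is the average of `d` points on the coordinate axes, so Jensen's inequality reduces
  -- the estimate to finitely many rays.
  have hx' : x = ∑ i, (1 / (d : ℝ)) • ((d * x i) • e i) := by
    ext j
    have : (∑ i, (1 / (d : ℝ)) • ((d * x i) • e i)) j =
        ∑ i, ((1 / (d : ℝ)) • ((d * x i) • e i)) j := by
      simp [WithLp.ofLp_sum, Finset.sum_apply]
    rw [this, Finset.sum_eq_single j]
    · simp [e]; field_simp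
    · intro i _ hij
      simp [e, hij.symm]
    · simp
  have hjensen : ψ x ≤ ∑ i, (1 / (d : ℝ)) * ψ ((d * x i) • e i) := by
    conv_lhs => rw [hx']
    exact hψ.map_sum_le (fun _ _ => by positivity)
      (by simp [Finset.sum_const]; field_simp) (fun _ _ => Set.mem_univ _)
  have hterm : ∀ i, (1 / (d : ℝ)) * ψ ((d * x i) • e i) ≤ (1 / d) * (c * ‖x‖) := by
    intro i
    refine mul_le_mul_of_nonneg_left ?_ (by positivity)
    refine (hcoord _ i ?_).trans ?_
    · rw [abs_mul, abs_of_pos hdR, mul_comm, ← lt_div_iff₀ hdR]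
      exact (hxi i).trans_lt hx
    · rw [abs_mul, abs_of_pos hdR, ← mul_assoc, div_mul_cancel₀ _ hdR.ne']
      exact mul_le_mul_of_nonneg_left (hxi i) hc.le
  rw [zero_add, h0, sub_zero, zero_apply,
    sub_zero, Real.norm_eq_abs, abs_of_nonneg (hpos x)]
  refine hjensen.trans ((Finset.sum_le_sum fun i _ => hterm i).trans (le_of_eq ?_))
  rw [Finset.sum_const, Finset.card_univ, Fintype.card_fin, nsmul_eq_mul]
  field_simp

variable {d : ℕ} {I K : Type*}

/-- The heights of the edge vectors `D` in direction `ν`. -/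
noncomputable def slope (D : I → EuclideanSpace ℝ (Fin d)) (ν : EuclideanSpace ℝ (Fin d)) :
    I → ℝ := fun κ => inner ℝ ν (D κ)

theorem slope_add (D : I → EuclideanSpace ℝ (Fin d)) (ν ξ : EuclideanSpace ℝ (Fin d)) :
    slope D (ν + ξ) = slope D ν + slope D ξ := by
  ext κ; simp [slope, inner_add_left]

theorem slope_smul (D : I → EuclideanSpace ℝ (Fin d)) (a : ℝ) (ν : EuclideanSpace ℝ (Fin d)) :
    slope D (a • ν) = a • slope D ν := by
  ext κ; simp [slope, real_inner_smul_left]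

theorem abs_slope_le (D : I → EuclideanSpace ℝ (Fin d)) (ν : EuclideanSpace ℝ (Fin d)) (κ : I) :
    |slope D ν κ| ≤ ‖ν‖ * ‖D κ‖ := abs_real_inner_le_norm _ _

theorem summable_mul_slope {C : I → ℝ} (hC : ∀ κ, 0 ≤ C κ) {D : I → EuclideanSpace ℝ (Fin d)}
    (hD : Summable fun κ => C κ * ‖D κ‖) (ν : EuclideanSpace ℝ (Fin d)) :
    Summable fun κ => C κ * slope D ν κ := by
  refine Summable.of_norm_bounded (hD.mul_left ‖ν‖) fun κ => ?_
  rw [norm_mul, Real.norm_eq_abs, Real.norm_eq_abs, abs_of_nonneg (hC κ), mul_left_comm]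
  exact mul_le_mul_of_nonneg_left (abs_slope_le D ν κ) (hC κ)

theorem convexOn_relaxed_slope [Fintype K] {C : I → ℝ} (hC : ∀ κ, 0 ≤ C κ) (hCs : Summable C)
    (s t : I → K) {D : I → EuclideanSpace ℝ (Fin d)} (hD : Summable fun κ => C κ * ‖D κ‖) :
    ConvexOn ℝ Set.univ fun ν => relaxed C s t (slope D ν) := by
  refine ⟨convex_univ, fun x _ y _ a b ha hb hab => ?_⟩
  have hsm : ∀ (a : ℝ) (x : EuclideanSpace ℝ (Fin d)), 0 ≤ a →
      relaxed C s t (slope D (a • x)) = a * relaxed C s t (slope D x) := by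
    intro a x ha
    rcases ha.eq_or_lt with rfl | ha
    · rw [slope_smul, zero_smul, zero_mul, relaxed_zero C hC]
    · rw [slope_smul, relaxed_smul C s t _ ha]
  simp only [smul_eq_mul]
  rw [← hsm a x ha, ← hsm b y hb, slope_add]
  exact relaxed_add_le hC hCs s t (summable_mul_slope hC hD _) (summable_mul_slope hC hD _)

/-- The calibration `p` supports the function at `ν`, so the excess `ψ` over `p` is convex,
nonnegative and zero at the origin. Along a ray, `ψ` is bounded by its own second difference, and
this by the second difference of the truncated functional at its minimiser. The hypothesis `hν`
keeps the critical edges critical along the ray. -/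
theorem differentiableAt_relaxed_slope [Fintype K] {C : I → ℝ} (hC : ∀ κ, 0 ≤ C κ)
    (hCs : Summable C) (s t : I → K) {D : I → EuclideanSpace ℝ (Fin d)}
    (hD : Summable fun κ => C κ * ‖D κ‖) {ν : EuclideanSpace ℝ (Fin d)}
    (hν : ∀ (ω : K → ℝ) (ξ : EuclideanSpace ℝ (Fin d)), ∃ η : K → ℝ, ∀ κ,
      (slope D ν + grad s t ω) κ = 0 → (slope D ξ + grad s t η) κ = 0) :
    DifferentiableAt ℝ (fun ν => relaxed C s t (slope D ν)) ν := by
  obtain ⟨α, hα, hαν, hdiv⟩ := exists_calibration hC hCs s t (summable_mul_slope hC hD ν)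
  have hαs : ∀ ξ, Summable fun κ => α κ * slope D ξ κ := fun ξ =>
    Summable.mul_of_le hα (summable_mul_slope hC hD ξ)
  let p : EuclideanSpace ℝ (Fin d) →ₗ[ℝ] ℝ :=
    { toFun := fun ξ => ∑' κ, α κ * slope D ξ κ
      map_add' := fun ξ ζ => by
        rw [← (hαs ξ).tsum_add (hαs ζ)]
        exact tsum_congr fun κ => by rw [slope_add, Pi.add_apply, mul_add]
      map_smul' := fun a ξ => by
        rw [RingHom.id_apply, smul_eq_mul, ← tsum_mul_left]
        exact tsum_congr fun κ => by rw [slope_smul, Pi.smul_apply, smul_eq_mul]; ring }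
  have hple : ∀ ξ, p ξ ≤ relaxed C s t (slope D ξ) := by
    intro ξ
    refine le_ciInf fun ω => ?_
    have hg := Summable.mul_of_le hα (summable_mul_grad hCs s t ω)
    have hsum := summable_mul_add (hαs ξ) hg
    calc p ξ = ∑' κ, α κ * (slope D ξ + grad s t ω) κ := by
          simp only [Pi.add_apply, mul_add]
          rw [(hαs ξ).tsum_add hg, hdiv ω, add_zero]
          rfl
      _ ≤ posSum C (slope D ξ + grad s t ω) := by
          refine hsum.tsum_le_tsum (fun κ => ?_) (summable_mul_posPart
            (summable_mul_add (summable_mul_slope hC hD ξ) (summable_mul_grad hCs s t ω)))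
          exact (mul_le_mul_of_nonneg_left (le_max_left _ 0) (hα κ).1).trans
            (mul_le_mul_of_nonneg_right (hα κ).2 (le_max_right _ _))
  have hpν : p ν = relaxed C s t (slope D ν) := hαν
  obtain ⟨C', ω, hC', hatt, hup⟩ := exists_attained_truncation hC hCs s t
    (summable_mul_slope hC hD ν)
  set Φ : EuclideanSpace ℝ (Fin d) → ℝ := fun ν => relaxed C s t (slope D ν) with hΦ
  have hconv : ConvexOn ℝ Set.univ Φ := convexOn_relaxed_slope hC hCs s t hD
  let ψ : EuclideanSpace ℝ (Fin d) → ℝ := fun x => Φ (ν + x) - Φ ν - p x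
  have hψpos : ∀ x, 0 ≤ ψ x := fun x => by
    have := hple (ν + x)
    rw [map_add, hpν] at this
    simp only [ψ, hΦ]
    linarith
  have hψ0 : ψ 0 = 0 := by simp [ψ]
  have hψconv : ConvexOn ℝ Set.univ ψ := by
    have h1 : ConvexOn ℝ Set.univ fun x => Φ (ν + x) := by
      have := hconv.translate_right (c := ν)
      rw [Set.preimage_univ] at this
      exact this
    have h2 : ConcaveOn ℝ Set.univ fun x => p x := p.concaveOn convex_univ
    exact (h1.sub (concaveOn_const (Φ ν) convex_univ)).sub h2
  have hray : ∀ ξ, Tendsto (fun a : ℝ => ψ (a • ξ) / a) (𝓝[>] 0) (𝓝 0) := by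
    intro ξ
    obtain ⟨η, hη⟩ := hν ω ξ
    have hs1 := summable_mul_add (summable_mul_slope hC hD ν) (summable_mul_grad hCs s t ω)
    have hs2 := summable_mul_add (summable_mul_slope hC hD ξ) (summable_mul_grad hCs s t η)
    have hlim := tendsto_second_difference_posSum (fun κ => (hC' κ).1)
      (Summable.mul_of_le hC' hs1) (Summable.mul_of_le hC' hs2) hη
    have hbound : ∀ a : ℝ, Φ (ν + a • ξ) ≤
        posSum C' (slope D ν + grad s t ω + a • (slope D ξ + grad s t η)) := by
      intro a
      have := hup (slope D (ν + a • ξ)) (summable_mul_slope hC hD _) (ω + a • η)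
      refine this.trans (le_of_eq ?_)
      rw [slope_add, slope_smul, grad_add, grad_smul, smul_add]
      congr 1; abel
    refine squeeze_zero' ?_ ?_ hlim
    · filter_upwards [self_mem_nhdsWithin] with a ha
      exact div_nonneg (hψpos _) (le_of_lt ha)
    · filter_upwards [self_mem_nhdsWithin] with a ha
      have ha : 0 < a := ha
      refine div_le_div_of_nonneg_right ?_ ha.le
      have h1 := hbound a
      have h2 := hbound (-a)
      have h3 := hψpos ((-a) • ξ)
      simp only [ψ, map_smul, smul_eq_mul] at h3 ⊢
      -- Attainment enters here: the middle term of the second difference is bounded by `Φ ν`, while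
      -- the outer terms are bounded below through `hbound`.
      have h4 : Φ ν ≥ posSum C' (slope D ν + grad s t ω) := hatt
      linarith
  have hder := ConvexOn.hasFDerivAt_zero_of_rays hψconv hψ0 hψpos hray
  have h5 : DifferentiableAt ℝ (fun x => ψ (x - ν)) ν := by
    refine DifferentiableAt.comp (g := ψ) ν ?_ (differentiableAt_id.sub_const ν)
    simpa using hder.differentiableAt
  have h6 : DifferentiableAt ℝ (fun x => ψ (x - ν) + Φ ν + p (x - ν)) ν := by
    refine (h5.add_const _).add ?_
    exact (LinearMap.toContinuousLinearMap p).differentiableAt.comp ν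
      (differentiableAt_id.sub_const ν)
  refine h6.congr_of_eventuallyEq (Eventually.of_forall fun x => ?_)
  simp only [ψ]
  rw [add_sub_cancel]
  ring

end Differentiability

/-! ### Counting lattice translates in rotated boxes. -/

section Counting

open MeasureTheory

variable {d : ℕ}

theorem intVec_add (z w : Fin d → ℤ) : intVec (z + w) = intVec z + intVec w := by
  ext m; simp [intVec]

theorem intVec_neg (z : Fin d → ℤ) : intVec (-z) = -intVec z := by
  ext m; simp [intVec]

theorem intVec_zero : intVec (0 : Fin d → ℤ) = 0 := by
  ext m; simp [intVec]

/-- The translate of `x` by the integer vector `z`, scaled by the period `T`. -/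
noncomputable def site (T : ℕ) (x : EuclideanSpace ℝ (Fin d)) (z : Fin d → ℤ) :
    EuclideanSpace ℝ (Fin d) := x + (T : ℝ) • intVec z

theorem site_add (T : ℕ) (x : EuclideanSpace ℝ (Fin d)) (z w : Fin d → ℤ) :
    site T x (z + w) = site T x z + (T : ℝ) • intVec w := by
  rw [site, site, intVec_add, smul_add, add_assoc]

/-- A box whose axes are the images of the coordinate axes under `R`. -/
def rbox (R : EuclideanSpace ℝ (Fin d) ≃ₗᵢ[ℝ] EuclideanSpace ℝ (Fin d)) (lo hi : Fin d → ℝ) :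
    Set (EuclideanSpace ℝ (Fin d)) := {p | ∀ m, lo m ≤ R.symm p m ∧ R.symm p m < hi m}

variable (R : EuclideanSpace ℝ (Fin d) ≃ₗᵢ[ℝ] EuclideanSpace ℝ (Fin d))

theorem rbox_eq_preimage (lo hi : Fin d → ℝ) :
    rbox R lo hi = R.symm ⁻¹' ((WithLp.ofLp : EuclideanSpace ℝ (Fin d) → Fin d → ℝ) ⁻¹'
      (Set.univ.pi fun m => Set.Ico (lo m) (hi m))) := by
  ext p; simp [rbox]

theorem measurableSet_rbox (lo hi : Fin d → ℝ) : MeasurableSet (rbox R lo hi) := by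
  rw [rbox_eq_preimage]
  refine R.symm.measurePreserving.measurable ((PiLp.volume_preserving_ofLp (Fin d)).measurable ?_)
  exact MeasurableSet.univ_pi fun _ => measurableSet_Ico

theorem volume_rbox (lo hi : Fin d → ℝ) :
    volume (rbox R lo hi) = ∏ m, ENNReal.ofReal (hi m - lo m) := by
  have hm : MeasurableSet (Set.univ.pi fun m => Set.Ico (lo m) (hi m)) :=
    MeasurableSet.univ_pi fun _ => measurableSet_Ico
  rw [rbox_eq_preimage, R.symm.measurePreserving.measure_preimage
    ((PiLp.volume_preserving_ofLp (Fin d)).measurable hm).nullMeasurableSet,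
    (PiLp.volume_preserving_ofLp (Fin d)).measure_preimage hm.nullMeasurableSet,
    Real.volume_pi_Ico]

theorem abs_apply_le_norm (v : EuclideanSpace ℝ (Fin d)) (m : Fin d) : |v m| ≤ ‖v‖ := by
  simpa using PiLp.norm_apply_le v m

theorem norm_le_sqrt_mul {v : EuclideanSpace ℝ (Fin d)} {a : ℝ} (ha : 0 ≤ a)
    (h : ∀ m, |v m| ≤ a) : ‖v‖ ≤ a * √d := by
  rw [EuclideanSpace.norm_eq]
  have : ∑ m, ‖v m‖ ^ 2 ≤ a ^ 2 * d := by
    refine (Finset.sum_le_sum fun m _ => pow_le_pow_left₀ (norm_nonneg _) (h m) 2).trans ?_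
    simp [mul_comm]
  refine (Real.sqrt_le_sqrt this).trans (le_of_eq ?_)
  rw [Real.sqrt_mul (sq_nonneg _), Real.sqrt_sq ha]

theorem finite_site_norm_le {T : ℕ} (hT : 0 < T) (x : EuclideanSpace ℝ (Fin d)) (B : ℝ) :
    {z : Fin d → ℤ | ‖site T x z‖ ≤ B}.Finite := by
  refine (Set.finite_Icc (fun _ => -⌈B + ‖x‖⌉) (fun _ => ⌈B + ‖x‖⌉)).subset fun z hz => ?_
  have hz : ‖site T x z‖ ≤ B := hz
  have hT' : (1 : ℝ) ≤ T := by exact_mod_cast hT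
  have key : ∀ m, |(z m : ℝ)| ≤ B + ‖x‖ := by
    intro m
    have h1 : ‖(T : ℝ) • intVec z‖ ≤ B + ‖x‖ := by
      have : (T : ℝ) • intVec z = site T x z - x := by rw [site, add_sub_cancel_left]
      rw [this]
      exact (norm_sub_le _ _).trans (by linarith)
    have h2 := (abs_apply_le_norm ((T : ℝ) • intVec z) m).trans h1
    simp only [intVec, PiLp.smul_apply, smul_eq_mul, abs_mul, Nat.abs_cast] at h2
    nlinarith [abs_nonneg (z m : ℝ)]
  constructor <;> intro m
  · have := (abs_le.1 (key m)).1
    have h := Int.le_ceil (B + ‖x‖)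
    have : (-⌈B + ‖x‖⌉ : ℝ) ≤ z m := by linarith
    exact_mod_cast this
  · have := (abs_le.1 (key m)).2
    have h := Int.le_ceil (B + ‖x‖)
    have : (z m : ℝ) ≤ ⌈B + ‖x‖⌉ := by linarith
    exact_mod_cast this

theorem finite_site_mem_rbox {T : ℕ} (hT : 0 < T) (x : EuclideanSpace ℝ (Fin d))
    (lo hi : Fin d → ℝ) : {z : Fin d → ℤ | site T x z ∈ rbox R lo hi}.Finite := by
  refine (finite_site_norm_le hT x ((∑ m, (|lo m| + |hi m|)) * √d)).subset fun z hz => ?_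
  show ‖site T x z‖ ≤ _
  rw [← R.symm.norm_map]
  refine norm_le_sqrt_mul (Finset.sum_nonneg fun m _ => by positivity) fun m => ?_
  have h1 : |R.symm (site T x z) m| ≤ |lo m| + |hi m| := by
    have := hz m
    rw [abs_le]
    constructor
    · linarith [neg_abs_le (lo m), abs_nonneg (hi m), this.1]
    · linarith [le_abs_self (hi m), abs_nonneg (lo m), this.2]
  exact h1.trans (Finset.single_le_sum (f := fun m => |lo m| + |hi m|)
    (fun m _ => by positivity) (Finset.mem_univ m))

/-- The half-open cell of side length `T` with lower corner `p`. -/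
def cell (T : ℕ) (p : EuclideanSpace ℝ (Fin d)) : Set (EuclideanSpace ℝ (Fin d)) :=
  rbox (LinearIsometryEquiv.refl ℝ _) p (fun m => p m + T)

theorem mem_cell {T : ℕ} {p y : EuclideanSpace ℝ (Fin d)} :
    y ∈ cell T p ↔ ∀ m, p m ≤ y m ∧ y m < p m + T := Iff.rfl

theorem volume_cell (T : ℕ) (p : EuclideanSpace ℝ (Fin d)) :
    volume (cell T p) = (T : ℝ≥0∞) ^ d := by
  rw [cell, volume_rbox]
  simp

theorem mem_cell_site_iff {T : ℕ} (hT : 0 < T) {x y : EuclideanSpace ℝ (Fin d)}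
    {z : Fin d → ℤ} : y ∈ cell T (site T x z) ↔ ∀ m, ⌊(y m - x m) / T⌋ = z m := by
  have hT' : (0 : ℝ) < T := by exact_mod_cast hT
  rw [mem_cell]
  refine forall_congr' fun m => ?_
  rw [Int.floor_eq_iff, le_div_iff₀ hT', div_lt_iff₀ hT']
  simp only [site, intVec, PiLp.add_apply, PiLp.smul_apply, smul_eq_mul]
  constructor <;> rintro ⟨h1, h2⟩ <;> constructor <;> linarith

theorem norm_sub_le_of_mem_cell {T : ℕ} {p y : EuclideanSpace ℝ (Fin d)} (h : y ∈ cell T p) :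
    ‖y - p‖ ≤ T * √d := by
  refine norm_le_sqrt_mul (Nat.cast_nonneg T) fun m => ?_
  have := mem_cell.1 h m
  simp only [PiLp.sub_apply]
  rw [abs_of_nonneg (sub_nonneg.2 this.1)]
  exact sub_le_iff_le_add'.2 this.2.le

/-- The number of lattice translates of `x` in `A`. -/
noncomputable def count (T : ℕ) (x : EuclideanSpace ℝ (Fin d))
    (A : Set (EuclideanSpace ℝ (Fin d))) : ℝ := Set.ncard {z : Fin d → ℤ | site T x z ∈ A}

theorem abs_symm_sub_le {T : ℕ} {p y : EuclideanSpace ℝ (Fin d)} (h : y ∈ cell T p)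
    (m : Fin d) : |R.symm y m - R.symm p m| ≤ T * √d := by
  have := abs_apply_le_norm (R.symm (y - p)) m
  rw [R.symm.norm_map, map_sub] at this
  exact this.trans (norm_sub_le_of_mem_cell h)

/-- The period cells at the counted sites are disjoint, have volume T^d, and lie in the box enlarged
by their diameter T√d. -/
theorem count_rbox_le {T : ℕ} (hT : 0 < T) (x : EuclideanSpace ℝ (Fin d)) {lo hi : Fin d → ℝ}
    (h : ∀ m, lo m ≤ hi m) :
    count T x (rbox R lo hi) * (T : ℝ) ^ d ≤ ∏ m, (hi m - lo m + 2 * (T * √d)) := by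
  have hfin := finite_site_mem_rbox R hT x lo hi
  have hvol : ∑ z ∈ hfin.toFinset, volume (cell T (site T x z)) ≤
      volume (rbox R (fun m => lo m - T * √d) (fun m => hi m + T * √d)) := by
    rw [← measure_biUnion_finset]
    · refine measure_mono (Set.iUnion₂_subset fun z hz y hy m => ?_)
      have h1 := (hfin.mem_toFinset.1 hz) m
      have h2 := abs_le.1 (abs_symm_sub_le R hy m)
      constructor <;> linarith [h1.1, h1.2, h2.1, h2.2]
    · intro z _ w _ hzw
      refine Set.disjoint_left.2 fun y hy hy' => hzw (funext fun m => ?_)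
      rw [← (mem_cell_site_iff hT).1 hy m, (mem_cell_site_iff hT).1 hy' m]
    · exact fun z _ => measurableSet_rbox _ _ _
  have hnn : ∀ m, 0 ≤ hi m - lo m + 2 * (T * √d) := fun m =>
    add_nonneg (sub_nonneg.2 (h m)) (by positivity)
  simp only [volume_cell, Finset.sum_const, volume_rbox, nsmul_eq_mul] at hvol
  rw [← ENNReal.ofReal_prod_of_nonneg fun m _ => by linarith [hnn m]] at hvol
  have e : (hfin.toFinset.card : ℝ≥0∞) * (T : ℝ≥0∞) ^ d =
      ENNReal.ofReal (count T x (rbox R lo hi) * (T : ℝ) ^ d) := by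
    rw [count, Set.ncard_eq_toFinset_card _ hfin, ENNReal.ofReal_mul (by positivity),
      ENNReal.ofReal_natCast, ENNReal.ofReal_pow (by positivity), ENNReal.ofReal_natCast]
  rw [e, ENNReal.ofReal_le_ofReal_iff (Finset.prod_nonneg fun m _ => by linarith [hnn m])] at hvol
  refine hvol.trans (le_of_eq (Finset.prod_congr rfl fun m _ => by ring))

/-- The shrunken box is covered by the period cells whose corners lie in the full box. -/
theorem le_count_rbox {T : ℕ} (hT : 0 < T) (x : EuclideanSpace ℝ (Fin d)) {lo hi : Fin d → ℝ}
    (h : ∀ m, 2 * (T * √d) ≤ hi m - lo m) :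
    ∏ m, (hi m - lo m - 2 * (T * √d)) ≤ count T x (rbox R lo hi) * (T : ℝ) ^ d := by
  have hfin := finite_site_mem_rbox R hT x lo hi
  have hvol : volume (rbox R (fun m => lo m + T * √d) (fun m => hi m - T * √d)) ≤
      ∑ z ∈ hfin.toFinset, volume (cell T (site T x z)) := by
    refine le_trans (measure_mono fun y hy => ?_) (measure_biUnion_finset_le _ _)
    have hy' : y ∈ cell T (site T x fun m => ⌊(y m - x m) / T⌋) :=
      (mem_cell_site_iff hT).2 fun m => rfl
    refine Set.mem_biUnion (hfin.mem_toFinset.2 fun m => ?_) hy'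
    have h1 := hy m
    have h2 := abs_le.1 (abs_symm_sub_le R hy' m)
    constructor <;> linarith [h1.1, h1.2, h2.1, h2.2]
  simp only [volume_cell, Finset.sum_const, volume_rbox, nsmul_eq_mul] at hvol
  rw [← ENNReal.ofReal_prod_of_nonneg fun m _ => by linarith [h m]] at hvol
  have e : (hfin.toFinset.card : ℝ≥0∞) * (T : ℝ≥0∞) ^ d =
      ENNReal.ofReal (count T x (rbox R lo hi) * (T : ℝ) ^ d) := by
    rw [count, Set.ncard_eq_toFinset_card _ hfin, ENNReal.ofReal_mul (by positivity),
      ENNReal.ofReal_natCast, ENNReal.ofReal_pow (by positivity), ENNReal.ofReal_natCast]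
  rw [e, ENNReal.ofReal_le_ofReal_iff (by unfold count; positivity)] at hvol
  refine le_trans (le_of_eq (Finset.prod_congr rfl fun m _ => by ring)) hvol

/-- The height of integer translations in direction `ν`. -/
noncomputable def heightHom (T : ℕ) (ν : EuclideanSpace ℝ (Fin d)) : (Fin d → ℤ) →+ ℝ where
  toFun z := inner ℝ ν ((T : ℝ) • intVec z)
  map_zero' := by simp [intVec_zero]
  map_add' z w := by rw [intVec_add, smul_add, inner_add_right]

theorem heightHom_apply (T : ℕ) (ν : EuclideanSpace ℝ (Fin d)) (z : Fin d → ℤ) :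
    heightHom T ν z = inner ℝ ν ((T : ℝ) • intVec z) := rfl

theorem site_add_zsmul (T : ℕ) (x : EuclideanSpace ℝ (Fin d)) (z w : Fin d → ℤ) (n : ℤ) :
    site T x (z + n • w) = site T x z + (n : ℝ) • ((T : ℝ) • intVec w) := by
  rw [site_add, smul_comm]
  congr 2
  ext m; simp [intVec]

end Counting

/-! ### Slabs: boxes with one distinguished height direction. -/

section Slabs

variable {d : ℕ} [NeZero d]

/-- The last index of `Fin d`. -/
def lastIdx (d : ℕ) [NeZero d] : Fin d := ⟨d - 1, Nat.sub_lt (NeZero.pos d) one_pos⟩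

variable (R : EuclideanSpace ℝ (Fin d) ≃ₗᵢ[ℝ] EuclideanSpace ℝ (Fin d))

/-- The part between the heights `a` and `b` of a prism of width `ρ` with axis `R e_d`. -/
def slab (ρ a b : ℝ) : Set (EuclideanSpace ℝ (Fin d)) :=
  rbox R (Function.update (fun _ => -ρ / 2) (lastIdx d) a)
    (Function.update (fun _ => ρ / 2) (lastIdx d) b)

theorem mem_slab {ρ a b : ℝ} {p : EuclideanSpace ℝ (Fin d)} :
    p ∈ slab R ρ a b ↔ (∀ m, m ≠ lastIdx d → -ρ / 2 ≤ R.symm p m ∧ R.symm p m < ρ / 2) ∧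
      a ≤ R.symm p (lastIdx d) ∧ R.symm p (lastIdx d) < b := by
  unfold slab rbox
  constructor
  · intro h
    refine ⟨fun m hm => ?_, ?_⟩
    · simpa [hm] using h m
    · simpa using h (lastIdx d)
  · rintro ⟨h1, h2⟩ m
    by_cases hm : m = lastIdx d
    · subst hm; simpa using h2
    · simpa [hm] using h1 m hm

theorem prod_eq_pow_mul {f : Fin d → ℝ} {u v : ℝ} (h : ∀ m, m ≠ lastIdx d → f m = u)
    (hv : f (lastIdx d) = v) : ∏ m, f m = u ^ (d - 1) * v := by
  rw [← Finset.prod_erase_mul _ _ (Finset.mem_univ (lastIdx d)), hv]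
  congr 1
  rw [Finset.prod_congr rfl fun m hm => h m (Finset.ne_of_mem_erase hm), Finset.prod_const,
    Finset.card_erase_of_mem (Finset.mem_univ _), Finset.card_univ, Fintype.card_fin]

theorem count_slab_le {T : ℕ} (hT : 0 < T) (x : EuclideanSpace ℝ (Fin d)) {ρ a b : ℝ}
    (hρ : 0 ≤ ρ) (hab : a ≤ b) :
    count T x (slab R ρ a b) * (T : ℝ) ^ d ≤
      (ρ + 2 * (T * √d)) ^ (d - 1) * (b - a + 2 * (T * √d)) := by
  refine (count_rbox_le R hT x fun m => ?_).trans (le_of_eq (prod_eq_pow_mul (fun m hm => ?_) ?_))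
  · by_cases hm : m = lastIdx d
    · subst hm; simpa using hab
    · simp [hm]; linarith
  · simp [hm]; ring
  · simp

theorem le_count_slab {T : ℕ} (hT : 0 < T) (x : EuclideanSpace ℝ (Fin d)) {ρ a b : ℝ}
    (hρ : 2 * (T * √d) ≤ ρ) (hab : 2 * (T * √d) ≤ b - a) :
    (ρ - 2 * (T * √d)) ^ (d - 1) * (b - a - 2 * (T * √d)) ≤
      count T x (slab R ρ a b) * (T : ℝ) ^ d := by
  refine le_trans (le_of_eq (prod_eq_pow_mul (fun m hm => ?_) ?_).symm)
    (le_count_rbox R hT x fun m => ?_)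
  · simp [hm]; ring
  · simp
  · by_cases hm : m = lastIdx d
    · subst hm; simpa using hab
    · simp [hm]; linarith

theorem finite_site_mem_slab {T : ℕ} (hT : 0 < T) (x : EuclideanSpace ℝ (Fin d)) (ρ a b : ℝ) :
    {z : Fin d → ℤ | site T x z ∈ slab R ρ a b}.Finite := finite_site_mem_rbox R hT x _ _

end Slabs

/-! ### Density of translates in slabs of fixed thickness. -/

section Density

variable {d : ℕ} [NeZero d]
variable (R : EuclideanSpace ℝ (Fin d) ≃ₗᵢ[ℝ] EuclideanSpace ℝ (Fin d))

theorem symm_apply_last (p : EuclideanSpace ℝ (Fin d)) :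
    R.symm p (lastIdx d) = inner ℝ (R (lastBasisVec d)) p := by
  have h : inner ℝ (R (lastBasisVec d)) p = inner ℝ (lastBasisVec d) (R.symm p) := by
    rw [← R.inner_map_map (lastBasisVec d) (R.symm p), R.apply_symm_apply]
  rw [h, lastBasisVec, EuclideanSpace.inner_single_left]
  simp [lastIdx]

theorem slab_mono {ρ ρ' a a' b b' : ℝ} (hρ : ρ ≤ ρ') (ha : a' ≤ a) (hb : b ≤ b') :
    slab R ρ a b ⊆ slab R ρ' a' b' := by
  intro p hp
  rw [mem_slab] at hp ⊢
  refine ⟨fun m hm => ?_, ha.trans hp.2.1, hp.2.2.trans_le hb⟩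
  have := hp.1 m hm
  constructor <;> linarith [this.1, this.2]

theorem add_mem_slab {ρ a b : ℝ} {p : EuclideanSpace ℝ (Fin d)} (hp : p ∈ slab R ρ a b)
    (v : EuclideanSpace ℝ (Fin d)) :
    p + v ∈ slab R (ρ + 2 * ‖v‖) (a + R.symm v (lastIdx d)) (b + R.symm v (lastIdx d)) := by
  rw [mem_slab] at hp ⊢
  simp only [map_add, PiLp.add_apply]
  refine ⟨fun m hm => ?_, by linarith [hp.2.1], by linarith [hp.2.2]⟩
  have h1 := hp.1 m hm
  have h2 := abs_apply_le_norm (R.symm v) m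
  rw [R.symm.norm_map, abs_le] at h2
  constructor <;> linarith [h1.1, h1.2, h2.1, h2.2]

theorem site_add_zsmul_mem_slab {T : ℕ} {x : EuclideanSpace ℝ (Fin d)} {z w : Fin d → ℤ}
    {ρ a b : ℝ} (h : site T x z ∈ slab R ρ a b) (n : ℤ) :
    site T x (z + n • w) ∈ slab R (ρ + 2 * (|(n : ℝ)| * ‖(T : ℝ) • intVec w‖))
      (a + n * heightHom T (R (lastBasisVec d)) w)
      (b + n * heightHom T (R (lastBasisVec d)) w) := by
  have := add_mem_slab R h ((n : ℝ) • ((T : ℝ) • intVec w))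
  rw [symm_apply_last, inner_smul_right, norm_smul, Real.norm_eq_abs] at this
  rw [site_add_zsmul]
  exact this

/-- Volume comparison is too crude for a slab of fixed thickness. Its `n` shifts by multiples of `w`
are disjoint because the step in height is at least `q`, and together they lie in one thick slab,
where the relative error is small. -/
theorem mul_count_slab_le {T : ℕ} (hT : 0 < T) (x : EuclideanSpace ℝ (Fin d)) {q : ℝ}
    {w : Fin d → ℤ} (hq : 0 ≤ q) (hw : q ≤ heightHom T (R (lastBasisVec d)) w) (n : ℕ)
    (ρ a : ℝ) :
    n * count T x (slab R ρ a (a + q)) ≤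
      count T x (slab R (ρ + 2 * (n * ‖(T : ℝ) • intVec w‖)) a
        (a + n * heightHom T (R (lastBasisVec d)) w)) := by
  classical
  set g := heightHom T (R (lastBasisVec d)) w with hg
  have hfin := finite_site_mem_slab R hT x ρ a (a + q)
  have hfin' := finite_site_mem_slab R hT x (ρ + 2 * (n * ‖(T : ℝ) • intVec w‖)) a (a + n * g)
  unfold count
  rw [Set.ncard_eq_toFinset_card _ hfin, Set.ncard_eq_toFinset_card _ hfin']
  have := Finset.card_le_card_of_injOn (s := Finset.range n ×ˢ hfin.toFinset)
    (t := hfin'.toFinset) (fun i : ℕ × (Fin d → ℤ) => i.2 + (i.1 : ℤ) • w) ?_ ?_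
  · rw [Finset.card_product, Finset.card_range] at this
    exact_mod_cast this
  · rintro ⟨i, z⟩ hi
    rw [Finset.mem_coe, Finset.mem_product, Finset.mem_range, Set.Finite.mem_toFinset] at hi
    rw [Finset.mem_coe, Set.Finite.mem_toFinset]
    have hin : (i : ℝ) + 1 ≤ n := by exact_mod_cast hi.1
    have hi0 : (0 : ℝ) ≤ i := Nat.cast_nonneg i
    refine slab_mono R ?_ ?_ ?_ (site_add_zsmul_mem_slab R hi.2 i)
    · simp only [Int.cast_natCast, Nat.abs_cast]
      have : (i : ℝ) * ‖(T : ℝ) • intVec w‖ ≤ n * ‖(T : ℝ) • intVec w‖ :=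
        mul_le_mul_of_nonneg_right (by linarith) (norm_nonneg _)
      linarith
    · simp only [Int.cast_natCast, ← hg]
      nlinarith
    · simp only [Int.cast_natCast, ← hg]
      nlinarith
  · rintro ⟨i, z⟩ hi ⟨j, y⟩ hj hij
    rw [Finset.mem_coe, Finset.mem_product, Finset.mem_range, Set.Finite.mem_toFinset] at hi hj
    simp only at hij hi hj
    have hz := ((mem_slab R).1 (site_add_zsmul_mem_slab R (w := w) hi.2 i)).2
    have hy := ((mem_slab R).1 (site_add_zsmul_mem_slab R (w := w) hj.2 j)).2
    rw [hij] at hz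
    simp only [Int.cast_natCast, ← hg] at hz hy
    -- A common height in layers `i` and `j` forces `i ≤ j`; by symmetry the layer index is
    -- determined.
    have key : ∀ i j : ℕ, a + i * g < a + q + j * g → i ≤ j := by
      intro i j h
      by_contra hlt
      have h1 : (j : ℝ) + 1 ≤ i := by exact_mod_cast not_le.1 hlt
      nlinarith
    have : i = j := le_antisymm (key i j (hz.1.trans_lt hy.2)) (key j i (hy.1.trans_lt hz.2))
    subst this
    simpa using hij

/-- The thick slab is cut into `n` layers of thickness at most `q`; each is shifted back to the
bottom by a multiple of `w`. The narrower width leaves room for the lateral drift. -/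
theorem count_slab_le_mul {T : ℕ} (hT : 0 < T) (x : EuclideanSpace ℝ (Fin d)) {q : ℝ}
    {w : Fin d → ℤ} (hpos : 0 < heightHom T (R (lastBasisVec d)) w)
    (hw : heightHom T (R (lastBasisVec d)) w ≤ q) (n : ℕ) (ρ a : ℝ) :
    count T x (slab R (ρ - 2 * (n * ‖(T : ℝ) • intVec w‖)) a
        (a + n * heightHom T (R (lastBasisVec d)) w)) ≤
      n * count T x (slab R ρ a (a + q)) := by
  classical
  set g := heightHom T (R (lastBasisVec d)) w with hg
  have hfin := finite_site_mem_slab R hT x ρ a (a + q)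
  have hfin' := finite_site_mem_slab R hT x (ρ - 2 * (n * ‖(T : ℝ) • intVec w‖)) a (a + n * g)
  unfold count
  rw [Set.ncard_eq_toFinset_card _ hfin, Set.ncard_eq_toFinset_card _ hfin']
  let lev : (Fin d → ℤ) → ℤ := fun z => ⌊(R.symm (site T x z) (lastIdx d) - a) / g⌋
  have := Finset.card_le_card_of_injOn (t := Finset.range n ×ˢ hfin.toFinset)
    (s := hfin'.toFinset) (fun z => ((lev z).toNat, z + (-((lev z).toNat : ℤ)) • w)) ?_ ?_
  · rw [Finset.card_product, Finset.card_range] at this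
    exact_mod_cast this
  · intro z hz
    rw [Finset.mem_coe, Set.Finite.mem_toFinset] at hz
    have hz : site T x z ∈ slab R (ρ - 2 * (n * ‖(T : ℝ) • intVec w‖)) a (a + n * g) := hz
    have hz' := ((mem_slab R).1 hz).2
    have h0 : 0 ≤ lev z := Int.floor_nonneg.2 (div_nonneg (by linarith [hz'.1]) hpos.le)
    have hcast : (((lev z).toNat : ℤ) : ℝ) = (lev z : ℝ) := by rw [Int.toNat_of_nonneg h0]
    have hlt : lev z < n := by
      rw [Int.floor_lt, div_lt_iff₀ hpos]
      push_cast
      linarith [hz'.2]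
    have hle := (Int.floor_le ((R.symm (site T x z) (lastIdx d) - a) / g))
    rw [le_div_iff₀ hpos] at hle
    have hlt2 := Int.lt_floor_add_one ((R.symm (site T x z) (lastIdx d) - a) / g)
    rw [div_lt_iff₀ hpos] at hlt2
    rw [Finset.mem_coe, Finset.mem_product, Finset.mem_range, Set.Finite.mem_toFinset]
    refine ⟨by simp only; omega, ?_⟩
    have hp : site T x z ∈ slab R (ρ - 2 * (n * ‖(T : ℝ) • intVec w‖))
        (R.symm (site T x z) (lastIdx d)) (a + (lev z + 1 : ℝ) * g) := by
      rw [mem_slab] at hz ⊢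
      exact ⟨hz.1, le_rfl, by simp only [lev]; linarith⟩
    have hnR : (lev z : ℝ) ≤ n := by exact_mod_cast hlt.le
    refine slab_mono R ?_ ?_ ?_ (site_add_zsmul_mem_slab R hp _)
    · rw [Int.cast_neg, abs_neg, hcast, abs_of_nonneg (by exact_mod_cast h0)]
      have : (lev z : ℝ) * ‖(T : ℝ) • intVec w‖ ≤ n * ‖(T : ℝ) • intVec w‖ :=
        mul_le_mul_of_nonneg_right hnR (norm_nonneg _)
      linarith
    · rw [Int.cast_neg, hcast, ← hg]
      simp only [lev]
      linarith
    · rw [Int.cast_neg, hcast, ← hg]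
      linarith
  · intro z _ y _ h
    simp only [Prod.mk.injEq] at h
    rw [h.1] at h
    simpa using h.2

theorem tendsto_shift_pow_div (c : ℝ) (k : ℕ) :
    Tendsto (fun ρ : ℝ => (ρ + c) ^ k / ρ ^ k) atTop (𝓝 1) := by
  have h1 : Tendsto (fun ρ : ℝ => 1 + c / ρ) atTop (𝓝 (1 + 0)) :=
    (tendsto_const_nhds.div_atTop tendsto_id).const_add 1
  have h2 := h1.pow k
  rw [add_zero, one_pow] at h2
  refine h2.congr' ?_
  filter_upwards [eventually_gt_atTop 0] with ρ hρ
  rw [← div_pow, add_div, div_self hρ.ne']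

/-- The density of lattice translates in a slab whose height can be approximated by
translations. -/
theorem tendsto_count_slab {T : ℕ} (hT : 0 < T) (x : EuclideanSpace ℝ (Fin d)) (a : ℝ) {q : ℝ}
    (hq : 0 ≤ q) (hG : Dense ((heightHom T (R (lastBasisVec d))).range : Set ℝ) ∨
      q ∈ (heightHom T (R (lastBasisVec d))).range) :
    Tendsto (fun ρ : ℝ => count T x (slab R ρ a (a + q)) / ρ ^ (d - 1)) atTop
      (𝓝 (q / (T : ℝ) ^ d)) := by
  have hTd : (0 : ℝ) < (T : ℝ) ^ d := by positivity
  rcases hq.eq_or_lt with rfl | hq0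
  · refine tendsto_const_nhds.congr fun ρ => ?_
    have : {z : Fin d → ℤ | site T x z ∈ slab R ρ a (a + 0)} = ∅ := by
      refine Set.eq_empty_of_forall_notMem fun z hz => ?_
      have := ((mem_slab R).1 hz).2
      linarith [this.1, this.2]
    rw [count, this]; simp
  set c := 2 * (T * √d : ℝ) with hc
  have hc0 : 0 ≤ c := by positivity
  have hup : ∀ ε > 0, ∃ w, q ≤ heightHom T (R (lastBasisVec d)) w ∧
      heightHom T (R (lastBasisVec d)) w ≤ q + ε := by
    intro ε hε
    rcases hG with hG | ⟨w, hw⟩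
    · obtain ⟨_, ⟨w, rfl⟩, h1, h2⟩ := hG.exists_between (lt_add_of_pos_right q hε)
      exact ⟨w, h1.le, h2.le⟩
    · exact ⟨w, hw.ge, by rw [hw]; linarith⟩
  have hlow : ∀ ε > 0, ∃ w, q - ε ≤ heightHom T (R (lastBasisVec d)) w ∧
      heightHom T (R (lastBasisVec d)) w ≤ q := by
    intro ε hε
    rcases hG with hG | ⟨w, hw⟩
    · obtain ⟨_, ⟨w, rfl⟩, h1, h2⟩ := hG.exists_between (sub_lt_self q hε)
      exact ⟨w, h1.le, h2.le⟩
    · exact ⟨w, by rw [hw]; linarith, hw.le⟩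
  suffices h : Tendsto (fun ρ : ℝ => count T x (slab R ρ a (a + q)) * (T : ℝ) ^ d / ρ ^ (d - 1))
      atTop (𝓝 q) by
    refine (h.div_const ((T : ℝ) ^ d)).congr fun ρ => ?_
    field_simp
  rw [tendsto_order]
  constructor
  · intro l hl
    set ε := min ((q - l) / 3) (q / 2) with hε
    have hεpos : 0 < ε := lt_min (by linarith) (by linarith)
    have hε1 : ε ≤ (q - l) / 3 := min_le_left _ _
    have hε2 : ε ≤ q / 2 := min_le_right _ _
    obtain ⟨w, hw1, hw2⟩ := hlow ε hεpos
    set g := heightHom T (R (lastBasisVec d)) w with hg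
    have hgpos : 0 < g := by linarith
    -- The first bound makes the volume error `c` at most `n * ε`; the second makes the stacked slab
    -- thick enough for `le_count_slab`.
    obtain ⟨n, hn⟩ := exists_nat_gt (max (c / ε) (c / g))
    have hn1 : c / ε < n := (le_max_left _ _).trans_lt hn
    have hn2 : c / g < n := (le_max_right _ _).trans_lt hn
    have hn0 : (0 : ℝ) < n := lt_of_le_of_lt (by positivity) hn1
    rw [div_lt_iff₀ hεpos] at hn1
    rw [div_lt_iff₀ hgpos] at hn2
    set e := 2 * (n * ‖(T : ℝ) • intVec w‖) with he
    have hlim := (tendsto_shift_pow_div (-(e + c)) (d - 1)).mul_const (q - 2 * ε)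
    rw [one_mul] at hlim
    filter_upwards [hlim.eventually_const_lt (show l < q - 2 * ε by linarith),
      eventually_gt_atTop 0, eventually_ge_atTop (e + c)] with ρ h1 hρ hρ2
    refine h1.trans_le ?_
    rw [div_mul_eq_mul_div]
    refine div_le_div_of_nonneg_right ?_ (by positivity)
    have h2 := count_slab_le_mul R hT x hgpos hw2 n ρ a
    have h3 := le_count_slab R hT x (ρ := ρ - e) (a := a) (b := a + n * g) (by linarith)
      (by linarith)
    rw [← hc] at h3
    have h4 : n * ((ρ + -(e + c)) ^ (d - 1) * (q - 2 * ε)) ≤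
        n * (count T x (slab R ρ a (a + q)) * (T : ℝ) ^ d) := by
      calc n * ((ρ + -(e + c)) ^ (d - 1) * (q - 2 * ε))
          = (ρ - e - c) ^ (d - 1) * (n * (q - 2 * ε)) := by
            rw [show ρ + -(e + c) = ρ - e - c by ring]; ring
        _ ≤ (ρ - e - c) ^ (d - 1) * (a + n * g - a - c) := by
            refine mul_le_mul_of_nonneg_left ?_ (pow_nonneg (by linarith) _)
            nlinarith
        _ ≤ _ := h3
        _ ≤ n * count T x (slab R ρ a (a + q)) * (T : ℝ) ^ d :=
            mul_le_mul_of_nonneg_right h2 hTd.le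
        _ = _ := by ring
    exact le_of_mul_le_mul_left h4 hn0
  · intro l hl
    set ε := (l - q) / 3 with hε
    have hεpos : 0 < ε := by rw [hε]; linarith
    obtain ⟨w, hw1, hw2⟩ := hup ε hεpos
    set g := heightHom T (R (lastBasisVec d)) w with hg
    have hgpos : 0 < g := by linarith
    obtain ⟨n, hn1⟩ := exists_nat_gt (c / ε)
    have hn0 : (0 : ℝ) < n := lt_of_le_of_lt (by positivity) hn1
    rw [div_lt_iff₀ hεpos] at hn1
    set e := 2 * (n * ‖(T : ℝ) • intVec w‖) with he
    have he0 : 0 ≤ e := by positivity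
    have hlim := (tendsto_shift_pow_div (e + c) (d - 1)).mul_const (q + 2 * ε)
    rw [one_mul] at hlim
    filter_upwards [hlim.eventually_lt_const (show q + 2 * ε < l by rw [hε]; linarith),
      eventually_gt_atTop 0] with ρ h1 hρ
    refine lt_of_le_of_lt ?_ h1
    rw [div_mul_eq_mul_div]
    refine div_le_div_of_nonneg_right ?_ (by positivity)
    have h2 := mul_count_slab_le R hT x hq hw1 n ρ a
    have h3 := count_slab_le R hT x (ρ := ρ + e) (a := a) (b := a + n * g) (by linarith)
      (le_add_of_nonneg_right (by positivity))
    rw [← hc] at h3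
    have h4 : n * (count T x (slab R ρ a (a + q)) * (T : ℝ) ^ d) ≤
        n * ((ρ + (e + c)) ^ (d - 1) * (q + 2 * ε)) := by
      calc n * (count T x (slab R ρ a (a + q)) * (T : ℝ) ^ d)
          = n * count T x (slab R ρ a (a + q)) * (T : ℝ) ^ d := by ring
        _ ≤ count T x (slab R (ρ + e) a (a + n * g)) * (T : ℝ) ^ d :=
            mul_le_mul_of_nonneg_right h2 hTd.le
        _ ≤ (ρ + e + c) ^ (d - 1) * (a + n * g - a + c) := h3
        _ ≤ (ρ + e + c) ^ (d - 1) * (n * (q + 2 * ε)) := by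
            refine mul_le_mul_of_nonneg_left ?_ (pow_nonneg (by linarith) _)
            nlinarith
        _ = _ := by rw [show ρ + (e + c) = ρ + e + c by ring]; ring
    exact le_of_mul_le_mul_left h4 hn0

end Density

/-! ### Averaging the rounding of two reals over a common offset. -/

section Rounding

open MeasureTheory

theorem intervalIntegrable_floor_add (A : ℝ) :
    IntervalIntegrable (fun x : ℝ => (⌊A + x⌋ : ℝ)) volume 0 1 := by
  refine Monotone.intervalIntegrable fun x y h => ?_
  exact_mod_cast Int.floor_le_floor (add_le_add_right h A)

/-- The floor is the identity minus a 1-periodic function, whose integral over a period does not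
depend on the shift. -/
theorem integral_floor_sub_floor (A B : ℝ) :
    ∫ x in (0 : ℝ)..1, ((⌊A + x⌋ : ℝ) - ⌊B + x⌋) = A - B := by
  have hper : ∀ A : ℝ, ∫ x in (0 : ℝ)..1, Int.fract (A + x) = ∫ x in (0 : ℝ)..1, Int.fract x := by
    intro A
    have hp : Function.Periodic (Int.fract : ℝ → ℝ) 1 := Int.fract_periodic ℝ
    rw [intervalIntegral.integral_comp_add_left (fun x => Int.fract x) A, add_zero]
    have := hp.intervalIntegral_add_eq A 0
    rwa [zero_add] at this
  have hfloor : ∀ A : ℝ, ∫ x in (0 : ℝ)..1, (⌊A + x⌋ : ℝ) =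
      A + 1 / 2 - ∫ x in (0 : ℝ)..1, Int.fract x := by
    intro A
    have h1 : IntervalIntegrable (fun x : ℝ => A + x) volume 0 1 :=
      (continuous_const.add continuous_id).intervalIntegrable 0 1
    have h2 : ∫ x in (0 : ℝ)..1, Int.fract (A + x) =
        (∫ x in (0 : ℝ)..1, (A + x)) - ∫ x in (0 : ℝ)..1, (⌊A + x⌋ : ℝ) := by
      rw [← intervalIntegral.integral_sub h1 (intervalIntegrable_floor_add A)]
      rfl
    have h3 : ∫ x in (0 : ℝ)..1, (A + x) = A + 1 / 2 := by
      rw [intervalIntegral.integral_add (by simp) (by simp)]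
      simp
    rw [hper, h3] at h2
    linarith
  rw [intervalIntegral.integral_sub (intervalIntegrable_floor_add A)
    (intervalIntegrable_floor_add B), hfloor, hfloor]
  ring

/-- Monotonicity of the floor fixes the sign of the integrand for all offsets, so the positive part
commutes with averaging: a discrete coarea formula. -/
theorem integral_max_floor_sub_floor (A B : ℝ) :
    ∫ x in (0 : ℝ)..1, max ((⌊A + x⌋ : ℝ) - ⌊B + x⌋) 0 = max (A - B) 0 := by
  rcases le_total B A with h | h
  · rw [max_eq_left (sub_nonneg.2 h), ← integral_floor_sub_floor]
    congr 1; ext x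
    refine max_eq_left (sub_nonneg.2 ?_)
    exact_mod_cast Int.floor_le_floor (add_le_add_left h x)
  · rw [max_eq_right (sub_nonpos.2 h)]
    rw [intervalIntegral.integral_congr (g := fun _ => (0 : ℝ)), intervalIntegral.integral_zero]
    intro x _
    refine max_eq_right (sub_nonpos.2 ?_)
    exact_mod_cast Int.floor_le_floor (add_le_add_left h x)

theorem lintegral_max_floor_sub_floor (A B : ℝ) {b : ℝ} (hb : 0 ≤ b) :
    ∫⁻ x in Set.Ioc (0 : ℝ) 1, ENNReal.ofReal (b * max ((⌊A + x⌋ : ℝ) - ⌊B + x⌋) 0) =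
      ENNReal.ofReal (b * max (A - B) 0) := by
  have hi : IntervalIntegrable (fun x : ℝ => b * max ((⌊A + x⌋ : ℝ) - ⌊B + x⌋) 0) volume 0 1 := by
    have := ((intervalIntegrable_floor_add A).sub (intervalIntegrable_floor_add B))
    rw [intervalIntegrable_iff_integrableOn_Ioc_of_le zero_le_one] at this ⊢
    exact (Integrable.pos_part this).const_mul b
  rw [← ofReal_integral_eq_lintegral_ofReal
    ((intervalIntegrable_iff_integrableOn_Ioc_of_le zero_le_one).1 hi)
    (Eventually.of_forall fun x => mul_nonneg hb (le_max_right _ _)),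
    ← intervalIntegral.integral_of_le zero_le_one, intervalIntegral.integral_const_mul,
    integral_max_floor_sub_floor]

end Rounding

/-! ### Edges of the periodic graph and admissible potentials. -/

section Edges

variable {d : ℕ} {K : Type*}

/-- An edge of the periodic graph: two classes of points and an integer translation. -/
abbrev Edge (K : Type*) (d : ℕ) := K × K × (Fin d → ℤ)

/-- The class of the first endpoint. -/
def edgeSrc (κ : Edge K d) : K := κ.1

/-- The class of the second endpoint. -/
def edgeTgt (κ : Edge K d) : K := κ.2.1

/-- The vector from the second to the first endpoint. -/
noncomputable def edgeVec (x : K → EuclideanSpace ℝ (Fin d)) (T : ℕ) (κ : Edge K d) :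
    EuclideanSpace ℝ (Fin d) := x κ.1 - site T (x κ.2.1) κ.2.2

/-- The difference along edges of the height in direction `ν` plus the potential `ω`. -/
noncomputable def jump (x : K → EuclideanSpace ℝ (Fin d)) (T : ℕ)
    (ν : EuclideanSpace ℝ (Fin d)) (ω : K → ℝ) : Edge K d → ℝ :=
  slope (edgeVec x T) ν + grad edgeSrc edgeTgt ω

variable (x : K → EuclideanSpace ℝ (Fin d)) (T : ℕ) (ν : EuclideanSpace ℝ (Fin d))

theorem edgeVec_eq (κ : Edge K d) (z : Fin d → ℤ) :
    edgeVec x T κ = site T (x κ.1) z - site T (x κ.2.1) (z + κ.2.2) := by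
  simp only [edgeVec, site, intVec_add, smul_add]
  abel

theorem inner_site (p : EuclideanSpace ℝ (Fin d)) (z : Fin d → ℤ) :
    inner ℝ ν (site T p z) = inner ℝ ν p + heightHom T ν z := by
  rw [site, inner_add_right, heightHom_apply]

theorem jump_apply (ω : K → ℝ) (κ : Edge K d) (z : Fin d → ℤ) :
    jump x T ν ω κ = (inner ℝ ν (site T (x κ.1) z) + ω κ.1) -
      (inner ℝ ν (site T (x κ.2.1) (z + κ.2.2)) + ω κ.2.1) := by
  simp only [jump, Pi.add_apply, slope, grad, edgeSrc, edgeTgt, edgeVec_eq x T κ z,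
    inner_sub_right]
  ring

theorem jump_apply' (ω : K → ℝ) (κ : Edge K d) :
    jump x T ν ω κ = (inner ℝ ν (x κ.1) + ω κ.1) -
      (inner ℝ ν (x κ.2.1) + ω κ.2.1 + heightHom T ν κ.2.2) := by
  rw [jump_apply x T ν ω κ 0, inner_site, inner_site, zero_add, map_zero]
  ring

/-- The jumps of the potential can be realised, or approximated, by lattice translations. -/
def Admissible (ω : K → ℝ) : Prop :=
  Dense ((heightHom T ν).range : Set ℝ) ∨
    ∀ κ : Edge K d, jump x T ν ω κ ∈ (heightHom T ν).range

variable {T ν}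

theorem heightHom_single (m : Fin d) : heightHom T ν (Pi.single m 1) = T * ν m := by
  have h : intVec (Pi.single m 1 : Fin d → ℤ) = EuclideanSpace.single m (1 : ℝ) := by
    ext j
    rcases eq_or_ne j m with rfl | hj
    · simp [intVec]
    · simp [intVec, hj]
  rw [heightHom_apply, h, inner_smul_right, EuclideanSpace.inner_single_right]
  simp

theorem dense_or_exists_generator (hT : 0 < T) (hν : ν ≠ 0) :
    Dense ((heightHom T ν).range : Set ℝ) ∨
      ∃ a : ℝ, 0 < a ∧ ∀ y, y ∈ (heightHom T ν).range ↔ ∃ n : ℤ, y = n * a := by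
  refine (AddSubgroup.dense_or_cyclic _).imp id ?_
  rintro ⟨a, ha⟩
  have hmem : ∀ y, y ∈ (heightHom T ν).range ↔ ∃ n : ℤ, y = n * a := fun y => by
    rw [ha, AddSubgroup.mem_closure_singleton]
    simp only [zsmul_eq_mul, eq_comm]
  have ha0 : a ≠ 0 := by
    rintro rfl
    apply hν
    ext m
    obtain ⟨n, hn⟩ := (hmem (heightHom T ν (Pi.single m 1))).1 ⟨_, rfl⟩
    rw [mul_zero, heightHom_single, mul_eq_zero] at hn
    exact hn.resolve_left (by exact_mod_cast hT.ne')
  rcases lt_or_gt_of_ne ha0 with h | h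
  · refine ⟨-a, neg_pos.2 h, fun y => (hmem y).trans ⟨?_, ?_⟩⟩ <;> rintro ⟨n, rfl⟩ <;>
      exact ⟨-n, by push_cast; ring⟩
  · exact ⟨a, h, hmem⟩

variable (T ν) in
/-- The potential obtained by rounding the heights to multiples of `a`. -/
noncomputable def rounded (a : ℝ) (ω : K → ℝ) (τ : ℝ) : K → ℝ := fun k =>
  a * ⌊(inner ℝ ν (x k) + ω k) / a + τ⌋ - inner ℝ ν (x k)

/-- The height of the translation is an integer multiple of `a`, so it passes through the floor and
both endpoints are rounded with the same offset. -/
theorem jump_rounded {a : ℝ} (ω : K → ℝ) (τ : ℝ) (κ : Edge K d) {n : ℤ}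
    (hn : heightHom T ν κ.2.2 = n * a) :
    jump x T ν (rounded x ν a ω τ) κ = a * ((⌊(inner ℝ ν (x κ.1) + ω κ.1) / a + τ⌋ : ℝ) -
      ⌊((inner ℝ ν (x κ.2.1) + ω κ.2.1) / a + n) + τ⌋) := by
  rw [jump_apply', hn, add_right_comm _ (n : ℝ) τ, Int.floor_add_intCast, Int.cast_add]
  simp only [rounded]
  ring

theorem admissible_rounded {a : ℝ}
    (hG : ∀ y, y ∈ (heightHom T ν).range ↔ ∃ n : ℤ, y = n * a) (ω : K → ℝ) (τ : ℝ) :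
    Admissible x T ν (rounded x ν a ω τ) := by
  refine Or.inr fun κ => ?_
  obtain ⟨n, hn⟩ := (hG _).1 ⟨κ.2.2, rfl⟩
  rw [jump_rounded x ω τ κ hn, hG]
  exact ⟨_, by rw [← Int.cast_sub, mul_comm]⟩

/-- When heights are multiples of `a`, every rounding of `ω` is admissible, and by the coarea
identity its energy averaged over the offset equals the original energy. Some offset is therefore no
worse than the average. -/
theorem exists_admissible_le [Fintype K] (hT : 0 < T) (hν : ν ≠ 0) {C : Edge K d → ℝ}
    (hC : ∀ κ, 0 ≤ C κ) (hCs : Summable C) (hD : Summable fun κ => C κ * ‖edgeVec x T κ‖)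
    (ω : K → ℝ) :
    ∃ ω' : K → ℝ, Admissible x T ν ω' ∧ posSum C (jump x T ν ω') ≤ posSum C (jump x T ν ω) := by
  classical
  rcases dense_or_exists_generator hT hν with h | ⟨a, ha, hG⟩
  · exact ⟨ω, Or.inl h, le_rfl⟩
  have hn : ∀ κ : Edge K d, ∃ n : ℤ, heightHom T ν κ.2.2 = n * a := fun κ =>
    (hG _).1 ⟨κ.2.2, rfl⟩
  choose n hn using hn
  have hsum : ∀ ω, Summable fun κ => C κ * max (jump x T ν ω κ) 0 := fun ω =>
    summable_mul_posPart (summable_mul_add (summable_mul_slope hC hD ν)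
      (summable_mul_grad hCs _ _ ω))
  set A : Edge K d → ℝ := fun κ => (inner ℝ ν (x κ.1) + ω κ.1) / a with hA
  set B : Edge K d → ℝ := fun κ => (inner ℝ ν (x κ.2.1) + ω κ.2.1) / a + n κ with hB
  have hterm : ∀ τ κ, C κ * max (jump x T ν (rounded x ν a ω τ) κ) 0 =
      (C κ * a) * max ((⌊A κ + τ⌋ : ℝ) - ⌊B κ + τ⌋) 0 := by
    intro τ κ
    rw [jump_rounded x ω τ κ (hn κ), mul_assoc, mul_max_of_nonneg _ _ ha.le, mul_zero]
  have hterm0 : ∀ κ, (C κ * a) * max (A κ - B κ) 0 = C κ * max (jump x T ν ω κ) 0 := by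
    intro κ
    rw [jump_apply', hn κ, mul_assoc, mul_max_of_nonneg _ _ ha.le, mul_zero]
    congr 2
    simp only [hA, hB]
    field_simp
  have hmeas : ∀ κ, Measurable fun τ : ℝ =>
      ENNReal.ofReal ((C κ * a) * max ((⌊A κ + τ⌋ : ℝ) - ⌊B κ + τ⌋) 0) := by
    intro κ
    have : ∀ A : ℝ, Measurable fun τ : ℝ => ((⌊A + τ⌋ : ℤ) : ℝ) := fun A =>
      measurable_from_top.comp (Int.measurable_floor.comp (measurable_const_add A))
    exact ((((this _).sub (this _)).max measurable_const).const_mul _).ennreal_ofReal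
  have : MeasureTheory.IsProbabilityMeasure (MeasureTheory.volume.restrict (Set.Ioc (0 : ℝ) 1)) :=
    ⟨by simp⟩
  obtain ⟨τ, hτ⟩ := MeasureTheory.exists_le_lintegral
    (μ := MeasureTheory.volume.restrict (Set.Ioc (0 : ℝ) 1))
    (f := fun τ : ℝ => ∑' κ, ENNReal.ofReal ((C κ * a) * max ((⌊A κ + τ⌋ : ℝ) - ⌊B κ + τ⌋) 0))
    (Measurable.tsum hmeas).aemeasurable
  rw [MeasureTheory.lintegral_tsum fun κ => (hmeas κ).aemeasurable] at hτ
  simp only [fun κ => lintegral_max_floor_sub_floor (A κ) (B κ) (mul_nonneg (hC κ) ha.le)] at hτ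
  simp only [hterm0, ← hterm] at hτ
  refine ⟨rounded x ν a ω τ, admissible_rounded x hG ω τ, ?_⟩
  rw [← ENNReal.ofReal_tsum_of_nonneg (fun κ => mul_nonneg (hC κ) (le_max_right _ _)) (hsum _),
    ← ENNReal.ofReal_tsum_of_nonneg (fun κ => mul_nonneg (hC κ) (le_max_right _ _)) (hsum _)] at hτ
  exact (ENNReal.ofReal_le_ofReal_iff (posSum_nonneg hC _)).1 hτ

/-- Rounding heights down to multiples of the generator does not change their sign pattern. The half
space itself can thus be counted through an admissible potential. -/
theorem exists_admissible_planar (hT : 0 < T) (hν : ν ≠ 0) :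
    ∃ ω : K → ℝ, Admissible x T ν ω ∧ ∀ k z,
      (0 ≤ inner ℝ ν (site T (x k) z) ↔ 0 ≤ inner ℝ ν (site T (x k) z) + ω k) := by
  rcases dense_or_exists_generator hT hν with h | ⟨a, ha, hG⟩
  · exact ⟨0, Or.inl h, by simp⟩
  refine ⟨rounded x ν a 0 0, admissible_rounded x hG 0 0, fun k z => ?_⟩
  obtain ⟨n, hn⟩ := (hG _).1 ⟨z, rfl⟩
  rw [inner_site, hn, show inner ℝ ν (x k) + n * a + rounded x ν a 0 0 k =
    a * ((⌊inner ℝ ν (x k) / a + n⌋ : ℤ) : ℝ) by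
      rw [Int.floor_add_intCast]; simp only [rounded, Pi.zero_apply, add_zero]; push_cast; ring,
    mul_nonneg_iff_of_pos_left ha, Int.cast_nonneg_iff, Int.floor_nonneg,
    show inner ℝ ν (x k) + n * a = a * (inner ℝ ν (x k) / a + n) by field_simp,
    mul_nonneg_iff_of_pos_left ha]

theorem heightHom_injective (hT : 0 < T) (hν : TotallyIrrational ν) :
    Function.Injective (heightHom T ν) := by
  rw [injective_iff_map_eq_zero]
  intro q hq
  by_contra h0
  rw [heightHom_apply, inner_smul_right, mul_eq_zero] at hq
  refine hν q h0 ?_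
  rw [real_inner_comm]
  exact hq.resolve_left (by exact_mod_cast hT.ne')

/-- In a totally irrational direction every other direction admits a potential that is constant
on the level sets of a given one. -/
theorem exists_compatible_potential (hT : 0 < T) (hν : TotallyIrrational ν) (ω : K → ℝ)
    (ξ : EuclideanSpace ℝ (Fin d)) :
    ∃ η : K → ℝ, ∀ κ : Edge K d, jump x T ν ω κ = 0 → jump x T ξ η κ = 0 := by
  -- An edge has zero jump exactly when its endpoints lie at the same value of height plus `ω`.
  -- Classes linked by some such translation are grouped, and each `k` receives the translation `W
  -- k` relative to its representative; injectivity of the height makes these translations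
  -- consistent along edges.
  let u : K → ℝ := fun k => inner ℝ ν (x k) + ω k
  let S : Setoid K :=
    { r := fun k l => ∃ w, u k = u l + heightHom T ν w
      iseqv :=
        { refl := fun k => ⟨0, by simp⟩
          symm := fun {k l} ⟨w, h⟩ => ⟨-w, by rw [map_neg]; linarith⟩
          trans := fun {k l m} ⟨w, h⟩ ⟨w', h'⟩ => ⟨w + w', by rw [map_add]; linarith⟩ } }
  let r : K → K := fun k => (Quotient.mk S k).out
  have hr : ∀ k, ∃ w, u k = u (r k) + heightHom T ν w := fun k => S.symm (Quotient.mk_out k)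
  choose W hW using hr
  refine ⟨fun k => inner ℝ ξ (site T (x (r k)) (W k)) - inner ℝ ξ (x k), ?_⟩
  rintro ⟨k, l, w⟩ h
  rw [jump_apply'] at h ⊢
  simp only at h ⊢
  have h1 : u k = u l + heightHom T ν w := by simp only [u]; linarith
  have hrr : r k = r l := by
    simp only [r]
    rw [Quotient.sound (s := S) ⟨w, h1⟩]
  have h2 : W k = W l + w := by
    apply heightHom_injective hT hν
    have e1 := hW k
    have e2 := hW l
    rw [hrr] at e1
    rw [map_add]
    linarith
  rw [h2, hrr, inner_site, inner_site, map_add]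
  ring

end Edges

/-! ### Calculus of edge counts of order S^(d-1). -/

section EdgeDensity

variable {d : ℕ} {K : Type*} (x : K → EuclideanSpace ℝ (Fin d)) (T : ℕ)

/-- A family of edge functions of size `S ^ (d - 1)`, locally uniformly in the edge length, with
pointwise limit `θ` after normalisation. -/
def HasDensity (n : ℝ → Edge K d → ℝ) (θ : Edge K d → ℝ) : Prop :=
  (∃ A : ℝ, ∀ᶠ S : ℝ in atTop, ∀ κ, |n S κ| ≤ A * (1 + ‖edgeVec x T κ‖) * S ^ (d - 1)) ∧
    ∀ κ, Tendsto (fun S : ℝ => n S κ / S ^ (d - 1)) atTop (𝓝 (θ κ))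

variable {x T} {n n' : ℝ → Edge K d → ℝ} {θ θ' : Edge K d → ℝ}

theorem HasDensity.add (h : HasDensity x T n θ) (h' : HasDensity x T n' θ') :
    HasDensity x T (fun S κ => n S κ + n' S κ) (fun κ => θ κ + θ' κ) := by
  obtain ⟨⟨A, hA⟩, hl⟩ := h
  obtain ⟨⟨A', hA'⟩, hl'⟩ := h'
  refine ⟨⟨A + A', ?_⟩, fun κ => ?_⟩
  · filter_upwards [hA, hA'] with S h1 h2 κ
    refine (abs_add_le _ _).trans ((add_le_add (h1 κ) (h2 κ)).trans (le_of_eq ?_))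
    ring
  · simpa only [add_div] using (hl κ).add (hl' κ)

theorem HasDensity.neg (h : HasDensity x T n θ) :
    HasDensity x T (fun S κ => -n S κ) (fun κ => -θ κ) := by
  obtain ⟨⟨A, hA⟩, hl⟩ := h
  refine ⟨⟨A, ?_⟩, fun κ => ?_⟩
  · filter_upwards [hA] with S h1 κ
    rw [abs_neg]; exact h1 κ
  · simpa only [neg_div] using (hl κ).neg

theorem HasDensity.sub (h : HasDensity x T n θ) (h' : HasDensity x T n' θ') :
    HasDensity x T (fun S κ => n S κ - n' S κ) (fun κ => θ κ - θ' κ) := by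
  simpa only [sub_eq_add_neg] using h.add h'.neg

theorem HasDensity.squeeze {m : ℝ → Edge K d → ℝ} (h : HasDensity x T n θ)
    (h' : HasDensity x T n' θ) (h1 : ∀ᶠ S in atTop, ∀ κ, n S κ ≤ m S κ)
    (h2 : ∀ᶠ S in atTop, ∀ κ, m S κ ≤ n' S κ) : HasDensity x T m θ := by
  obtain ⟨⟨A, hA⟩, hl⟩ := h
  obtain ⟨⟨A', hA'⟩, hl'⟩ := h'
  refine ⟨⟨max A A', ?_⟩, fun κ => ?_⟩
  · filter_upwards [hA, hA', h1, h2, eventually_ge_atTop 0] with S a1 a2 a3 a4 hS κ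
    have hw : 0 ≤ (1 + ‖edgeVec x T κ‖) * S ^ (d - 1) := by positivity
    have b1 := a1 κ
    have b2 := a2 κ
    have b3 := mul_le_mul_of_nonneg_right (le_max_left A A') hw
    have b4 := mul_le_mul_of_nonneg_right (le_max_right A A') hw
    rw [mul_assoc] at b1 b2
    rw [mul_assoc, abs_le]
    rw [abs_le] at b1 b2
    constructor <;> linarith [a3 κ, a4 κ, b1.1, b2.2]
  · refine tendsto_of_tendsto_of_tendsto_of_le_of_le' (hl κ) (hl' κ) ?_ ?_
    · filter_upwards [h1, eventually_ge_atTop 0] with S hS hS0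
      exact div_le_div_of_nonneg_right (hS κ) (by positivity)
    · filter_upwards [h2, eventually_ge_atTop 0] with S hS hS0
      exact div_le_div_of_nonneg_right (hS κ) (by positivity)

theorem HasDensity.comp_mul (h : HasDensity x T n θ) {r : ℝ} (hr : 0 < r) :
    HasDensity x T (fun S κ => n (r * S) κ) (fun κ => r ^ (d - 1) * θ κ) := by
  obtain ⟨⟨A, hA⟩, hl⟩ := h
  have ht : Tendsto (fun S : ℝ => r * S) atTop atTop := tendsto_id.const_mul_atTop hr
  refine ⟨⟨A * r ^ (d - 1), ?_⟩, fun κ => ?_⟩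
  · filter_upwards [ht.eventually hA] with S h1 κ
    refine (h1 κ).trans (le_of_eq ?_)
    rw [mul_pow]; ring
  · refine (((hl κ).comp ht).const_mul (r ^ (d - 1))).congr fun S => ?_
    simp only [Function.comp, mul_pow]
    have : r ^ (d - 1) ≠ 0 := (pow_pos hr _).ne'
    field_simp

theorem HasDensity.summable_mul {C α : Edge K d → ℝ} (hCs : Summable C)
    (hD : Summable fun κ => C κ * ‖edgeVec x T κ‖) (hα : ∀ κ, 0 ≤ α κ ∧ α κ ≤ C κ)
    (h : HasDensity x T n θ) : ∀ᶠ S in atTop, Summable fun κ => α κ * n S κ := by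
  obtain ⟨⟨A, hA⟩, -⟩ := h
  filter_upwards [hA] with S h1
  have hs := (Summable.mul_of_le hα ((hCs.add hD).congr fun κ => by
    rw [← mul_one_add])).mul_right (A * S ^ (d - 1))
  refine Summable.of_norm_bounded hs fun κ => ?_
  rw [norm_mul, Real.norm_eq_abs, Real.norm_eq_abs, abs_of_nonneg (hα κ).1]
  refine (mul_le_mul_of_nonneg_left (h1 κ) (hα κ).1).trans (le_of_eq ?_)
  ring

/-- Dominated convergence: after normalisation the terms are at most A C (1 + |D|), which is
summable by the first moment assumption. -/
theorem HasDensity.tendsto_tsum {C α : Edge K d → ℝ} (hCs : Summable C)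
    (hD : Summable fun κ => C κ * ‖edgeVec x T κ‖) (hα : ∀ κ, 0 ≤ α κ ∧ α κ ≤ C κ)
    (h : HasDensity x T n θ) :
    Tendsto (fun S : ℝ => (∑' κ, α κ * n S κ) / S ^ (d - 1)) atTop (𝓝 (∑' κ, α κ * θ κ)) := by
  obtain ⟨⟨A, hA⟩, hl⟩ := h
  have hs := (Summable.mul_of_le hα ((hCs.add hD).congr fun κ => by
    rw [← mul_one_add])).mul_right A
  simp only [← tsum_div_const]
  refine tendsto_tsum_of_dominated_convergence hs (fun κ => ?_) ?_
  · simpa only [mul_div_assoc] using (hl κ).const_mul (α κ)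
  · filter_upwards [hA, eventually_gt_atTop 0] with S h1 hS κ
    rw [norm_div, norm_mul, Real.norm_eq_abs, Real.norm_eq_abs, Real.norm_eq_abs,
      abs_of_nonneg (hα κ).1, abs_of_pos (pow_pos hS _), div_le_iff₀ (pow_pos hS _)]
    refine (mul_le_mul_of_nonneg_left (h1 κ) (hα κ).1).trans (le_of_eq ?_)
    ring

end EdgeDensity

/-! ### Rotated cubes. -/

section Blocks

variable {d : ℕ}
variable (R : EuclideanSpace ℝ (Fin d) ≃ₗᵢ[ℝ] EuclideanSpace ℝ (Fin d))

/-- The rotated half-open cube of side length `ρ`. -/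
def block (ρ : ℝ) : Set (EuclideanSpace ℝ (Fin d)) :=
  rbox R (fun _ => -ρ / 2) (fun _ => ρ / 2)

theorem mem_block {ρ : ℝ} {p : EuclideanSpace ℝ (Fin d)} :
    p ∈ block R ρ ↔ ∀ m, -ρ / 2 ≤ R.symm p m ∧ R.symm p m < ρ / 2 := Iff.rfl

theorem image_cube_eq_block (ρ : ℝ) : R '' cube d ρ = block R ρ := by
  ext p
  rw [mem_block]
  constructor
  · rintro ⟨q, hq, rfl⟩ m
    rw [R.symm_apply_apply]
    exact hq m
  · intro h
    exact ⟨R.symm p, h, R.apply_symm_apply p⟩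

theorem block_mono {ρ ρ' : ℝ} (h : ρ ≤ ρ') : block R ρ ⊆ block R ρ' := by
  intro p hp m
  have := hp m
  constructor <;> linarith [this.1, this.2]

theorem finite_site_mem_block {T : ℕ} (hT : 0 < T) (p : EuclideanSpace ℝ (Fin d)) (ρ : ℝ) :
    {z : Fin d → ℤ | site T p z ∈ block R ρ}.Finite := finite_site_mem_rbox R hT p _ _

theorem abs_symm_apply_sub_le (p q : EuclideanSpace ℝ (Fin d)) (m : Fin d) :
    |R.symm p m - R.symm q m| ≤ ‖p - q‖ := by
  have := abs_apply_le_norm (R.symm (p - q)) m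
  rwa [R.symm.norm_map, map_sub] at this

/-- Nearby points of a smaller block lie in the larger block. -/
theorem mem_block_of_norm_sub_le {p q : EuclideanSpace ℝ (Fin d)} {ρ ρ' : ℝ}
    (hp : p ∈ block R ρ) (h : ρ + 2 * ‖p - q‖ ≤ ρ') : q ∈ block R ρ' := by
  intro m
  have h1 := hp m
  have h2 := abs_le.1 (abs_symm_apply_sub_le R p q m)
  constructor <;> linarith [h1.1, h1.2, h2.1, h2.2]

end Blocks

/-! ### Edge counts at the interface, at the rim and across the gap. -/

section EdgeGeometry

variable {d : ℕ}
variable (R : EuclideanSpace ℝ (Fin d) ≃ₗᵢ[ℝ] EuclideanSpace ℝ (Fin d))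

variable {T : ℕ} {ν : EuclideanSpace ℝ (Fin d)}

variable {K : Type*} (x : K → EuclideanSpace ℝ (Fin d))

/-- The number of translates of `p` in a block with heights in `[a, a + q)`. -/
noncomputable def layerCount (T : ℕ) (ν p : EuclideanSpace ℝ (Fin d)) (ρ a q : ℝ) : ℝ :=
  Set.ncard {z : Fin d → ℤ | site T p z ∈ block R ρ ∧ a ≤ inner ℝ ν (site T p z) ∧
    inner ℝ ν (site T p z) < a + q}

/-- The number of edges of a given class that leave the superlevel set of the height plus `ω`
inside a block. -/
noncomputable def upCount (T : ℕ) (ν : EuclideanSpace ℝ (Fin d)) (ω : K → ℝ) (ρ : ℝ)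
    (κ : Edge K d) : ℝ :=
  Set.ncard {z : Fin d → ℤ | site T (x κ.1) z ∈ block R ρ ∧
    0 ≤ inner ℝ ν (site T (x κ.1) z) + ω κ.1 ∧
    inner ℝ ν (site T (x κ.2.1) (z + κ.2.2)) + ω κ.2.1 < 0}

/-- The number of edges of a given class that enter the superlevel set of the height plus `ω`
inside a block. -/
noncomputable def downCount (T : ℕ) (ν : EuclideanSpace ℝ (Fin d)) (ω : K → ℝ) (ρ : ℝ)
    (κ : Edge K d) : ℝ :=
  Set.ncard {z : Fin d → ℤ | site T (x κ.1) z ∈ block R ρ ∧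
    inner ℝ ν (site T (x κ.1) z) + ω κ.1 < 0 ∧
    0 ≤ inner ℝ ν (site T (x κ.2.1) (z + κ.2.2)) + ω κ.2.1}

/-- The two endpoints differ by the constant `jump`, so an edge leaves the superlevel set exactly
when its source lies in a layer of thickness equal to the positive part of the jump. -/
theorem upCount_eq_layerCount (ω : K → ℝ) (ρ : ℝ) (κ : Edge K d) :
    upCount R x T ν ω ρ κ =
      layerCount R T ν (x κ.1) ρ (-ω κ.1) (max (jump x T ν ω κ) 0) := by
  unfold upCount layerCount
  congr 2
  ext z
  simp only [Set.mem_ofPred_eq]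
  have hj := jump_apply x T ν ω κ z
  refine and_congr_right fun _ => ?_
  rcases le_total 0 (jump x T ν ω κ) with h | h
  · rw [max_eq_left h]
    constructor <;> rintro ⟨h1, h2⟩ <;> constructor <;> linarith
  · rw [max_eq_right h]
    constructor <;> rintro ⟨h1, h2⟩ <;> constructor <;> linarith

theorem downCount_eq_layerCount (ω : K → ℝ) (ρ : ℝ) (κ : Edge K d) :
    downCount R x T ν ω ρ κ = layerCount R T ν (x κ.1) ρ
      (-ω κ.1 - max (-jump x T ν ω κ) 0) (max (-jump x T ν ω κ) 0) := by
  unfold downCount layerCount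
  congr 2
  ext z
  simp only [Set.mem_ofPred_eq]
  have hj := jump_apply x T ν ω κ z
  refine and_congr_right fun _ => ?_
  rcases le_total 0 (-jump x T ν ω κ) with h | h
  · rw [max_eq_left h]
    constructor <;> rintro ⟨h1, h2⟩ <;> constructor <;> linarith
  · rw [max_eq_right h]
    constructor <;> rintro ⟨h1, h2⟩ <;> constructor <;> linarith

theorem abs_jump_le [Fintype K] (hν : ‖ν‖ = 1) (ω : K → ℝ) (κ : Edge K d) :
    |jump x T ν ω κ| ≤ ‖edgeVec x T κ‖ + 2 * ‖ω‖ := by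
  have h1 := abs_slope_le (edgeVec x T) ν κ
  have h2 := abs_grad_le (edgeSrc (K := K) (d := d)) edgeTgt ω κ
  rw [hν, one_mul] at h1
  exact (abs_add_le _ _).trans (add_le_add h1 h2)

/-- The number of edges that cross the boundary of a block near the hyperplane orthogonal
to `ν`. -/
noncomputable def rimCount (T : ℕ) (ν : EuclideanSpace ℝ (Fin d)) (M ρ : ℝ) (κ : Edge K d) : ℝ :=
  Set.ncard {z : Fin d → ℤ | Xor (site T (x κ.1) z ∈ block R ρ)
      (site T (x κ.2.1) (z + κ.2.2) ∈ block R ρ) ∧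
    |inner ℝ ν (site T (x κ.1) z)| ≤ M + ‖edgeVec x T κ‖}

/-- The number of edges from outside of a block to the concentric block smaller by a
factor `r`. -/
noncomputable def farCount (T : ℕ) (r S : ℝ) (κ : Edge K d) : ℝ :=
  Set.ncard {z : Fin d → ℤ | site T (x κ.1) z ∉ block R S ∧
    site T (x κ.2.1) (z + κ.2.2) ∈ block R (r * S)}

theorem norm_site_sub_site (κ : Edge K d) (z : Fin d → ℤ) :
    ‖site T (x κ.1) z - site T (x κ.2.1) (z + κ.2.2)‖ = ‖edgeVec x T κ‖ := by
  rw [← edgeVec_eq]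

theorem abs_inner_sub_le (hν : ‖ν‖ = 1) (κ : Edge K d) (z : Fin d → ℤ) :
    |inner ℝ ν (site T (x κ.1) z) - inner ℝ ν (site T (x κ.2.1) (z + κ.2.2))| ≤
      ‖edgeVec x T κ‖ := by
  rw [← inner_sub_right, ← edgeVec_eq]
  have := abs_real_inner_le_norm ν (edgeVec x T κ)
  rwa [hν, one_mul] at this

theorem finite_target_mem_block (hT : 0 < T) (κ : Edge K d) (ρ : ℝ) :
    {z : Fin d → ℤ | site T (x κ.2.1) (z + κ.2.2) ∈ block R ρ}.Finite := by
  have := (finite_site_mem_block R hT (x κ.2.1) ρ).preimage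
    (f := fun z => z + κ.2.2) (add_left_injective κ.2.2).injOn
  exact this

theorem ncard_target_eq (κ : Edge K d) (P : (Fin d → ℤ) → Prop) :
    Set.ncard {z : Fin d → ℤ | P (z + κ.2.2)} = Set.ncard {z : Fin d → ℤ | P z} := by
  rw [← Set.ncard_image_of_injective {z | P (z + κ.2.2)} (add_left_injective κ.2.2)]
  congr 1
  ext z
  constructor
  · rintro ⟨w, hw, rfl⟩; exact hw
  · intro hz
    refine ⟨z - κ.2.2, ?_, by simp⟩
    simpa using hz

theorem exists_large_approachable (hT : 0 < T) (hν : ν ≠ 0) (Q : ℝ) :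
    ∃ q, Q ≤ q ∧ (Dense ((heightHom T ν).range : Set ℝ) ∨ q ∈ (heightHom T ν).range) := by
  rcases dense_or_exists_generator hT hν with h | ⟨a, ha, hG⟩
  · exact ⟨Q, le_rfl, Or.inl h⟩
  · obtain ⟨n, hn⟩ := exists_nat_ge (Q / a)
    exact ⟨n * a, (div_le_iff₀ ha).1 hn, Or.inr ((hG _).2 ⟨n, by simp⟩)⟩

/-- Such an edge has to be longer than the gap between the two cubes. -/
theorem farCount_eq_zero {r S : ℝ} {κ : Edge K d}
    (h : r * S + 2 * ‖edgeVec x T κ‖ ≤ S) : farCount R x T r S κ = 0 := by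
  unfold farCount
  have : {z : Fin d → ℤ | site T (x κ.1) z ∉ block R S ∧
      site T (x κ.2.1) (z + κ.2.2) ∈ block R (r * S)} = ∅ := by
    refine Set.eq_empty_of_forall_notMem fun z hz => hz.1 (mem_block_of_norm_sub_le R hz.2 ?_)
    rw [norm_sub_rev, norm_site_sub_site]
    exact h
  rw [this]; simp

end EdgeGeometry

/-! ### Densities of the edge counts. -/

section Counts

variable {d : ℕ} [NeZero d]
variable (R : EuclideanSpace ℝ (Fin d) ≃ₗᵢ[ℝ] EuclideanSpace ℝ (Fin d))

theorem inner_eq_symm_last {ν : EuclideanSpace ℝ (Fin d)} (hR : R (lastBasisVec d) = ν)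
    (p : EuclideanSpace ℝ (Fin d)) : inner ℝ ν p = R.symm p (lastIdx d) := by
  rw [symm_apply_last, hR]

theorem mem_block_iff_slab {ρ : ℝ} {p : EuclideanSpace ℝ (Fin d)} :
    p ∈ block R ρ ↔ p ∈ slab R ρ (-ρ / 2) (ρ / 2) := by
  rw [mem_slab, mem_block]
  constructor
  · exact fun h => ⟨fun m _ => h m, h _⟩
  · rintro ⟨h1, h2⟩ m
    by_cases hm : m = lastIdx d
    · subst hm; exact h2
    · exact h1 m hm

theorem exists_count_slab_bound {T : ℕ} (hT : 0 < T) :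
    ∃ A : ℝ, 0 ≤ A ∧ ∀ (p : EuclideanSpace ℝ (Fin d)) (ρ a b : ℝ), 1 ≤ ρ → a ≤ b →
      count T p (slab R ρ a b) ≤ A * (1 + (b - a)) * ρ ^ (d - 1) := by
  set c := 2 * (T * √d : ℝ) with hc
  have hc0 : 0 ≤ c := by positivity
  refine ⟨(1 + c) ^ (d - 1) * (1 + c), by positivity, fun p ρ a b hρ hab => ?_⟩
  have h1 := count_slab_le R hT p (ρ := ρ) (by linarith) hab
  rw [← hc] at h1
  have hTd : (1 : ℝ) ≤ (T : ℝ) ^ d := one_le_pow₀ (by exact_mod_cast hT)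
  have h0 : 0 ≤ count T p (slab R ρ a b) := by unfold count; positivity
  calc count T p (slab R ρ a b) ≤ count T p (slab R ρ a b) * (T : ℝ) ^ d :=
        le_mul_of_one_le_right h0 hTd
    _ ≤ _ := h1
    _ ≤ ((1 + c) * ρ) ^ (d - 1) * ((1 + c) * (1 + (b - a))) := by
        refine mul_le_mul (pow_le_pow_left₀ (by linarith) (by nlinarith) _) (by nlinarith)
          (by linarith) (by positivity)
    _ = _ := by rw [mul_pow]; ring

variable {T : ℕ} {ν : EuclideanSpace ℝ (Fin d)}

theorem layerCount_le (hT : 0 < T) (hR : R (lastBasisVec d) = ν) (p : EuclideanSpace ℝ (Fin d))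
    (ρ a q : ℝ) : layerCount R T ν p ρ a q ≤ count T p (slab R ρ a (a + q)) := by
  unfold layerCount count
  have : {z : Fin d → ℤ | site T p z ∈ block R ρ ∧ a ≤ inner ℝ ν (site T p z) ∧
      inner ℝ ν (site T p z) < a + q} ⊆ {z | site T p z ∈ slab R ρ a (a + q)} := by
    intro z hz
    obtain ⟨h1, h2, h3⟩ := hz
    rw [inner_eq_symm_last R hR] at h2 h3
    exact (mem_slab R).2 ⟨fun m _ => h1 m, h2, h3⟩
  exact_mod_cast Set.ncard_le_ncard this (finite_site_mem_slab R hT p _ _ _)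

/-- Once the block is taller than the fixed layer, its top and bottom impose nothing and the layer
is a slab. -/
theorem tendsto_layerCount (hT : 0 < T) (hR : R (lastBasisVec d) = ν)
    (p : EuclideanSpace ℝ (Fin d)) (a : ℝ) {q : ℝ} (hq : 0 ≤ q)
    (hG : Dense ((heightHom T ν).range : Set ℝ) ∨ q ∈ (heightHom T ν).range) :
    Tendsto (fun ρ : ℝ => layerCount R T ν p ρ a q / ρ ^ (d - 1)) atTop
      (𝓝 (q / (T : ℝ) ^ d)) := by
  rw [← hR] at hG
  refine (tendsto_count_slab R hT p a hq hG).congr' ?_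
  filter_upwards [eventually_ge_atTop (2 * |a|), eventually_ge_atTop (2 * |a + q|)] with ρ h1 h2
  congr 1
  unfold layerCount count
  congr 2
  ext z
  simp only [Set.mem_ofPred_eq]
  rw [mem_slab, mem_block, inner_eq_symm_last R hR]
  constructor
  · rintro ⟨h3, h4, h5⟩
    refine ⟨fun m => ?_, h4, h5⟩
    by_cases hm : m = lastIdx d
    · subst hm
      constructor <;> linarith [neg_abs_le a, le_abs_self (a + q)]
    · exact h3 m hm
  · rintro ⟨h3, h4, h5⟩
    exact ⟨fun m _ => h3 m, h4, h5⟩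

variable {K : Type*} (x : K → EuclideanSpace ℝ (Fin d))

theorem hasDensity_layerCount [Fintype K] (hT : 0 < T) (hR : R (lastBasisVec d) = ν)
    {a q : Edge K d → ℝ} {M : ℝ} (hM : 0 ≤ M) (hq : ∀ κ, 0 ≤ q κ)
    (hqM : ∀ κ, q κ ≤ ‖edgeVec x T κ‖ + M)
    (hG : Dense ((heightHom T ν).range : Set ℝ) ∨ ∀ κ, q κ ∈ (heightHom T ν).range) :
    HasDensity x T (fun ρ κ => layerCount R T ν (x κ.1) ρ (a κ) (q κ))
      (fun κ => q κ / (T : ℝ) ^ d) := by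
  obtain ⟨A, hA0, hA⟩ := exists_count_slab_bound R hT
  refine ⟨⟨A * (1 + M), ?_⟩, fun κ => tendsto_layerCount R hT hR _ _ (hq κ)
    (hG.imp id fun h => h κ)⟩
  filter_upwards [eventually_ge_atTop 1] with ρ hρ κ
  have h0 : 0 ≤ layerCount R T ν (x κ.1) ρ (a κ) (q κ) := by unfold layerCount; positivity
  rw [abs_of_nonneg h0]
  refine (layerCount_le R hT hR _ _ _ _).trans ((hA _ ρ _ _ hρ (by linarith [hq κ])).trans ?_)
  refine mul_le_mul_of_nonneg_right ?_ (by positivity)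
  rw [mul_assoc]
  refine mul_le_mul_of_nonneg_left ?_ hA0
  nlinarith [hqM κ, norm_nonneg (edgeVec x T κ)]

theorem hasDensity_upCount [Fintype K] (hT : 0 < T) (hR : R (lastBasisVec d) = ν)
    (hν : ‖ν‖ = 1) {ω : K → ℝ} (hω : Admissible x T ν ω) :
    HasDensity x T (upCount R x T ν ω) (fun κ => max (jump x T ν ω κ) 0 / (T : ℝ) ^ d) := by
  have := hasDensity_layerCount R x hT hR (a := fun κ => -ω κ.1)
    (q := fun κ => max (jump x T ν ω κ) 0) (M := 2 * ‖ω‖) (by positivity)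
    (fun κ => le_max_right _ _)
    (fun κ => max_le ((le_abs_self _).trans (abs_jump_le x hν ω κ)) (by positivity))
    (hω.imp id fun h κ => by
      rcases max_choice (jump x T ν ω κ) 0 with h' | h' <;> rw [h']
      · exact h κ
      · exact zero_mem _)
  simpa only [← upCount_eq_layerCount] using this

theorem hasDensity_downCount [Fintype K] (hT : 0 < T) (hR : R (lastBasisVec d) = ν)
    (hν : ‖ν‖ = 1) {ω : K → ℝ} (hω : Admissible x T ν ω) :
    HasDensity x T (downCount R x T ν ω) (fun κ => max (-jump x T ν ω κ) 0 / (T : ℝ) ^ d) := by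
  have := hasDensity_layerCount R x hT hR (a := fun κ => -ω κ.1 - max (-jump x T ν ω κ) 0)
    (q := fun κ => max (-jump x T ν ω κ) 0) (M := 2 * ‖ω‖) (by positivity)
    (fun κ => le_max_right _ _)
    (fun κ => max_le ((neg_le_abs _).trans (abs_jump_le x hν ω κ)) (by positivity))
    (hω.imp id fun h κ => by
      rcases max_choice (-jump x T ν ω κ) 0 with h' | h' <;> rw [h']
      · exact neg_mem (h κ)
      · exact zero_mem _)
  simpa only [← downCount_eq_layerCount] using this

theorem tendsto_count_slab_shift (hT : 0 < T) (hR : R (lastBasisVec d) = ν)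
    (p : EuclideanSpace ℝ (Fin d)) (a c : ℝ) {q : ℝ} (hq : 0 ≤ q)
    (hG : Dense ((heightHom T ν).range : Set ℝ) ∨ q ∈ (heightHom T ν).range) :
    Tendsto (fun ρ : ℝ => count T p (slab R (ρ + c) a (a + q)) / ρ ^ (d - 1)) atTop
      (𝓝 (q / (T : ℝ) ^ d)) := by
  rw [← hR] at hG
  have ht : Tendsto (fun ρ : ℝ => ρ + c) atTop atTop := tendsto_atTop_add_const_right _ c tendsto_id
  have := ((tendsto_count_slab R hT p a hq hG).comp ht).mul (tendsto_shift_pow_div c (d - 1))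
  rw [mul_one] at this
  refine this.congr' ?_
  filter_upwards [eventually_gt_atTop 0, eventually_gt_atTop (-c)] with ρ h1 h2
  simp only [Function.comp]
  have e1 : (ρ + c) ^ (d - 1) ≠ 0 := (pow_pos (by linarith) _).ne'
  field_simp

/-- For large `ρ`, the sources of rim edges lie in a slab of width ρ + 2r but outside the one of
width ρ - 2r, with r the edge length. Both slabs have the same leading count, so the difference is
negligible. -/
theorem tendsto_rimCount (hT : 0 < T) (hR : R (lastBasisVec d) = ν) (hν : ‖ν‖ = 1)
    {M : ℝ} (κ : Edge K d) :
    Tendsto (fun ρ : ℝ => rimCount R x T ν M ρ κ / ρ ^ (d - 1)) atTop (𝓝 0) := by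
  set r := ‖edgeVec x T κ‖ with hr
  have hr0 : 0 ≤ r := norm_nonneg _
  -- The additional 1 lets the half-open slab contain the closed range of heights |h| ≤ M + r.
  obtain ⟨q, hqQ, hG⟩ := exists_large_approachable hT
    (show ν ≠ 0 by rintro rfl; simp at hν) (max (2 * (M + r) + 1) 0)
  have hq1 := (le_max_left _ _).trans hqQ
  have hq0 := (le_max_right _ _).trans hqQ
  have h1 := tendsto_count_slab_shift R hT hR (x κ.1) (-(M + r)) (2 * r) hq0 hG
  have h2 := tendsto_count_slab_shift R hT hR (x κ.1) (-(M + r)) (-(2 * r)) hq0 hG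
  have h3 := h1.sub h2
  rw [sub_self] at h3
  refine squeeze_zero' ?_ ?_ h3
  · filter_upwards [eventually_ge_atTop 0] with ρ hρ
    unfold rimCount
    positivity
  · filter_upwards [eventually_ge_atTop 0, eventually_gt_atTop (2 * (M + 2 * r)),
      eventually_ge_atTop (2 * r)] with ρ hρ hρ2 hρ3
    rw [← sub_div]
    refine div_le_div_of_nonneg_right ?_ (by positivity)
    have hfin := finite_site_mem_slab R hT (x κ.1) (ρ + 2 * r) (-(M + r)) (-(M + r) + q)
    have hsub : {z : Fin d → ℤ | site T (x κ.1) z ∈ slab R (ρ + -(2 * r)) (-(M + r)) (-(M + r) + q)}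
        ⊆ {z | site T (x κ.1) z ∈ slab R (ρ + 2 * r) (-(M + r)) (-(M + r) + q)} := fun z hz =>
      slab_mono R (by linarith) le_rfl le_rfl hz
    unfold rimCount count
    rw [← Set.ncard_sdiff_add_ncard_of_subset hsub hfin, Nat.cast_add, add_sub_cancel_right]
    refine Nat.cast_le.2 (Set.ncard_le_ncard ?_ (hfin.subset Set.sdiff_subset))
    rintro z ⟨hx, hz⟩
    have hz' := abs_le.1 hz
    have hdist := norm_site_sub_site x (T := T) κ z
    have hdist' : ‖site T (x κ.2.1) (z + κ.2.2) - site T (x κ.1) z‖ = r := by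
      rw [norm_sub_rev, hdist]
    have hin := inner_eq_symm_last R hR (site T (x κ.1) z)
    constructor
    · have hb : site T (x κ.1) z ∈ block R (ρ + 2 * r) := by
        rcases hx with ⟨h, _⟩ | ⟨h, _⟩
        · exact block_mono R (by linarith) h
        · exact mem_block_of_norm_sub_le R h (by rw [hdist'])
      exact (mem_slab R).2 ⟨fun m _ => hb m, by linarith [hz'.1], by linarith [hz'.2]⟩
    · intro hs
      have hs' := ((mem_slab R).1 hs).1
      have hi : site T (x κ.1) z ∈ block R ρ := by
        intro m
        by_cases hm : m = lastIdx d
        · subst hm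
          rw [← hin]
          constructor <;> linarith [hz'.1, hz'.2]
        · have := hs' m hm
          constructor <;> linarith [this.1, this.2]
      have hj : site T (x κ.2.1) (z + κ.2.2) ∈ block R ρ := by
        intro m
        have h4 := abs_le.1 (abs_symm_apply_sub_le R (site T (x κ.1) z)
          (site T (x κ.2.1) (z + κ.2.2)) m)
        rw [hdist] at h4
        by_cases hm : m = lastIdx d
        · subst hm
          rw [← hin] at h4
          constructor <;> linarith [hz'.1, hz'.2, h4.1, h4.2]
        · have := hs' m hm
          constructor <;> linarith [this.1, this.2, h4.1, h4.2]
      rcases hx with ⟨_, h⟩ | ⟨_, h⟩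
      · exact h hj
      · exact h hi

theorem hasDensity_rimCount (hT : 0 < T) (hR : R (lastBasisVec d) = ν) (hν : ‖ν‖ = 1)
    {M : ℝ} (hM : 0 ≤ M) : HasDensity x T (rimCount R x T ν M) (fun _ => 0) := by
  obtain ⟨A, hA0, hA⟩ := exists_count_slab_bound R hT
  -- One slab for each endpoint that may lie in the block. Its thickness is 2M + 4r + 1, and 2 + 2M
  -- + 4r ≤ (2 + 2M + 4)(1 + r).
  refine ⟨⟨2 * (A * (2 + 2 * M + 4)), ?_⟩, tendsto_rimCount R x hT hR hν⟩
  filter_upwards [eventually_ge_atTop 1] with ρ hρ κ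
  set r := ‖edgeVec x T κ‖ with hr
  have hr0 : 0 ≤ r := norm_nonneg _
  have h0 : 0 ≤ rimCount R x T ν M ρ κ := by unfold rimCount; positivity
  rw [abs_of_nonneg h0]
  have hfin1 := finite_site_mem_slab R hT (x κ.1) ρ (-(M + 2 * r)) (M + 2 * r + 1)
  have hfin2 := finite_site_mem_slab R hT (x κ.2.1) ρ (-(M + 2 * r)) (M + 2 * r + 1)
  have hfin2' : {z : Fin d → ℤ | site T (x κ.2.1) (z + κ.2.2) ∈
      slab R ρ (-(M + 2 * r)) (M + 2 * r + 1)}.Finite :=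
    hfin2.preimage (f := fun z => z + κ.2.2) (add_left_injective κ.2.2).injOn
  have hle : rimCount R x T ν M ρ κ ≤
      count T (x κ.1) (slab R ρ (-(M + 2 * r)) (M + 2 * r + 1)) +
      count T (x κ.2.1) (slab R ρ (-(M + 2 * r)) (M + 2 * r + 1)) := by
    unfold rimCount count
    rw [← ncard_target_eq κ fun z => site T (x κ.2.1) z ∈
      slab R ρ (-(M + 2 * r)) (M + 2 * r + 1), ← Nat.cast_add]
    refine Nat.cast_le.2 (le_trans (Set.ncard_le_ncard ?_ (hfin1.union hfin2'))
      (Set.ncard_union_le _ _))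
    rintro z ⟨hx, hz⟩
    have hz' := abs_le.1 hz
    have hdh := abs_le.1 (abs_inner_sub_le x hν (T := T) κ z)
    rcases hx with ⟨h, _⟩ | ⟨h, _⟩
    · refine Or.inl ((mem_slab R).2 ⟨fun m _ => h m, ?_⟩)
      rw [← inner_eq_symm_last R hR]
      constructor <;> linarith [hz'.1, hz'.2]
    · refine Or.inr ((mem_slab R).2 ⟨fun m _ => h m, ?_⟩)
      rw [← inner_eq_symm_last R hR]
      constructor <;> linarith [hz'.1, hz'.2, hdh.1, hdh.2]
  refine hle.trans ((add_le_add (hA _ ρ _ _ hρ (by linarith)) (hA _ ρ _ _ hρ (by linarith))).trans ?_)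
  rw [← add_mul, ← two_mul, mul_assoc 2 (A * (2 + 2 * M + 4)) (1 + r), mul_assoc A]
  refine mul_le_mul_of_nonneg_right (mul_le_mul_of_nonneg_left
    (mul_le_mul_of_nonneg_left ?_ hA0) zero_le_two) (by positivity)
  nlinarith [mul_nonneg hM hr0]

/-- The count is bounded by a volume of order S^d, but it vanishes unless the edge is longer than (1
- r) S / 2. The excess factor S is thus traded for the edge length. -/
theorem hasDensity_farCount (hT : 0 < T) {r : ℝ} (hr0 : 0 < r) (hr1 : r < 1) :
    HasDensity x T (farCount R x T r) (fun _ => 0) := by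
  obtain ⟨A, hA0, hA⟩ := exists_count_slab_bound R hT
  refine ⟨⟨A * (2 / (1 - r)), ?_⟩, fun κ => ?_⟩
  · filter_upwards [eventually_ge_atTop 1, eventually_ge_atTop (1 / r)] with S hS hS' κ
    set b := ‖edgeVec x T κ‖ with hb
    have hb0 : 0 ≤ b := norm_nonneg _
    have h1r : 0 < 1 - r := by linarith
    have h0 : 0 ≤ farCount R x T r S κ := by unfold farCount; positivity
    rw [abs_of_nonneg h0]
    rcases le_or_gt (r * S + 2 * b) S with h | h
    · rw [farCount_eq_zero R x h]; positivity
    · have hρ : 1 ≤ r * S := by rwa [div_le_iff₀' hr0] at hS'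
      have hle : farCount R x T r S κ ≤
          count T (x κ.2.1) (slab R (r * S) (-(r * S) / 2) ((r * S) / 2)) := by
        unfold farCount count
        rw [← ncard_target_eq κ fun z => site T (x κ.2.1) z ∈
          slab R (r * S) (-(r * S) / 2) ((r * S) / 2)]
        refine Nat.cast_le.2 (Set.ncard_le_ncard ?_ ?_)
        · rintro z ⟨_, hz⟩
          exact (mem_block_iff_slab R).1 hz
        · exact (finite_site_mem_slab R hT (x κ.2.1) _ _ _).preimage
            (f := fun z => z + κ.2.2) (add_left_injective κ.2.2).injOn
      refine hle.trans ((hA _ _ _ _ hρ (by linarith)).trans ?_)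
      refine mul_le_mul ?_ (pow_le_pow_left₀ (by positivity) (by nlinarith) _) (by positivity)
        (by positivity)
      rw [mul_assoc]
      refine mul_le_mul_of_nonneg_left ?_ hA0
      rw [div_mul_eq_mul_div, le_div_iff₀ h1r]
      nlinarith
  · refine tendsto_const_nhds.congr' ?_
    have : ∀ᶠ S : ℝ in atTop, 2 * ‖edgeVec x T κ‖ / (1 - r) ≤ S := eventually_ge_atTop _
    filter_upwards [this] with S hS
    rw [div_le_iff₀ (by linarith)] at hS
    rw [farCount_eq_zero R x (by linarith), zero_div]

end Counts

/-! ### Comparison of indicators on a single edge. -/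

section PointwiseComparison

open Classical in
/-- The real number that is `1` if `P` holds and `0` otherwise. -/
noncomputable def ind (P : Prop) : ℝ := if P then 1 else 0

theorem ind_of {P : Prop} (h : P) : ind P = 1 := if_pos h

theorem ind_of_not {P : Prop} (h : ¬P) : ind P = 0 := if_neg h

theorem ind_nonneg (P : Prop) : 0 ≤ ind P := by
  unfold ind; split_ifs <;> simp

theorem ind_eq_zero_or_one (P : Prop) : ind P = 0 ∨ ind P = 1 := by
  unfold ind; split_ifs <;> simp

theorem ind_mono {P Q : Prop} (h : P → Q) : ind P ≤ ind Q := by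
  by_cases hP : P
  · rw [ind_of hP, ind_of (h hP)]
  · rw [ind_of_not hP]; exact ind_nonneg Q

theorem ind_and_sub_ind_and (P Q : Prop) : ind (P ∧ ¬Q) - ind (¬P ∧ Q) = ind P - ind Q := by
  by_cases hP : P <;> by_cases hQ : Q <;> simp [ind, hP, hQ]

/-- Here `iD` means source in the large block, `iB` and `jB` source and target in the small one,
`hi` and `hj` endpoints in the half space, and `r` proximity to the hyperplane. Inside the small
block the full weight `C` is replaced by the linear lower bound α (a - b); outside, the
configuration is the half space. Mixed edges are paid for by the rim and far terms. -/
theorem indicator_lower_bound {C α a b : ℝ} {iD iB jB hi hj r : Prop} (h0 : 0 ≤ α) (h1 : α ≤ C)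
    (ha : a = 0 ∨ a = 1) (hb : b = 0 ∨ b = 1) (hBD : iB → iD)
    (hia : ¬iB → a = ind hi) (hjb : ¬jB → b = ind hj) (hr : Xor hi hj → r) :
    C * ind (iD ∧ ¬iB ∧ ¬jB ∧ hi ∧ ¬hj) +
      α * (ind (iB ∧ hi ∧ ¬hj) - ind (iB ∧ ¬hi ∧ hj) + ((a - ind hi) - (b - ind hj))) -
      C * (ind (Xor iB jB ∧ r) + ind (¬iD ∧ jB)) ≤
    C * ind (iD ∧ a = 1 ∧ b = 0) := by
  have hC : 0 ≤ C := h0.trans h1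
  have hdrop : iD → α * (a - b) ≤ C * ind (iD ∧ a = 1 ∧ b = 0) := by
    intro hD
    rcases ha with rfl | rfl <;> rcases hb with rfl | rfl <;> simp [ind, hD] <;> linarith
  by_cases hB : iB
  · have hD := hBD hB
    have e := ind_and_sub_ind_and hi hj
    have hx := mul_nonneg hC (ind_nonneg (Xor iB jB ∧ r))
    rw [ind_of_not (P := iD ∧ ¬iB ∧ ¬jB ∧ hi ∧ ¬hj) (fun h => h.2.1 hB),
      ind_of_not (P := ¬iD ∧ jB) (fun h => h.1 hD)]
    simp only [hB, true_and] at hx ⊢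
    rw [e]
    linarith [hdrop hD]
  · rw [ind_of_not (P := iB ∧ hi ∧ ¬hj) (fun h => hB h.1),
      ind_of_not (P := iB ∧ ¬hi ∧ hj) (fun h => hB h.1), hia hB] at *
    have hn := mul_nonneg hC (ind_nonneg (iD ∧ ind hi = 1 ∧ b = 0))
    by_cases hj' : jB
    · rw [ind_of_not (P := iD ∧ ¬iB ∧ ¬jB ∧ hi ∧ ¬hj) (fun h => h.2.2.1 hj')]
      have hx : ind (Xor hi hj) ≤ ind (Xor iB jB ∧ r) :=
        ind_mono fun h => ⟨Or.inr ⟨hj', hB⟩, hr h⟩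
      by_cases hD : iD
      · rw [ind_of_not (P := ¬iD ∧ jB) (fun h => h.1 hD)]
        have h2 := hdrop hD
        have h3 : ind hj - ind hi ≤ ind (Xor hi hj) := by
          by_cases c4 : hi <;> by_cases c5 : hj <;> simp [ind, Xor, c4, c5]
        have h4 : α * (ind hj - ind hi) ≤ C * ind (Xor iB jB ∧ r) :=
          (mul_le_mul_of_nonneg_left (h3.trans hx) h0).trans
            (mul_le_mul_of_nonneg_right h1 (ind_nonneg _))
        linarith
      · rw [ind_of (P := ¬iD ∧ jB) ⟨hD, hj'⟩]
        have h2 := mul_nonneg hC (ind_nonneg (Xor iB jB ∧ r))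
        have h3 : ind hj - b ≤ 1 := by
          rcases hb with rfl | rfl <;> rcases ind_eq_zero_or_one hj with h | h <;> rw [h] <;>
            norm_num
        have h4 : α * (ind hj - b) ≤ C * 1 :=
          (mul_le_mul_of_nonneg_left h3 h0).trans (by linarith)
        linarith
    · rw [hjb hj', ind_of_not (P := ¬iD ∧ jB) (fun h => hj' h.2)]
      have h2 := mul_nonneg hC (ind_nonneg (Xor iB jB ∧ r))
      have h3 : ind (iD ∧ ¬iB ∧ ¬jB ∧ hi ∧ ¬hj) ≤ ind (iD ∧ ind hi = 1 ∧ ind hj = 0) :=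
        ind_mono fun h => ⟨h.1, ind_of h.2.2.2.1, ind_of_not h.2.2.2.2⟩
      have h4 := mul_le_mul_of_nonneg_left h3 hC
      linarith

theorem ind_eq_one_iff {P : Prop} : ind P = 1 ↔ P := by
  by_cases h : P <;> simp [ind, h]

theorem ind_eq_zero_iff {P : Prop} : ind P = 0 ↔ ¬P := by
  by_cases h : P <;> simp [ind, h]

/-- A drop occurs wholly outside the small block, where the half space applies, or wholly inside,
where `gi` and `gj` apply, or else across its boundary, which the rim term covers. -/
theorem indicator_upper_bound {a b : ℝ} {iD iB jB hi hj gi gj r : Prop}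
    (ha : iB → a = ind gi) (ha' : ¬iB → a = ind hi) (hb : jB → b = ind gj)
    (hb' : ¬jB → b = ind hj) (h1 : gi → ¬hj → r) (h2 : hi → ¬gj → r) :
    ind (iD ∧ a = 1 ∧ b = 0) ≤
      ind (iD ∧ ¬iB ∧ ¬jB ∧ hi ∧ ¬hj) + ind (iB ∧ gi ∧ ¬gj) + ind (Xor iB jB ∧ r) := by
  have p1 := ind_nonneg (iD ∧ ¬iB ∧ ¬jB ∧ hi ∧ ¬hj)
  have p2 := ind_nonneg (iB ∧ gi ∧ ¬gj)
  have p3 := ind_nonneg (Xor iB jB ∧ r)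
  by_cases hP : iD ∧ a = 1 ∧ b = 0
  · rw [ind_of hP]
    obtain ⟨hD, ha1, hb0⟩ := hP
    by_cases hB : iB <;> by_cases hJ : jB
    · rw [ha hB, ind_eq_one_iff] at ha1
      rw [hb hJ, ind_eq_zero_iff] at hb0
      rw [ind_of (P := iB ∧ gi ∧ ¬gj) ⟨hB, ha1, hb0⟩]
      linarith
    · rw [ha hB, ind_eq_one_iff] at ha1
      rw [hb' hJ, ind_eq_zero_iff] at hb0
      rw [ind_of (P := Xor iB jB ∧ r) ⟨Or.inl ⟨hB, hJ⟩, h1 ha1 hb0⟩]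
      linarith
    · rw [ha' hB, ind_eq_one_iff] at ha1
      rw [hb hJ, ind_eq_zero_iff] at hb0
      rw [ind_of (P := Xor iB jB ∧ r) ⟨Or.inr ⟨hJ, hB⟩, h2 ha1 hb0⟩]
      linarith
    · rw [ha' hB, ind_eq_one_iff] at ha1
      rw [hb' hJ, ind_eq_zero_iff] at hb0
      rw [ind_of (P := iD ∧ ¬iB ∧ ¬jB ∧ hi ∧ ¬hj) ⟨hD, hB, hJ, ha1, hb0⟩]
      linarith
  · rw [ind_of_not hP]
    linarith

/-- Subtracting the edges that start in the small block still leaves those that enter it from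
outside; these are rim edges. -/
theorem indicator_annulus {iD iB jB hi hj r : Prop} (hBD : iB → iD) (hr : Xor hi hj → r) :
    ind (iD ∧ hi ∧ ¬hj) - ind (iB ∧ hi ∧ ¬hj) - ind (Xor iB jB ∧ r) ≤
        ind (iD ∧ ¬iB ∧ ¬jB ∧ hi ∧ ¬hj) ∧
      ind (iD ∧ ¬iB ∧ ¬jB ∧ hi ∧ ¬hj) ≤ ind (iD ∧ hi ∧ ¬hj) - ind (iB ∧ hi ∧ ¬hj) := by
  by_cases c4 : hi <;> by_cases c5 : hj
  · simp [ind, c4, c5]; split_ifs <;> norm_num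
  · have hr' : r := hr (Or.inl ⟨c4, c5⟩)
    by_cases c1 : iD <;> by_cases c2 : iB <;> by_cases c3 : jB <;>
      simp_all [ind, Xor]
  · simp [ind, c4]; split_ifs <;> norm_num
  · simp [ind, c4]; split_ifs <;> norm_num

theorem ncard_eq_sum_ind {β : Type*} {P : β → Prop} (Z : Finset β) (h : ∀ z, P z → z ∈ Z) :
    (Set.ncard {z | P z} : ℝ) = ∑ z ∈ Z, ind (P z) := by
  classical
  unfold ind
  rw [Finset.sum_boole, ← Set.ncard_coe_finset]
  congr 2
  ext z
  simpa using h z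

end PointwiseComparison

/-! ### Competitors, gluing, and bounds on their edge counts. -/

section Configurations

variable {d : ℕ} {K : Type*}
variable (R : EuclideanSpace ℝ (Fin d) ≃ₗᵢ[ℝ] EuclideanSpace ℝ (Fin d))
variable (x : K → EuclideanSpace ℝ (Fin d)) (T : ℕ) (ν : EuclideanSpace ℝ (Fin d))

/-- The number of edges of a given class starting in a block from a point with value `1` to a
point with value `0`. -/
noncomputable def dropCount (u : K → (Fin d → ℤ) → ℝ) (S : ℝ) (κ : Edge K d) : ℝ :=
  Set.ncard {z : Fin d → ℤ | site T (x κ.1) z ∈ block R S ∧ u κ.1 z = 1 ∧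
    u κ.2.1 (z + κ.2.2) = 0}

/-- The number of edges through the hyperplane orthogonal to `ν` that start in a block and have no
endpoint in the concentric block smaller by a factor `r`. -/
noncomputable def annulusCount (r S : ℝ) (κ : Edge K d) : ℝ :=
  Set.ncard {z : Fin d → ℤ | site T (x κ.1) z ∈ block R S ∧
    site T (x κ.1) z ∉ block R (r * S) ∧ site T (x κ.2.1) (z + κ.2.2) ∉ block R (r * S) ∧
    0 ≤ inner ℝ ν (site T (x κ.1) z) ∧ ¬0 ≤ inner ℝ ν (site T (x κ.2.1) (z + κ.2.2))}

/-- The `{0, 1}`-valued configurations that agree with the half space outside of a block. -/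
def competitors (ρ : ℝ) : Set (K → (Fin d → ℤ) → ℝ) :=
  {u | (∀ k z, u k z = 0 ∨ u k z = 1) ∧
    ∀ k z, site T (x k) z ∉ block R ρ → u k z = halfSpace ν (site T (x k) z)}

variable {x T ν}

theorem halfSpace_eq (p : EuclideanSpace ℝ (Fin d)) :
    halfSpace ν p = ind (0 ≤ inner ℝ ν p) := rfl

theorem upCount_congr {ω : K → ℝ} (h : ∀ k z, (0 ≤ inner ℝ ν (site T (x k) z) ↔
    0 ≤ inner ℝ ν (site T (x k) z) + ω k)) (ρ : ℝ) (κ : Edge K d) :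
    upCount R x T ν ω ρ κ = Set.ncard {z : Fin d → ℤ | site T (x κ.1) z ∈ block R ρ ∧
      0 ≤ inner ℝ ν (site T (x κ.1) z) ∧
      ¬0 ≤ inner ℝ ν (site T (x κ.2.1) (z + κ.2.2))} := by
  unfold upCount
  simp only [← h, ← not_le]

theorem downCount_congr {ω : K → ℝ} (h : ∀ k z, (0 ≤ inner ℝ ν (site T (x k) z) ↔
    0 ≤ inner ℝ ν (site T (x k) z) + ω k)) (ρ : ℝ) (κ : Edge K d) :
    downCount R x T ν ω ρ κ = Set.ncard {z : Fin d → ℤ | site T (x κ.1) z ∈ block R ρ ∧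
      ¬0 ≤ inner ℝ ν (site T (x κ.1) z) ∧
      0 ≤ inner ℝ ν (site T (x κ.2.1) (z + κ.2.2))} := by
  unfold downCount
  simp only [← h, ← not_le]

theorem abs_inner_le_of_xor (hν : ‖ν‖ = 1) {M : ℝ} (hM : 0 ≤ M) (κ : Edge K d) (z : Fin d → ℤ)
    (h : Xor (0 ≤ inner ℝ ν (site T (x κ.1) z))
      (0 ≤ inner ℝ ν (site T (x κ.2.1) (z + κ.2.2)))) :
    |inner ℝ ν (site T (x κ.1) z)| ≤ M + ‖edgeVec x T κ‖ := by
  have h1 := abs_le.1 (abs_inner_sub_le x hν (T := T) κ z)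
  rw [abs_le]
  rcases h with ⟨h2, h3⟩ | ⟨h2, h3⟩ <;> rw [not_le] at h3 <;> constructor <;>
    linarith [h1.1, h1.2]

theorem exists_finset_edges (hT : 0 < T) (κ : Edge K d) (S : ℝ) :
    ∃ Z : Finset (Fin d → ℤ), ∀ z, (site T (x κ.1) z ∈ block R S ∨
      site T (x κ.2.1) (z + κ.2.2) ∈ block R S) → z ∈ Z := by
  have h1 := finite_site_mem_block R hT (x κ.1) S
  have h2 := finite_target_mem_block R x hT κ S
  refine ⟨(h1.union h2).toFinset, fun z hz => ?_⟩
  rw [Set.Finite.mem_toFinset]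
  exact hz

/-- The potential `V` sums, over each vertex class, the finitely supported deviation from the half
space. Summing the edge inequality over translations turns these deviations into `grad V`, with the
same `V` for every edge class, so a calibration removes it. -/
theorem dropCount_lower_bound (hT : 0 < T) (hν : ‖ν‖ = 1) {M : ℝ} (hM : 0 ≤ M) {ω : K → ℝ}
    (hω : ∀ k z, (0 ≤ inner ℝ ν (site T (x k) z) ↔ 0 ≤ inner ℝ ν (site T (x k) z) + ω k))
    {r S : ℝ} (hrS : r * S ≤ S) {u : K → (Fin d → ℤ) → ℝ}
    (hu : u ∈ competitors R x T ν (r * S)) :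
    ∃ V : K → ℝ, ∀ (κ : Edge K d) (C α : ℝ), 0 ≤ α → α ≤ C →
      C * annulusCount R x T ν r S κ + α * (upCount R x T ν ω (r * S) κ -
        downCount R x T ν ω (r * S) κ + grad edgeSrc edgeTgt V κ) -
        C * (rimCount R x T ν M (r * S) κ + farCount R x T r S κ) ≤
      C * dropCount R x T u S κ := by
  classical
  have hBD : block R (r * S) ⊆ block R S := block_mono R hrS
  let v : K → (Fin d → ℤ) → ℝ := fun k z => u k z - halfSpace ν (site T (x k) z)
  have hv : ∀ k z, site T (x k) z ∉ block R S → v k z = 0 := fun k z h =>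
    sub_eq_zero.2 (hu.2 k z fun h' => h (hBD h'))
  refine ⟨fun k => ∑ᶠ z, v k z, fun κ C α h0 h1 => ?_⟩
  obtain ⟨Z, hZ⟩ := exists_finset_edges R (x := x) hT κ S
  have hV1 : ∑ᶠ z, v κ.1 z = ∑ z ∈ Z, v κ.1 z :=
    finsum_eq_sum_of_support_subset _ fun z hz => hZ z <| Or.inl <| by
      by_contra h; exact hz (hv _ _ h)
  -- Shifting the summation index by the translation of the edge expresses the target total over the
  -- same index set as the source total.
  have hV2 : ∑ᶠ z, v κ.2.1 z = ∑ z ∈ Z, v κ.2.1 (z + κ.2.2) := by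
    rw [← finsum_comp_equiv (Equiv.addRight κ.2.2)]
    exact finsum_eq_sum_of_support_subset _ fun z hz => hZ z <| Or.inr <| by
      by_contra h; exact hz (hv _ _ h)
  rw [upCount_congr R hω, downCount_congr R hω]
  simp only [grad, edgeSrc, edgeTgt]
  rw [hV1, hV2]
  unfold annulusCount rimCount farCount dropCount
  rw [ncard_eq_sum_ind Z fun z hz => hZ z (Or.inl hz.1),
    ncard_eq_sum_ind Z fun z hz => hZ z (Or.inl (hBD hz.1)),
    ncard_eq_sum_ind Z fun z hz => hZ z (Or.inl (hBD hz.1)),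
    ncard_eq_sum_ind Z fun z hz => hZ z (by
      rcases hz.1 with ⟨h, _⟩ | ⟨h, _⟩
      · exact Or.inl (hBD h)
      · exact Or.inr (hBD h)),
    ncard_eq_sum_ind Z fun z hz => hZ z (Or.inr (hBD hz.2)),
    ncard_eq_sum_ind Z fun z hz => hZ z (Or.inl hz.1),
    ← Finset.sum_sub_distrib, ← Finset.sum_sub_distrib, ← Finset.sum_add_distrib,
    ← Finset.sum_add_distrib, Finset.mul_sum, Finset.mul_sum, Finset.mul_sum, Finset.mul_sum,
    ← Finset.sum_add_distrib, ← Finset.sum_sub_distrib]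
  refine Finset.sum_le_sum fun z _ => ?_
  have hi : ∀ k z, site T (x k) z ∉ block R (r * S) →
      u k z = ind (0 ≤ inner ℝ ν (site T (x k) z)) := fun k z h => by
    rw [hu.2 k z h, halfSpace_eq]
  have := indicator_lower_bound h0 h1 (hu.1 κ.1 z) (hu.1 κ.2.1 (z + κ.2.2))
    (fun h : site T (x κ.1) z ∈ block R (r * S) => hBD h) (hi κ.1 z) (hi κ.2.1 (z + κ.2.2))
    (abs_inner_le_of_xor (x := x) (T := T) hν hM κ z)
  simpa only [v, halfSpace_eq] using this

open Classical in
/-- The configuration given by the superlevel set of the height plus `ω` inside a block, and by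
the half space outside. -/
noncomputable def glued (x : K → EuclideanSpace ℝ (Fin d)) (T : ℕ)
    (ν : EuclideanSpace ℝ (Fin d)) (ω : K → ℝ) (ρ : ℝ) : K → (Fin d → ℤ) → ℝ := fun k z =>
  if site T (x k) z ∈ block R ρ then ind (0 ≤ inner ℝ ν (site T (x k) z) + ω k)
  else ind (0 ≤ inner ℝ ν (site T (x k) z))

theorem glued_mem_competitors (ω : K → ℝ) (ρ : ℝ) :
    glued R x T ν ω ρ ∈ competitors R x T ν ρ := by
  classical
  constructor
  · intro k z
    unfold glued
    split_ifs <;> exact ind_eq_zero_or_one _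
  · intro k z h
    rw [halfSpace_eq, glued, if_neg h]

/-- Replacing the half space by the shifted superlevel set changes only edges crossing the block
boundary within height ‖ω‖ plus the edge length, all of which are rim edges. -/
theorem dropCount_glued_le [Fintype K] (hT : 0 < T) (hν : ‖ν‖ = 1) (ω : K → ℝ) {r S : ℝ}
    (hrS : r * S ≤ S) (κ : Edge K d) :
    dropCount R x T (glued R x T ν ω (r * S)) S κ ≤ annulusCount R x T ν r S κ +
      upCount R x T ν ω (r * S) κ + rimCount R x T ν ‖ω‖ (r * S) κ := by
  classical
  have hBD : block R (r * S) ⊆ block R S := block_mono R hrS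
  obtain ⟨Z, hZ⟩ := exists_finset_edges R (x := x) hT κ S
  unfold annulusCount rimCount dropCount upCount
  simp only [← not_le]
  rw [ncard_eq_sum_ind Z fun z hz => hZ z (Or.inl hz.1),
    ncard_eq_sum_ind Z fun z hz => hZ z (Or.inl hz.1),
    ncard_eq_sum_ind Z fun z hz => hZ z (Or.inl (hBD hz.1)),
    ncard_eq_sum_ind Z fun z hz => hZ z (by
      rcases hz.1 with ⟨h, _⟩ | ⟨h, _⟩
      · exact Or.inl (hBD h)
      · exact Or.inr (hBD h)),
    ← Finset.sum_add_distrib, ← Finset.sum_add_distrib]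
  refine Finset.sum_le_sum fun z _ => ?_
  have h1 := abs_le.1 (abs_inner_sub_le x hν (T := T) κ z)
  have h2 := abs_le.1 ((Real.norm_eq_abs _).ge.trans (norm_le_pi_norm ω κ.1))
  have h3 := abs_le.1 ((Real.norm_eq_abs _).ge.trans (norm_le_pi_norm ω κ.2.1))
  refine indicator_upper_bound (fun h => if_pos h) (fun h => if_neg h) (fun h => if_pos h)
    (fun h => if_neg h) (fun ha hb => ?_) (fun ha hb => ?_)
  · rw [not_le] at hb
    rw [abs_le]
    constructor <;> linarith [h1.1, h1.2, h2.1, h2.2, norm_nonneg (edgeVec x T κ)]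
  · rw [not_le] at hb
    rw [abs_le]
    constructor <;>
      linarith [h1.1, h1.2, h3.1, h3.2, norm_nonneg (edgeVec x T κ), norm_nonneg ω]

theorem annulusCount_bounds (hT : 0 < T) (hν : ‖ν‖ = 1) {ω : K → ℝ}
    (hω : ∀ k z, (0 ≤ inner ℝ ν (site T (x k) z) ↔ 0 ≤ inner ℝ ν (site T (x k) z) + ω k))
    {r S : ℝ} (hrS : r * S ≤ S) (κ : Edge K d) :
    upCount R x T ν ω S κ - upCount R x T ν ω (r * S) κ - rimCount R x T ν 0 (r * S) κ ≤
        annulusCount R x T ν r S κ ∧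
      annulusCount R x T ν r S κ ≤ upCount R x T ν ω S κ - upCount R x T ν ω (r * S) κ := by
  classical
  have hBD : block R (r * S) ⊆ block R S := block_mono R hrS
  obtain ⟨Z, hZ⟩ := exists_finset_edges R (x := x) hT κ S
  rw [upCount_congr R hω, upCount_congr R hω]
  unfold annulusCount rimCount
  rw [ncard_eq_sum_ind Z fun z hz => hZ z (Or.inl hz.1),
    ncard_eq_sum_ind Z fun z hz => hZ z (Or.inl (hBD hz.1)),
    ncard_eq_sum_ind Z fun z hz => hZ z (by
      rcases hz.1 with ⟨h, _⟩ | ⟨h, _⟩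
      · exact Or.inl (hBD h)
      · exact Or.inr (hBD h)),
    ncard_eq_sum_ind Z fun z hz => hZ z (Or.inl hz.1),
    ← Finset.sum_sub_distrib, ← Finset.sum_sub_distrib]
  have key := fun z => indicator_annulus
    (fun h : site T (x κ.1) z ∈ block R (r * S) => hBD h)
    (jB := site T (x κ.2.1) (z + κ.2.2) ∈ block R (r * S))
    (abs_inner_le_of_xor (x := x) (T := T) hν le_rfl κ z)
  exact ⟨Finset.sum_le_sum fun z _ => (key z).1, Finset.sum_le_sum fun z _ => (key z).2⟩

theorem dropCount_le_sum [Fintype K] (hT : 0 < T) (u : K → (Fin d → ℤ) → ℝ) (S : ℝ)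
    (κ : Edge K d) : dropCount R x T u S κ ≤ ∑ k, count T (x k) (block R S) := by
  have h1 : dropCount R x T u S κ ≤ count T (x κ.1) (block R S) := by
    unfold dropCount count
    exact Nat.cast_le.2 (Set.ncard_le_ncard (fun z hz => hz.1) (finite_site_mem_block R hT _ _))
  exact h1.trans (Finset.single_le_sum (f := fun k => count T (x k) (block R S))
    (fun k _ => by unfold count; positivity) (Finset.mem_univ κ.1))

theorem summable_mul_dropCount [Fintype K] (hT : 0 < T) {C : Edge K d → ℝ}
    (hC : ∀ κ, 0 ≤ C κ) (hCs : Summable C) (u : K → (Fin d → ℤ) → ℝ) (S : ℝ) :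
    Summable fun κ => C κ * dropCount R x T u S κ :=
  Summable.of_nonneg_of_le (fun κ => mul_nonneg (hC κ) (by unfold dropCount; positivity))
    (fun κ => mul_le_mul_of_nonneg_left (dropCount_le_sum R hT u S κ) (hC κ)) (hCs.mul_right _)

end Configurations

/-! ### The inner limit. -/

section Limit

variable {d : ℕ} [NeZero d] {K : Type*} [Fintype K]
variable (R : EuclideanSpace ℝ (Fin d) ≃ₗᵢ[ℝ] EuclideanSpace ℝ (Fin d))
variable {x : K → EuclideanSpace ℝ (Fin d)} {T : ℕ} {ν : EuclideanSpace ℝ (Fin d)}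

theorem hasDensity_annulusCount (hT : 0 < T) (hR : R (lastBasisVec d) = ν) (hν : ‖ν‖ = 1)
    {ω : K → ℝ} (hadm : Admissible x T ν ω)
    (hω : ∀ k z, (0 ≤ inner ℝ ν (site T (x k) z) ↔ 0 ≤ inner ℝ ν (site T (x k) z) + ω k))
    {r : ℝ} (hr0 : 0 < r) (hr1 : r < 1) :
    HasDensity x T (annulusCount R x T ν r)
      (fun κ => (1 - r ^ (d - 1)) * (max (jump x T ν ω κ) 0 / (T : ℝ) ^ d)) := by
  have hup := hasDensity_upCount R x hT hR hν hadm
  have hsub := hup.sub (hup.comp_mul hr0)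
  have hrim := (hasDensity_rimCount R x hT hR hν (M := 0) le_rfl).comp_mul hr0
  have hlow := hsub.sub hrim
  simp only [mul_zero, sub_zero] at hlow
  have hbd : ∀ᶠ S : ℝ in atTop, r * S ≤ S := by
    filter_upwards [eventually_ge_atTop 0] with S hS
    nlinarith
  have := HasDensity.squeeze hlow hsub
    (hbd.mono fun S hS κ => (annulusCount_bounds R hT hν hω hS κ).1)
    (hbd.mono fun S hS κ => (annulusCount_bounds R hT hν hω hS κ).2)
  simpa only [sub_mul, one_mul] using this

/-- The annulus contributes the flat energy with factor 1 - r^(d-1). In the small block, calibration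
from below and gluing with nearly optimal admissible potentials from above both give `relaxed` with
factor r^(d-1). -/
theorem tendsto_iInf_dropCount (hT : 0 < T) (hR : R (lastBasisVec d) = ν) (hν : ‖ν‖ = 1)
    {C : Edge K d → ℝ} (hC : ∀ κ, 0 ≤ C κ) (hCs : Summable C)
    (hD : Summable fun κ => C κ * ‖edgeVec x T κ‖)
    {ω₀ : K → ℝ} (hadm : Admissible x T ν ω₀)
    (hω₀ : ∀ k z, (0 ≤ inner ℝ ν (site T (x k) z) ↔ 0 ≤ inner ℝ ν (site T (x k) z) + ω₀ k))
    {r : ℝ} (hr0 : 0 < r) (hr1 : r < 1) :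
    Tendsto (fun S : ℝ => (⨅ u ∈ competitors R x T ν (r * S),
        ENNReal.ofReal (∑' κ, C κ * dropCount R x T u S κ)) / ENNReal.ofReal (S ^ (d - 1))) atTop
      (𝓝 (ENNReal.ofReal (((1 - r ^ (d - 1)) * posSum C (jump x T ν ω₀) +
        r ^ (d - 1) * relaxed C edgeSrc edgeTgt (slope (edgeVec x T) ν)) / (T : ℝ) ^ d))) := by
  have hν0 : ν ≠ 0 := by rintro rfl; simp at hν
  have hCC : ∀ κ, 0 ≤ C κ ∧ C κ ≤ C κ := fun κ => ⟨hC κ, le_rfl⟩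
  obtain ⟨α, hα, hαν, hdiv⟩ := exists_calibration hC hCs (edgeSrc (K := K) (d := d)) edgeTgt
    (summable_mul_slope hC hD ν)
  have hann := hasDensity_annulusCount R hT hR hν hadm hω₀ hr0 hr1
  have hannsum : ∑' κ, C κ * ((1 - r ^ (d - 1)) * (max (jump x T ν ω₀ κ) 0 / (T : ℝ) ^ d)) =
      (1 - r ^ (d - 1)) * posSum C (jump x T ν ω₀) / (T : ℝ) ^ d := by
    unfold posSum
    rw [← tsum_mul_left, ← tsum_div_const]
    exact tsum_congr fun κ => by ring
  have hrS : ∀ᶠ S : ℝ in atTop, r * S ≤ S := by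
    filter_upwards [eventually_ge_atTop 0] with S hS
    nlinarith
  have hquot : ∀ y S : ℝ, 0 < S →
      ENNReal.ofReal y / ENNReal.ofReal (S ^ (d - 1)) = ENNReal.ofReal (y / S ^ (d - 1)) :=
    fun y S hS => (ENNReal.ofReal_div_of_pos (pow_pos hS _)).symm
  rw [tendsto_order]
  constructor
  · intro l hl
    have hupd := ((hasDensity_upCount R x hT hR hν hadm).sub
      (hasDensity_downCount R x hT hR hν hadm)).comp_mul hr0
    have hrim := (hasDensity_rimCount R x hT hR hν (M := 0) le_rfl).comp_mul hr0
    have herr := hrim.add (hasDensity_farCount R x hT hr0 hr1)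
    have hlim := ((hann.tendsto_tsum hCs hD hCC).add (hupd.tendsto_tsum hCs hD hα)).sub
      (herr.tendsto_tsum hCs hD hCC)
    have hval : (∑' κ, C κ * ((1 - r ^ (d - 1)) * (max (jump x T ν ω₀ κ) 0 / (T : ℝ) ^ d))) +
        (∑' κ, α κ * (r ^ (d - 1) * (max (jump x T ν ω₀ κ) 0 / (T : ℝ) ^ d -
          max (-jump x T ν ω₀ κ) 0 / (T : ℝ) ^ d))) -
        (∑' κ : Edge K d, C κ * (r ^ (d - 1) * 0 + 0)) =
        ((1 - r ^ (d - 1)) * posSum C (jump x T ν ω₀) +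
          r ^ (d - 1) * relaxed C edgeSrc edgeTgt (slope (edgeVec x T) ν)) / (T : ℝ) ^ d := by
      have hg := Summable.mul_of_le hα (summable_mul_grad hCs (edgeSrc (K := K) (d := d)) edgeTgt ω₀)
      have hs := Summable.mul_of_le hα (summable_mul_slope hC hD ν)
      have e1 : ∑' κ, α κ * (r ^ (d - 1) * (max (jump x T ν ω₀ κ) 0 / (T : ℝ) ^ d -
          max (-jump x T ν ω₀ κ) 0 / (T : ℝ) ^ d)) =
          r ^ (d - 1) * (∑' κ, (α κ * slope (edgeVec x T) ν κ +
            α κ * grad edgeSrc edgeTgt ω₀ κ)) / (T : ℝ) ^ d := by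
        rw [← tsum_mul_left, ← tsum_div_const]
        refine tsum_congr fun κ => ?_
        -- Upward minus downward crossings give the signed jump, which is linear; its gradient part
        -- is annihilated by `α`, leaving the value of `relaxed`.
        have hm : max (jump x T ν ω₀ κ) 0 - max (-jump x T ν ω₀ κ) 0 =
            slope (edgeVec x T) ν κ + grad edgeSrc edgeTgt ω₀ κ :=
          max_zero_sub_max_neg_zero_eq_self (jump x T ν ω₀ κ)
        rw [← sub_div, hm]
        ring
      rw [hannsum, e1, hs.tsum_add hg, hdiv, hαν]
      simp only [mul_zero, add_zero, tsum_zero, sub_zero]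
      ring
    rw [hval] at hlim
    have hlim' := (ENNReal.continuous_ofReal.tendsto _).comp hlim
    filter_upwards [hlim'.eventually_const_lt hl, hrS, eventually_gt_atTop 0,
      hann.summable_mul hCs hD hCC, hupd.summable_mul hCs hD hα, herr.summable_mul hCs hD hCC]
      with S h1 h2 hS s1 s2 s3
    refine h1.trans_le ?_
    simp only [Function.comp]
    rw [← add_div, ← sub_div, ← hquot _ _ hS]
    refine ENNReal.div_le_div_right (le_iInf₂ fun u hu => ENNReal.ofReal_le_ofReal ?_) _
    obtain ⟨V, hV⟩ := dropCount_lower_bound R hT hν le_rfl hω₀ h2 hu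
    have hg := Summable.mul_of_le hα (summable_mul_grad hCs (edgeSrc (K := K) (d := d)) edgeTgt V)
    rw [← s1.tsum_add s2, ← (s1.add s2).tsum_sub s3]
    -- The deviation of the competitor enters only through this vanishing sum, so the bound is
    -- uniform in `u`.
    have hz : ∑' κ, α κ * grad edgeSrc edgeTgt V κ = 0 := hdiv V
    refine (le_add_of_nonneg_right hz.ge).trans ?_
    rw [← ((s1.add s2).sub s3).tsum_add hg]
    refine (((s1.add s2).sub s3).add hg).tsum_le_tsum (fun κ => ?_)
      (summable_mul_dropCount R hT hC hCs u S)
    refine le_trans (le_of_eq ?_) (hV κ (C κ) (α κ) (hα κ).1 (hα κ).2)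
    ring
  · intro l hl
    have hpot : ∃ ω : K → ℝ, Admissible x T ν ω ∧
        ENNReal.ofReal (((1 - r ^ (d - 1)) * posSum C (jump x T ν ω₀) +
          r ^ (d - 1) * posSum C (jump x T ν ω)) / (T : ℝ) ^ d) < l := by
      let f : ℝ → ℝ≥0∞ := fun y => ENNReal.ofReal (((1 - r ^ (d - 1)) *
        posSum C (jump x T ν ω₀) + r ^ (d - 1) * y) / (T : ℝ) ^ d)
      have hf : Continuous f := ENNReal.continuous_ofReal.comp (by fun_prop)
      have hmono : Monotone f := fun y y' h => ENNReal.ofReal_le_ofReal (by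
        have : 0 < r ^ (d - 1) := pow_pos hr0 _
        gcongr)
      have hev : ∀ᶠ y in 𝓝 (relaxed C edgeSrc edgeTgt (slope (edgeVec x T) ν)), f y < l :=
        (hf.tendsto _).eventually_lt_const hl
      obtain ⟨ε, hε, hball⟩ := Metric.eventually_nhds_iff.1 hev
      obtain ⟨ω, hω⟩ := exists_lt_of_ciInf_lt
        (lt_add_of_pos_right (relaxed C edgeSrc edgeTgt (slope (edgeVec x T) ν)) (half_pos hε))
      obtain ⟨ω', hω', hle⟩ := exists_admissible_le x hT hν0 hC hCs hD ω
      refine ⟨ω', hω', (hmono (hle.trans hω.le)).trans_lt (hball ?_)⟩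
      rw [Real.dist_eq, add_sub_cancel_left, abs_of_pos (half_pos hε)]
      exact half_lt_self hε
    obtain ⟨ω, hω, hωl⟩ := hpot
    have hup := (hasDensity_upCount R x hT hR hν hω).comp_mul hr0
    have hrim := (hasDensity_rimCount R x hT hR hν (norm_nonneg ω)).comp_mul hr0
    have htot := (hann.add hup).add hrim
    have hlim := htot.tendsto_tsum hCs hD hCC
    have hval : ∑' κ, C κ * ((1 - r ^ (d - 1)) * (max (jump x T ν ω₀ κ) 0 / (T : ℝ) ^ d) +
        r ^ (d - 1) * (max (jump x T ν ω κ) 0 / (T : ℝ) ^ d) + r ^ (d - 1) * 0) =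
        ((1 - r ^ (d - 1)) * posSum C (jump x T ν ω₀) +
          r ^ (d - 1) * posSum C (jump x T ν ω)) / (T : ℝ) ^ d := by
      have hj : ∀ ω, Summable fun κ => C κ * max (jump x T ν ω κ) 0 := fun ω =>
        summable_mul_posPart (summable_mul_add (summable_mul_slope hC hD ν)
          (summable_mul_grad hCs _ _ ω))
      unfold posSum
      rw [← tsum_mul_left, ← tsum_mul_left, ← ((hj ω₀).mul_left _).tsum_add ((hj ω).mul_left _),
        ← tsum_div_const]
      exact tsum_congr fun κ => by ring
    rw [hval] at hlim
    have hlim' := (ENNReal.continuous_ofReal.tendsto _).comp hlim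
    filter_upwards [hlim'.eventually_lt_const hωl, hrS, eventually_gt_atTop 0,
      htot.summable_mul hCs hD hCC] with S h1 h2 hS s1
    refine lt_of_le_of_lt ?_ h1
    simp only [Function.comp]
    rw [← hquot _ _ hS]
    refine ENNReal.div_le_div_right ((iInf₂_le (glued R x T ν ω (r * S))
      (glued_mem_competitors R ω (r * S))).trans (ENNReal.ofReal_le_ofReal ?_)) _
    refine (summable_mul_dropCount R hT hC hCs _ S).tsum_le_tsum (fun κ => ?_) s1
    exact mul_le_mul_of_nonneg_left (dropCount_glued_le R hT hν ω h2 κ) (hC κ)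

end Limit

/-! ### From the point set to the finite periodic graph. -/

section Reduction

variable {d : ℕ} {L : Set (EuclideanSpace ℝ (Fin d))} {T : ℕ}

theorem Periodic.site_mem (hper : Periodic L T) {p : EuclideanSpace ℝ (Fin d)} (hp : p ∈ L)
    (z : Fin d → ℤ) : site T p z ∈ L := by
  rw [← hper z]
  exact ⟨p, hp, rfl⟩

/-- The points of `L` in the fundamental cell of the period lattice. -/
abbrev Fundamental (L : Set (EuclideanSpace ℝ (Fin d))) (T : ℕ) :=
  {p : EuclideanSpace ℝ (Fin d) // p ∈ L ∧ p ∈ cell T 0}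

/-- On a grid whose cubes have diameter below the separation `r`, each cube contains at most one
point, and finitely many cubes meet the cell. -/
theorem Discrete.finite_fundamental (h : Discrete L) (T : ℕ) : Finite (Fundamental L T) := by
  obtain ⟨r, hr, hL⟩ := h
  set a : ℝ := r / (√d + 1) with ha
  have hs : 0 ≤ √(d : ℝ) := Real.sqrt_nonneg _
  have ha0 : 0 < a := by positivity
  have har : a * √d < r := by
    rw [ha, div_mul_eq_mul_div, div_lt_iff₀ (by positivity)]
    nlinarith
  let f : EuclideanSpace ℝ (Fin d) → Fin d → ℤ := fun p m => ⌊p m / a⌋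
  refine Set.Finite.to_subtype (s := {p | p ∈ L ∧ p ∈ cell T 0}) ?_
  refine Set.Finite.of_finite_image (f := f)
    ((Set.finite_Icc (fun _ => (0 : ℤ)) (fun _ => ⌊(T : ℝ) / a⌋)).subset ?_) ?_
  · rintro _ ⟨p, ⟨_, hp⟩, rfl⟩
    rw [mem_cell] at hp
    simp only [PiLp.zero_apply, zero_add] at hp
    exact ⟨fun m => Int.floor_nonneg.2 (div_nonneg (hp m).1 ha0.le),
      fun m => Int.floor_le_floor (div_le_div_of_nonneg_right (hp m).2.le ha0.le)⟩
  · rintro p ⟨hp, _⟩ q ⟨hq, _⟩ hpq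
    by_contra hne
    have h1 := hL p hp q hq (Ne.symm hne)
    have h2 : ‖p - q‖ ≤ a * √d := by
      refine norm_le_sqrt_mul ha0.le fun m => ?_
      have h3 : ⌊p m / a⌋ = ⌊q m / a⌋ := congrFun hpq m
      have h4 := Int.abs_sub_lt_one_of_floor_eq_floor h3
      rw [← sub_div, abs_div, abs_of_pos ha0, div_lt_one ha0] at h4
      exact h4.le
    rw [dist_eq_norm] at h1
    linarith

/-- Every point of `L` is a unique translate of a point of the fundamental cell. -/
noncomputable def siteEquiv (hT : 0 < T) (hper : Periodic L T) :
    Fundamental L T × (Fin d → ℤ) ≃ L :=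
  Equiv.ofBijective (fun kz => ⟨site T kz.1.1 kz.2, hper.site_mem kz.1.2.1 kz.2⟩) (by
    have hfloor : ∀ (k : Fundamental L T) (z : Fin d → ℤ) m,
        ⌊(site T k.1 z) m / T⌋ = z m := by
      intro k z m
      have h : site T k.1 z ∈ cell T (site T 0 z) := by
        rw [mem_cell]
        intro m
        have := mem_cell.1 k.2.2 m
        simp only [site, PiLp.add_apply, PiLp.zero_apply, zero_add] at this ⊢
        constructor <;> linarith [this.1, this.2]
      have := (mem_cell_site_iff hT).1 h m
      simpa using this
    constructor
    · rintro ⟨k, z⟩ ⟨l, w⟩ h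
      have h : site T k.1 z = site T l.1 w := congrArg Subtype.val h
      have hz : z = w := funext fun m => by rw [← hfloor k z m, ← hfloor l w m, h]
      subst hz
      have : k = l := Subtype.ext (add_right_cancel h)
      rw [this]
    · rintro ⟨p, hp⟩
      let z : Fin d → ℤ := fun m => ⌊p m / T⌋
      refine ⟨(⟨site T p (-z), hper.site_mem hp _, ?_⟩, z), Subtype.ext ?_⟩
      · have hT' : (0 : ℝ) < T := by exact_mod_cast hT
        rw [mem_cell]
        intro m
        have h1 := Int.floor_le (p m / T)
        have h2 := Int.lt_floor_add_one (p m / T)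
        rw [le_div_iff₀ hT'] at h1
        rw [div_lt_iff₀ hT'] at h2
        simp only [site, intVec, PiLp.add_apply, PiLp.smul_apply, PiLp.zero_apply, smul_eq_mul,
          Pi.neg_apply, Int.cast_neg, z]
        constructor <;> linarith
      · simp only [site, intVec_neg, smul_neg]
        abel)

variable (hT : 0 < T) (hper : Periodic L T)

theorem coe_siteEquiv (kz : Fundamental L T × (Fin d → ℤ)) :
    (siteEquiv hT hper kz : EuclideanSpace ℝ (Fin d)) = site T kz.1.1 kz.2 := rfl

/-- The interaction coefficients as a function of edges. -/
noncomputable def edgeCoeff (c : L → L → ℝ≥0) (κ : Edge (Fundamental L T) d) : ℝ :=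
  c (siteEquiv hT hper (κ.1, 0)) (siteEquiv hT hper (κ.2.1, κ.2.2))

variable {c : L → L → ℝ≥0}

theorem coeff_eq_edgeCoeff (hc : PeriodicCoeff L T c) (κ : Edge (Fundamental L T) d)
    (z : Fin d → ℤ) :
    (c (siteEquiv hT hper (κ.1, z)) (siteEquiv hT hper (κ.2.1, z + κ.2.2)) : ℝ) =
      edgeCoeff hT hper c κ := by
  unfold edgeCoeff
  rw [hc z (siteEquiv hT hper (κ.1, 0)) (siteEquiv hT hper (κ.2.1, κ.2.2))]
  · rw [coe_siteEquiv, coe_siteEquiv, ← site_add, zero_add]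
  · rw [coe_siteEquiv, coe_siteEquiv, ← site_add, add_comm]

theorem edgeCoeff_nonneg (κ : Edge (Fundamental L T) d) : 0 ≤ edgeCoeff hT hper c κ :=
  NNReal.coe_nonneg _

theorem site_zero (p : EuclideanSpace ℝ (Fin d)) : site T p 0 = p := by
  rw [site, intVec_zero, smul_zero, add_zero]

theorem summable_edgeCoeff_mul_norm [Fintype (Fundamental L T)] (hc : DecayingCoeff L c) :
    Summable fun κ : Edge (Fundamental L T) d =>
      edgeCoeff hT hper c κ * ‖edgeVec (fun k : Fundamental L T => k.1) T κ‖ := by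
  refine (summable_prod_of_nonneg fun κ => mul_nonneg (edgeCoeff_nonneg hT hper κ)
    (norm_nonneg _)).2 ⟨fun k => ?_, (hasSum_fintype _).summable⟩
  refine ((siteEquiv hT hper).summable_iff.2 (hc (siteEquiv hT hper (k, 0)))).congr fun lw => ?_
  simp only [Function.comp, edgeCoeff, edgeVec, coe_siteEquiv, site_zero]

/-- The first moment controls every edge of length at least `r`. By discreteness the only exception
for a given source is the loop from the point to itself, which is split off. -/
theorem summable_edgeCoeff [Fintype (Fundamental L T)] (hdisc : Discrete L)
    (hc : DecayingCoeff L c) :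
    Summable fun κ : Edge (Fundamental L T) d => edgeCoeff hT hper c κ := by
  classical
  obtain ⟨r, hr, hL⟩ := hdisc
  have hs := summable_edgeCoeff_mul_norm hT hper hc
  refine (summable_prod_of_nonneg fun κ => edgeCoeff_nonneg hT hper κ).2
    ⟨fun k => ?_, (hasSum_fintype _).summable⟩
  have hk := ((hs.prod_factor k).mul_left (1 / r)).add
    (summable_of_ne_finset_zero (s := {(k, (0 : Fin d → ℤ))})
      (f := fun lw : Fundamental L T × (Fin d → ℤ) =>
        if lw = (k, 0) then edgeCoeff hT hper c (k, lw) else 0) fun lw hlw => by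
      rw [if_neg (Finset.notMem_singleton.1 hlw)])
  refine Summable.of_nonneg_of_le (fun lw => edgeCoeff_nonneg hT hper _) (fun lw => ?_) hk
  by_cases hlw : lw = (k, 0)
  · rw [if_pos hlw]
    exact le_add_of_nonneg_left (mul_nonneg (by positivity)
      (mul_nonneg (edgeCoeff_nonneg hT hper _) (norm_nonneg _)))
  · rw [if_neg hlw, add_zero]
    have hne : siteEquiv hT hper lw ≠ siteEquiv hT hper (k, 0) :=
      fun h => hlw ((siteEquiv hT hper).injective h)
    have h1 := hL _ (siteEquiv hT hper (k, 0)).2 _ (siteEquiv hT hper lw).2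
      (fun h => hne (Subtype.ext h))
    rw [dist_eq_norm, coe_siteEquiv, coe_siteEquiv, site_zero] at h1
    have h2 : r ≤ ‖edgeVec (fun k : Fundamental L T => k.1) T (k, lw)‖ := h1
    have h3 := mul_le_mul_of_nonneg_left h2 (edgeCoeff_nonneg (c := c) hT hper (k, lw))
    rw [one_div, ← div_eq_inv_mul, le_div_iff₀ hr]
    exact h3

theorem tsum_ite_eq_ofReal_ncard {β : Type*} {P : β → Prop} [DecidablePred P]
    (h : {z | P z}.Finite) :
    ∑' z, (if P z then (1 : ℝ≥0∞) else 0) = ENNReal.ofReal (Set.ncard {z | P z}) := by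
  rw [tsum_eq_sum (s := h.toFinset) fun z hz => by
    rw [if_neg]; simpa using hz]
  have hP : ∀ z ∈ h.toFinset, P z := fun z hz => by simpa using hz
  rw [Finset.sum_congr rfl fun z hz => if_pos (hP z hz), Finset.sum_const,
    nsmul_eq_mul, mul_one, ENNReal.ofReal_natCast, Set.ncard_eq_toFinset_card _ h]

/-- For values in {0, 1} the positive part of a difference is the indicator of a drop. Writing the
target as a translate relative to the source and using periodicity groups equal coefficients. -/
theorem energy_block_eq [Fintype (Fundamental L T)] (hdisc : Discrete L)
    (hcper : PeriodicCoeff L T c) (hcdec : DecayingCoeff L c)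
    (R : EuclideanSpace ℝ (Fin d) ≃ₗᵢ[ℝ] EuclideanSpace ℝ (Fin d)) (S : ℝ) {u : L → ℝ}
    (hu : ∀ i, u i = 0 ∨ u i = 1) :
    energy L c u (block R S) = ENNReal.ofReal (∑' κ, edgeCoeff hT hper c κ *
      dropCount R (fun k : Fundamental L T => k.1) T
        (fun k z => u (siteEquiv hT hper (k, z))) S κ) := by
  classical
  set e := siteEquiv hT hper with he
  have hterm : ∀ (k : Fundamental L T) (z : Fin d → ℤ),
      Set.indicator {i : L | (i : EuclideanSpace ℝ (Fin d)) ∈ block R S}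
        (fun i => ∑' j : L, (c i j : ℝ≥0∞) * ENNReal.ofReal (max (u i - u j) 0)) (e (k, z)) =
      ∑' lw : Fundamental L T × (Fin d → ℤ), ENNReal.ofReal (edgeCoeff hT hper c (k, lw)) *
        (if site T k.1 z ∈ block R S ∧ u (e (k, z)) = 1 ∧ u (e (lw.1, z + lw.2)) = 0
          then (1 : ℝ≥0∞) else 0) := by
    intro k z
    by_cases hk : site T k.1 z ∈ block R S
    · rw [Set.indicator_of_mem (show e (k, z) ∈ {i : L | (i : EuclideanSpace ℝ (Fin d)) ∈ block R S} from hk), ← e.tsum_eq,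
        ← ((Equiv.refl (Fundamental L T)).prodCongr (Equiv.addLeft z)).tsum_eq]
      refine tsum_congr fun lw => ?_
      have h1 : ((Equiv.refl (Fundamental L T)).prodCongr (Equiv.addLeft z)) lw =
          (lw.1, z + lw.2) := rfl
      rw [h1, ← coeff_eq_edgeCoeff hT hper hcper (k, lw) z, ENNReal.ofReal_coe_nnreal]
      congr 1
      rcases hu (e (k, z)) with h2 | h2 <;> rcases hu (e (lw.1, z + lw.2)) with h3 | h3 <;>
        simp [h2, h3, hk]
    · rw [Set.indicator_of_notMem (show e (k, z) ∉ {i : L | (i : EuclideanSpace ℝ (Fin d)) ∈ block R S} from hk)]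
      simp [hk]
  unfold energy
  refine (tsum_subtype {i : L | (i : EuclideanSpace ℝ (Fin d)) ∈ block R S}
    (fun i => ∑' j : L, (c i j : ℝ≥0∞) * ENNReal.ofReal (max (u i - u j) 0))).trans ?_
  rw [← e.tsum_eq,
    ENNReal.tsum_prod' (f := fun kz => Set.indicator
      {i : L | (i : EuclideanSpace ℝ (Fin d)) ∈ block R S}
      (fun i => ∑' j : L, (c i j : ℝ≥0∞) * ENNReal.ofReal (max (u i - u j) 0)) (e kz))]
  simp only [hterm]
  rw [ENNReal.ofReal_tsum_of_nonneg (fun κ => mul_nonneg (edgeCoeff_nonneg hT hper κ)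
    (by unfold dropCount; positivity)) (summable_mul_dropCount R hT
      (fun κ => edgeCoeff_nonneg hT hper κ) (summable_edgeCoeff hT hper hdisc hcdec) _ S),
    ENNReal.tsum_prod' (α := Fundamental L T) (β := Fundamental L T × (Fin d → ℤ))]
  refine tsum_congr fun k => ?_
  rw [ENNReal.tsum_comm]
  refine tsum_congr fun lw => ?_
  rw [ENNReal.tsum_mul_left, ENNReal.ofReal_mul (edgeCoeff_nonneg hT hper _)]
  congr 1
  exact tsum_ite_eq_ofReal_ncard
    ((finite_site_mem_block R hT k.1 S).subset fun z hz => hz.1)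

theorem cellInf_eq [Fintype (Fundamental L T)] (hdisc : Discrete L)
    (hcper : PeriodicCoeff L T c) (hcdec : DecayingCoeff L c)
    (R : EuclideanSpace ℝ (Fin d) ≃ₗᵢ[ℝ] EuclideanSpace ℝ (Fin d))
    (ν : EuclideanSpace ℝ (Fin d)) (δ S : ℝ) :
    cellInf L c R ν δ S = ⨅ u ∈ competitors R (fun k : Fundamental L T => k.1) T ν ((1 - δ) * S),
      ENNReal.ofReal (∑' κ, edgeCoeff hT hper c κ *
        dropCount R (fun k : Fundamental L T => k.1) T u S κ) := by
  unfold cellInf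
  simp only [image_cube_eq_block]
  set e := siteEquiv hT hper with he
  refine le_antisymm (le_iInf₂ fun u hu => ?_) (le_iInf₂ fun u hu => ?_)
  · have hmem : (fun i => u (e.symm i).1 (e.symm i).2) ∈ {u : L → ℝ | (∀ i, u i = 0 ∨ u i = 1) ∧
        ∀ i : L, (i : EuclideanSpace ℝ (Fin d)) ∉ block R ((1 - δ) * S) →
          u i = halfSpace ν i} := by
      refine ⟨fun i => hu.1 _ _, fun i hi => ?_⟩
      have h1 : (i : EuclideanSpace ℝ (Fin d)) = site T (e.symm i).1.1 (e.symm i).2 := by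
        conv_lhs => rw [← e.apply_symm_apply i]
        rfl
      rw [h1] at hi ⊢
      exact hu.2 _ _ hi
    refine (iInf₂_le _ hmem).trans (le_of_eq ?_)
    rw [energy_block_eq hT hper hdisc hcper hcdec R S hmem.1]
    simp only [← he, Equiv.symm_apply_apply]
  · have hmem : (fun k z => u (e (k, z))) ∈
        competitors R (fun k : Fundamental L T => k.1) T ν ((1 - δ) * S) :=
      ⟨fun k z => hu.1 _, fun k z hz => hu.2 (e (k, z)) hz⟩
    refine (iInf₂_le _ hmem).trans (le_of_eq ?_)
    rw [energy_block_eq hT hper hdisc hcper hcdec R S hu.1]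

end Reduction

/-! ### The cell formula as the unique surface density. -/

section SurfaceDensity

variable {d : ℕ} {L : Set (EuclideanSpace ℝ (Fin d))} {T : ℕ}

/-- The surface energy density given by the periodic cell formula. -/
noncomputable def cellDensity (hT : 0 < T) (hper : Periodic L T) (c : L → L → ℝ≥0)
    (ν : EuclideanSpace ℝ (Fin d)) : ℝ :=
  relaxed (edgeCoeff hT hper c) edgeSrc edgeTgt
    (slope (edgeVec (fun k : Fundamental L T => k.1) T) ν) / (T : ℝ) ^ d

variable {c : L → L → ℝ≥0}

theorem differentiableAt_cellDensity (hdisc : Discrete L) (hT : 0 < T) (hper : Periodic L T)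
    (hcdec : DecayingCoeff L c) {ν : EuclideanSpace ℝ (Fin d)} (hν : TotallyIrrational ν) :
    DifferentiableAt ℝ (cellDensity hT hper c) ν := by
  classical
  have := hdisc.finite_fundamental T
  have := Fintype.ofFinite (Fundamental L T)
  have := differentiableAt_relaxed_slope (fun κ => edgeCoeff_nonneg (c := c) hT hper κ)
    (summable_edgeCoeff hT hper hdisc hcdec) edgeSrc edgeTgt
    (summable_edgeCoeff_mul_norm hT hper hcdec)
    (fun ω ξ => exists_compatible_potential (fun k : Fundamental L T => k.1) hT hν ω ξ)
  unfold cellDensity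
  simp only [div_eq_mul_inv]
  exact DifferentiableAt.mul_const this _

variable [NeZero d]

theorem isSurfaceDensity_cellDensity (hdisc : Discrete L) (hT : 0 < T) (hper : Periodic L T)
    (hcper : PeriodicCoeff L T c) (hcdec : DecayingCoeff L c) :
    IsSurfaceDensity L c (cellDensity hT hper c) := by
  classical
  have := hdisc.finite_fundamental T
  have := Fintype.ofFinite (Fundamental L T)
  have hC := fun κ => edgeCoeff_nonneg (c := c) hT hper κ
  have hCs := summable_edgeCoeff hT hper hdisc hcdec
  have hD := summable_edgeCoeff_mul_norm hT hper hcdec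
  have hTd : (0 : ℝ) < (T : ℝ) ^ d := by positivity
  refine ⟨fun ν => div_nonneg (relaxed_nonneg hC _ _ _) hTd.le, ?_, fun t ν ht => ?_, ?_⟩
  · have := (convexOn_relaxed_slope hC hCs edgeSrc edgeTgt hD).smul (inv_nonneg.2 hTd.le)
    refine this.congr fun ν _ => ?_
    simp only [cellDensity, smul_eq_mul, div_eq_inv_mul]
  · unfold cellDensity
    rw [slope_smul, relaxed_smul _ _ _ _ ht, mul_div_assoc]
  · intro ν hν R hR
    obtain ⟨ω₀, hadm, hω₀⟩ := exists_admissible_planar (T := T) (ν := ν)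
      (fun k : Fundamental L T => k.1) hT (by rintro rfl; simp at hν)
    -- This is the inner limit with r = 1 - δ. It is continuous in δ, and at δ = 0 the flat energy
    -- `P` drops out.
    refine ⟨fun δ => ENNReal.ofReal (((1 - (1 - δ) ^ (d - 1)) * posSum (edgeCoeff hT hper c)
      (jump (fun k : Fundamental L T => k.1) T ν ω₀) + (1 - δ) ^ (d - 1) *
      relaxed (edgeCoeff hT hper c) edgeSrc edgeTgt
        (slope (edgeVec (fun k : Fundamental L T => k.1) T) ν)) / (T : ℝ) ^ d), ?_, ?_⟩
    · intro δ h0 h1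
      simp only [cellInf_eq hT hper hdisc hcper hcdec]
      exact tendsto_iInf_dropCount R hT hR hν hC hCs hD hadm hω₀ (by linarith) (by linarith)
    · set P := posSum (edgeCoeff hT hper c) (jump (fun k : Fundamental L T => k.1) T ν ω₀)
      set Φ := relaxed (edgeCoeff hT hper c) edgeSrc edgeTgt
        (slope (edgeVec (fun k : Fundamental L T => k.1) T) ν) with hΦ
      have hcont : Continuous fun δ : ℝ =>
          ((1 - (1 - δ) ^ (d - 1)) * P + (1 - δ) ^ (d - 1) * Φ) / (T : ℝ) ^ d := by fun_prop
      have hlim := (ENNReal.continuous_ofReal.comp hcont).tendsto 0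
      simp only [Function.comp, sub_zero, one_pow, sub_self, zero_mul, zero_add, one_mul] at hlim
      exact hlim.mono_left nhdsWithin_le_nhds

theorem norm_lastBasisVec : ‖lastBasisVec d‖ = 1 := by
  simp [lastBasisVec]

theorem exists_isometry_lastBasisVec {ν : EuclideanSpace ℝ (Fin d)} (hν : ‖ν‖ = 1) :
    ∃ R : EuclideanSpace ℝ (Fin d) ≃ₗᵢ[ℝ] EuclideanSpace ℝ (Fin d), R (lastBasisVec d) = ν :=
  ⟨_, Submodule.reflection_sub (norm_lastBasisVec.trans hν.symm)⟩

/-- Uniqueness of limits settles unit vectors, since the inner limits agree for δ in (0, 1).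
Homogeneity extends this to nonzero vectors, and φ(0) = 2 φ(0) handles the origin. -/
theorem IsSurfaceDensity.unique {φ ψ : EuclideanSpace ℝ (Fin d) → ℝ}
    (hφ : IsSurfaceDensity L c φ) (hψ : IsSurfaceDensity L c ψ) : φ = ψ := by
  have hunit : ∀ ν, ‖ν‖ = 1 → φ ν = ψ ν := by
    intro ν hν
    obtain ⟨R, hR⟩ := exists_isometry_lastBasisVec hν
    obtain ⟨g, hg, hg0⟩ := hφ.limit ν hν R hR
    obtain ⟨g', hg', hg0'⟩ := hψ.limit ν hν R hR
    have hev : g =ᶠ[𝓝[>] 0] g' := by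
      filter_upwards [Ioo_mem_nhdsGT (zero_lt_one (α := ℝ))] with δ hδ
      exact tendsto_nhds_unique (hg δ hδ.1 hδ.2) (hg' δ hδ.1 hδ.2)
    have := tendsto_nhds_unique (hg0.congr' hev) hg0'
    exact (ENNReal.ofReal_eq_ofReal_iff (hφ.nonneg ν) (hψ.nonneg ν)).1 this
  have hzero : ∀ {φ : EuclideanSpace ℝ (Fin d) → ℝ}, IsSurfaceDensity L c φ → φ 0 = 0 := by
    intro φ h
    have := h.homogeneous 2 0 two_pos
    rw [smul_zero] at this
    linarith
  ext y
  by_cases hy : y = 0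
  · rw [hy, hzero hφ, hzero hψ]
  · have hpos : 0 < ‖y‖ := norm_pos_iff.2 hy
    have h1 : y = ‖y‖ • (‖y‖⁻¹ • y) := by rw [smul_smul, mul_inv_cancel₀ hpos.ne', one_smul]
    rw [h1, hφ.homogeneous _ _ hpos, hψ.homogeneous _ _ hpos, hunit]
    rw [norm_smul, norm_inv, norm_norm, inv_mul_cancel₀ hpos.ne']

end SurfaceDensity

end SpinLattice

theorem proposition2p9 (d : ℕ) [NeZero d] (L : Set (EuclideanSpace ℝ (Fin d)))
    (hdisc : SpinLattice.Discrete L) (T : ℕ) (hT : 0 < T) (hper : SpinLattice.Periodic L T)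
    (c : L → L → ℝ≥0) (hcper : SpinLattice.PeriodicCoeff L T c)
    (hcdec : SpinLattice.DecayingCoeff L c) :
    (∃! φ : EuclideanSpace ℝ (Fin d) → ℝ, SpinLattice.IsSurfaceDensity L c φ) ∧
    ∀ φ : EuclideanSpace ℝ (Fin d) → ℝ, SpinLattice.IsSurfaceDensity L c φ →
      ∀ ν : EuclideanSpace ℝ (Fin d), SpinLattice.TotallyIrrational ν →
        DifferentiableAt ℝ φ ν := by
  have hφ := SpinLattice.isSurfaceDensity_cellDensity hdisc hT hper hcper hcdec
  refine ⟨⟨_, hφ, fun ψ hψ => hψ.unique hφ⟩, fun φ h ν hν => ?_⟩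
  rw [h.unique hφ]
  exact SpinLattice.differentiableAt_cellDensity hdisc hT hper hcdec hν
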